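/- Let $n\ge 1$ and let $H_0$ be an $n\times n$ complex Ginibre matrix, i.e. its entries are i.i.d. complex Gaussian with $\mathbb{E}h=0$, $\mathbb{E}|h|^2=1/n$, $\mathbb{E}h^2=0$. Let $A_0$ be an $n\times n$ complex matrix, $z\in\mathbb{C}$, $\varepsilon>0$, and put $$Y(z)=(A_0+H_0-z)(A_0+H_0-z)^*,\qquad T(z,\varepsilon)=\mathbb{E}\Big\{\frac1n\mathrm{Tr}\,(Y(z)+\varepsilon^2)^{-1}\Big\},$$ $$Y_0(z)=(A_0-z)(A_0-z)^*,\qquad \mathcal{L}_n(x)=\frac1n\log\det(Y_0(z)+x),\qquad G(x)=(Y_0(z)+x)^{-1}.$$ Let $\varepsilon_0>0$ and let $L=\mathbb{R}+i\varepsilon_0$, oriented from left to right. Then, if $A_0$ is deterministic, $$T(z,\varepsilon)=-\frac{n^3}{\pi^3\varepsilon}\int_{\mathbb{R}^2}(u_1+\varepsilon)\,du_1du_2\int_{L\times L}dt_1dt_2\int_{(0,\infty)^2}r_1r_2\,dr_1dr_2\;\varphi(u_1,u_2,t_1,t_2)\,e^{nF_1(u_1,u_2)}\,e^{nF_2(t_1,t_2,r_1,r_2)},$$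 where the integrals are taken successively (first over $(r_1,r_2)$, then over $(t_1,t_2)$, then over $(u_1,u_2)$), each of them converges absolutely (the first two for every $u=(u_1,u_2)\neq 0$), and, with $|u|^2=u_1^2+u_2^2$, $$F_1(u_1,u_2)=\mathcal{L}_n(|u|^2)-(u_1+\varepsilon)^2-u_2^2,$$ $$F_2(t_1,t_2,r_1,r_2)=-\mathcal{L}_n(-t_1t_2)-(r_1r_2)^2-ir_1r_2(t_1+t_2)-\varepsilon(r_1^2+r_2^2),$$ $$\begin{aligned}\varphi(u_1,u_2,t_1,t_2)=&\Big(1-\frac1n\mathrm{Tr}\,G(-t_1t_2)+\frac{|u|^2}{n}\mathrm{Tr}\,G(|u|^2)G(-t_1t_2)\Big)^2+t_1t_2|u|^2\Big(\frac1n\mathrm{Tr}\,G(|u|^2)G(-t_1t_2)\Big)^2\\&+\frac{|u|^2+t_1t_2}{n^2}\Big(\mathrm{Tr}\,G(|u|^2)G^2(-t_1t_2)-|u|^2\,\mathrm{Tr}\,G^2(|u|^2)G^2(-t_1t_2)\Big).\end{aligned}$$ If $A_0$ is random and independent of $H_0$, then the right-hand side, evaluated at $A_0$, is almost surely equal to the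 conditional expectation of $\frac1n\mathrm{Tr}\,(Y(z)+\varepsilon^2)^{-1}$ given $A_0$, and consequently $T(z,\varepsilon)$ is the expectation of the right-hand side. -/

import Mathlib

open MeasureTheory ProbabilityTheory Set
open scoped Matrix NNReal

noncomputable section

namespace DeformedGinibre

/-- The centred circular complex Gaussian law on `ℂ` with `𝔼 |h|² = v` and `𝔼 h² = 0`: real and
imaginary parts are independent real Gaussians with mean `0` and variance `v / 2`. -/
def complexGaussian (v : ℝ≥0) : Measure ℂ :=
  ((gaussianReal 0 (v / 2)).prod (gaussianReal 0 (v / 2))).map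
    (fun p : ℝ × ℝ => (p.1 : ℂ) + (p.2 : ℂ) * Complex.I)

/-- The family of all entries of a random matrix, as a random vector. -/
def entries {Ω : Type*} {n : ℕ} (M : Ω → Matrix (Fin n) (Fin n) ℂ) :
    Ω → (Fin n × Fin n → ℂ) :=
  fun ω p => M ω p.1 p.2

/-- `H₀` is drawn from the complex Ginibre ensemble: the entries are i.i.d. complex Gaussian with
`𝔼 h = 0`, `𝔼 |h|² = 1 / n`, `𝔼 h² = 0`. -/
structure IsComplexGinibre {Ω : Type*} [MeasurableSpace Ω] (P : Measure Ω) {n : ℕ}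
    (H₀ : Ω → Matrix (Fin n) (Fin n) ℂ) : Prop where
  measurable : Measurable (entries H₀)
  indep : iIndepFun (fun (p : Fin n × Fin n) (ω : Ω) => H₀ ω p.1 p.2) P
  law : ∀ i j, P.map (fun ω => H₀ ω i j) = complexGaussian (1 / (n : ℝ≥0))

variable {n : ℕ}

/-- `n⁻¹ Tr ((H - z)(H - z)^* + ε²)⁻¹`. -/
def resolventTrace (H : Matrix (Fin n) (Fin n) ℂ) (z : ℂ) (ε : ℝ) : ℂ :=
  (n : ℂ)⁻¹ * Matrix.trace
    (((H - Matrix.scalar (Fin n) z) * (H - Matrix.scalar (Fin n) z)ᴴ +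
      Matrix.scalar (Fin n) ((ε : ℂ) ^ 2))⁻¹)

/-- `T(z, ε) = 𝔼 { n⁻¹ Tr (Y(z) + ε²)⁻¹ }`, where `Y(z) = (H - z)(H - z)^*` and `H = A₀ + H₀`. -/
def T {Ω : Type*} [MeasurableSpace Ω] (P : Measure Ω) (A₀ H₀ : Ω → Matrix (Fin n) (Fin n) ℂ)
    (z : ℂ) (ε : ℝ) : ℂ :=
  ∫ ω, resolventTrace (A₀ ω + H₀ ω) z ε ∂P

/-- `Y₀(z) = (A₀ - z)(A₀ - z)^*`. -/
def Y₀ (A : Matrix (Fin n) (Fin n) ℂ) (z : ℂ) : Matrix (Fin n) (Fin n) ℂ :=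
  (A - Matrix.scalar (Fin n) z) * (A - Matrix.scalar (Fin n) z)ᴴ

/-- `𝓛_n(x) = n⁻¹ log det (Y₀(z) + x)`. It is only used inside `exp (n 𝓛_n(x))`, where
the choice of the branch of the logarithm plays no role. -/
def Ln (A : Matrix (Fin n) (Fin n) ℂ) (z x : ℂ) : ℂ :=
  (n : ℂ)⁻¹ * Complex.log (Y₀ A z + Matrix.scalar (Fin n) x).det

/-- `G(x) = (Y₀(z) + x)⁻¹`. -/
def G (A : Matrix (Fin n) (Fin n) ℂ) (z x : ℂ) : Matrix (Fin n) (Fin n) ℂ :=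
  (Y₀ A z + Matrix.scalar (Fin n) x)⁻¹

/-- `F₁(u₁, u₂) = 𝓛_n(u₁² + u₂²) - (u₁ + ε)² - u₂²`. -/
def F₁ (A : Matrix (Fin n) (Fin n) ℂ) (z : ℂ) (ε u₁ u₂ : ℝ) : ℂ :=
  Ln A z ((u₁ : ℂ) ^ 2 + (u₂ : ℂ) ^ 2) - ((u₁ : ℂ) + ε) ^ 2 - (u₂ : ℂ) ^ 2

/-- `F₂(t₁, t₂, r₁, r₂) = -𝓛_n(-t₁t₂) - (r₁r₂)² - i r₁r₂(t₁ + t₂) - ε(r₁² + r₂²)`. -/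
def F₂ (A : Matrix (Fin n) (Fin n) ℂ) (z : ℂ) (ε : ℝ) (t₁ t₂ : ℂ) (r₁ r₂ : ℝ) : ℂ :=
  -Ln A z (-(t₁ * t₂)) - ((r₁ : ℂ) * r₂) ^ 2 - Complex.I * r₁ * r₂ * (t₁ + t₂)
    - ε * ((r₁ : ℂ) ^ 2 + (r₂ : ℂ) ^ 2)

/-- The function `φ(u₁, u₂, t₁, t₂)`; here `q = |u|² = u ū = u₁² + u₂²` and `w = t₁ t₂`. -/
def φ (A : Matrix (Fin n) (Fin n) ℂ) (z : ℂ) (u₁ u₂ : ℝ) (t₁ t₂ : ℂ) : ℂ :=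
  let q : ℂ := (u₁ : ℂ) ^ 2 + (u₂ : ℂ) ^ 2
  let w : ℂ := t₁ * t₂
  (1 - (n : ℂ)⁻¹ * (G A z (-w)).trace + q * (n : ℂ)⁻¹ * (G A z q * G A z (-w)).trace) ^ 2
    + w * q * ((n : ℂ)⁻¹ * (G A z q * G A z (-w)).trace) ^ 2
    + (q + w) / (n : ℂ) ^ 2 *
      ((G A z q * G A z (-w) ^ 2).trace - q * (G A z q ^ 2 * G A z (-w) ^ 2).trace)

/-- The full integrand `(u₁ + ε) r₁r₂ φ exp (n F₁) exp (n F₂)`, with `u = (u₁, u₂)`,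
`r = (r₁, r₂)`, and with `t₁ = s₁ + i ε₀`, `t₂ = s₂ + i ε₀` on the line `L = ℝ + i ε₀`
parametrized by `s = (s₁, s₂)`. -/
def integrand (A : Matrix (Fin n) (Fin n) ℂ) (z : ℂ) (ε ε₀ : ℝ) (u s r : ℝ × ℝ) : ℂ :=
  let t₁ : ℂ := s.1 + ε₀ * Complex.I
  let t₂ : ℂ := s.2 + ε₀ * Complex.I
  ((u.1 : ℂ) + ε) * (r.1 * r.2) * φ A z u.1 u.2 t₁ t₂ *
    Complex.exp (n * F₁ A z ε u.1 u.2) * Complex.exp (n * F₂ A z ε t₁ t₂ r.1 r.2)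

/-- The integral over `r₁, r₂ > 0`. -/
def rIntegral (A : Matrix (Fin n) (Fin n) ℂ) (z : ℂ) (ε ε₀ : ℝ) (u s : ℝ × ℝ) : ℂ :=
  ∫ r in Ioi (0 : ℝ) ×ˢ Ioi (0 : ℝ), integrand A z ε ε₀ u s r

/-- The integral over `t₁, t₂ ∈ L` of the integral over `r₁, r₂ > 0`. -/
def tIntegral (A : Matrix (Fin n) (Fin n) ℂ) (z : ℂ) (ε ε₀ : ℝ) (u : ℝ × ℝ) : ℂ :=
  ∫ s : ℝ × ℝ, rIntegral A z ε ε₀ u s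

/-- All the successive integrals converge absolutely (`G(|u|²)` may be undefined at `u = 0`). -/
structure Converges (A : Matrix (Fin n) (Fin n) ℂ) (z : ℂ) (ε ε₀ : ℝ) : Prop where
  r : ∀ u s : ℝ × ℝ, u ≠ 0 →
    IntegrableOn (integrand A z ε ε₀ u s) (Ioi (0 : ℝ) ×ˢ Ioi (0 : ℝ))
  t : ∀ u : ℝ × ℝ, u ≠ 0 → Integrable (rIntegral A z ε ε₀ u)
  u : Integrable (tIntegral A z ε ε₀)

/-- `- n³ / (π³ ε) ∫ (u₁ + ε) du₁ du₂ ∫_L dt₁ dt₂ ∫ r₁ r₂ dr₁ dr₂ φ exp (n F₁) exp (n F₂)`. -/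
def representation (A : Matrix (Fin n) (Fin n) ℂ) (z : ℂ) (ε ε₀ : ℝ) : ℂ :=
  -((n : ℂ) ^ 3 / ((Real.pi : ℂ) ^ 3 * ε)) * ∫ u : ℝ × ℝ, tIntegral A z ε ε₀ u

end DeformedGinibre

end

/-! Write M = A₀ + H₀ - z. By Jacobi's formula, Tr (MM* + ε²)⁻¹ is the derivative of det (MM* + q)
at q = ε² divided by det (MM* + ε²). The inverse determinant is a Gaussian integral over two vectors
φ₁, φ₂ ∈ ℂⁿ of the character exp (-2i Re φ₁* M φ₂) (`inv_det_eq_integral`), and the numerator is a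
polynomial in the entries of M and their conjugates. Averaging over H₀ is thus a Gaussian average of
a polynomial against a character, and ordinary integrals suffice.

The average is taken column by column. Since det (q + X + b cᵀ) is affine in b and in c, only first
moments and covariances enter (`integral_shiftPoly_column`): b and c move to complex points, and the
covariance contributes v ∂_q with v = 1/n. Over all columns, a monomial q^m is acted on by (1 + v
∂_q)^m, and ∂_q (1 + v ∂_q)^m q^m at ε² is a planar Gaussian integral of (u₁ + ε)|u|^(2m)
(`integral_shifted_pow`). This produces the u-integral (`integral_trace_resolvent`). The character
averages to the quartic weight exp (-v |φ₁|²|φ₂|²), and the determinant left over is a rank-two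
perturbation of det (Y₀ + |u|²), equal to it times `quadFactor` (`det_rank_two_perturbation`).

It remains to turn the (φ₁, φ₂)-integral into the (t, r)-integral. Let Θ be `quadFactor` times the
character. Against the weight exp (-β₁|φ₁|² - β₂|φ₂|²) with β_j = -i t_j, Θ integrates to π^(2n)
times the function φ of the statement over det (Y₀ - t₁t₂) (`integral_quadFactor`). As a function of
t this is the Fourier transform of the density of Θ in y_j = |φ_j|². Scaling φ₁ has the same effect
on Θ as scaling φ₂, so this density has the form J(y₁y₂) (`exists_radial_density`). The r-integral
superposes the characters exp (-ik(t₁ + t₂)), k = n r₁r₂, so Fourier inversion in t evaluates the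
density at the diagonal point (k, k) (`integral_fourier₂_mul`). There J(k²) = J(n r₁² · n r₂²), and
the substitution y_j = n r_j² recovers the vector integral with its quartic weight
(`integral_resolventFactor_mul_radialIntegral`). The height ε₀ of the contour only damps the
density, and cancels on the diagonal.

Absolute convergence in t follows from decay like 1 / (|t₁||t₂||t₁ + t₂|). For random A₀,
independence makes the conditional law of H₀ equal to its law. -/

namespace DeformedGinibre

/-! ### Moments of product weights -/

/-- Under the complex weight `w`, the functions `A` and `B` have normalized first moments `a`, `b`
and normalized covariance `κ`. -/
structure PairMoments {α : Type*} [MeasurableSpace α] (μ : Measure α) (w A B : α → ℂ)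
    (Z a b κ : ℂ) : Prop where
  integrable : Integrable w μ
  integrable_left : Integrable (fun x => w x * A x) μ
  integrable_right : Integrable (fun x => w x * B x) μ
  integrable_mul : Integrable (fun x => w x * (A x * B x)) μ
  integral : ∫ x, w x ∂μ = Z
  integral_left : ∫ x, w x * A x ∂μ = Z * a
  integral_right : ∫ x, w x * B x ∂μ = Z * b
  integral_mul : ∫ x, w x * (A x * B x) ∂μ = Z * (a * b + κ)

section Pi

variable {α ι : Type*} [MeasurableSpace α] [Fintype ι] {μ : Measure α}
  {w : ι → α → ℂ} {A B : α → ℂ} {Z a b κ : ι → ℂ}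

theorem PairMoments.pi_one [SigmaFinite μ]
    (h : ∀ l, PairMoments μ (w l) A B (Z l) (a l) (b l) (κ l)) :
    Integrable (fun φ : ι → α => ∏ l, w l (φ l)) (Measure.pi fun _ => μ) ∧
    ∫ φ : ι → α, ∏ l, w l (φ l) ∂(Measure.pi fun _ => μ) = ∏ l, Z l := by
  constructor
  · exact Integrable.fintype_prod fun l => (h l).integrable
  · rw [integral_fintype_prod_eq_prod w]
    exact Finset.prod_congr rfl fun l _ => (h l).integral

variable [DecidableEq ι]

/-- Writing the extra factors as products over all coordinates, trivial except at one index, keeps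
the integrand a pure product, so that its integral factorizes. The case i = k is included. -/
theorem prod_mul_ite_mul_ite (w : ι → ℂ) (A B : ι → ℂ) (i k : ι) :
    ∏ l, (w l * ((if l = i then A l else 1) * (if l = k then B l else 1)))
      = (∏ l, w l) * (A i * B k) := by
  rw [Finset.prod_mul_distrib, Finset.prod_mul_distrib, Finset.prod_ite_eq', Finset.prod_ite_eq']
  simp

theorem prod_mul_ite (w : ι → ℂ) (A : ι → ℂ) (i : ι) :
    ∏ l, (w l * (if l = i then A l else 1)) = (∏ l, w l) * A i := by
  rw [Finset.prod_mul_distrib, Finset.prod_ite_eq']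
  simp

theorem PairMoments.swap {w A B : α → ℂ} {Z a b κ : ℂ} (h : PairMoments μ w A B Z a b κ) :
    PairMoments μ w B A Z b a κ where
  integrable := h.integrable
  integrable_left := h.integrable_right
  integrable_right := h.integrable_left
  integrable_mul := by simpa only [mul_comm] using h.integrable_mul
  integral := h.integral
  integral_left := h.integral_right
  integral_right := h.integral_left
  integral_mul := by
    rw [mul_comm b a, ← h.integral_mul]
    simp only [mul_comm]

variable [SigmaFinite μ]

theorem PairMoments.pi_left (h : ∀ l, PairMoments μ (w l) A B (Z l) (a l) (b l) (κ l)) (i : ι) :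
    Integrable (fun φ : ι → α => (∏ l, w l (φ l)) * A (φ i)) (Measure.pi fun _ => μ) ∧
    ∫ φ : ι → α, (∏ l, w l (φ l)) * A (φ i) ∂(Measure.pi fun _ => μ) = (∏ l, Z l) * a i := by
  have key : (fun φ : ι → α => (∏ l, w l (φ l)) * A (φ i)) =
      fun φ => ∏ l, (w l (φ l) * (if l = i then A (φ l) else 1)) := by
    funext φ
    exact (prod_mul_ite (fun l => w l (φ l)) (fun l => A (φ l)) i).symm
  rw [key]
  constructor
  · refine Integrable.fintype_prod (f := fun l x => w l x * (if l = i then A x else 1)) fun l => ?_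
    by_cases hl : l = i
    · simpa [hl] using (h i).integrable_left
    · simpa [hl] using (h l).integrable
  · rw [integral_fintype_prod_eq_prod (fun l x => w l x * (if l = i then A x else 1)),
      ← prod_mul_ite Z a i]
    refine Finset.prod_congr rfl fun l _ => ?_
    by_cases hl : l = i
    · simpa [hl] using (h i).integral_left
    · simpa [hl] using (h l).integral

/-- Different coordinates are independent under the product weight, so the covariance appears only
when both factors sit on the same coordinate. -/
theorem PairMoments.pi_mul (h : ∀ l, PairMoments μ (w l) A B (Z l) (a l) (b l) (κ l)) (i k : ι) :
    Integrable (fun φ : ι → α => (∏ l, w l (φ l)) * (A (φ i) * B (φ k)))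
      (Measure.pi fun _ => μ) ∧
    ∫ φ : ι → α, (∏ l, w l (φ l)) * (A (φ i) * B (φ k)) ∂(Measure.pi fun _ => μ)
      = (∏ l, Z l) * (a i * b k + if i = k then κ i else 0) := by
  have key : (fun φ : ι → α => (∏ l, w l (φ l)) * (A (φ i) * B (φ k))) =
      fun φ => ∏ l, (w l (φ l) * ((if l = i then A (φ l) else 1) *
        (if l = k then B (φ l) else 1))) := by
    funext φ
    exact (prod_mul_ite_mul_ite (fun l => w l (φ l)) (fun l => A (φ l)) (fun l => B (φ l)) i k).symm
  rw [key]
  constructor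
  · refine Integrable.fintype_prod (f := fun l x => w l x * ((if l = i then A x else 1) *
      (if l = k then B x else 1))) fun l => ?_
    obtain rfl | hl := eq_or_ne l i
    · obtain rfl | hk := eq_or_ne l k
      · simpa using (h l).integrable_mul
      · simpa [hk] using (h l).integrable_left
    · obtain rfl | hk := eq_or_ne l k
      · simpa [hl] using (h l).integrable_right
      · simpa [hl, hk] using (h l).integrable
  · rw [integral_fintype_prod_eq_prod (fun l x => w l x * ((if l = i then A x else 1) *
      (if l = k then B x else 1)))]
    by_cases hik : i = k
    · subst hik
      have : (∏ l, Z l) * (a i * b i + if i = i then κ i else 0)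
          = ∏ l, (Z l * (if l = i then (a l * b l + κ l) else 1)) := by
        rw [prod_mul_ite Z (fun l => a l * b l + κ l) i]
        simp
      rw [this]
      refine Finset.prod_congr rfl fun l _ => ?_
      by_cases hl : l = i
      · simpa [hl] using (h i).integral_mul
      · simpa [hl] using (h l).integral
    · rw [if_neg hik, add_zero, ← prod_mul_ite_mul_ite Z a b i k]
      refine Finset.prod_congr rfl fun l _ => ?_
      obtain rfl | hl := eq_or_ne l i
      · simpa [hik] using (h l).integral_left
      · obtain rfl | hk := eq_or_ne l k
        · simpa [hl] using (h l).integral_right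
        · simpa [hl, hk] using (h l).integral

/-- Expectation of a polynomial that is affine in `A` and in `B` under a product weight. -/
theorem PairMoments.pi_affine (h : ∀ l, PairMoments μ (w l) A B (Z l) (a l) (b l) (κ l))
    (d : ℂ) (p r : ι → ℂ) (Q : ι → ι → ℂ) :
    Integrable (fun φ : ι → α => (∏ l, w l (φ l)) * (d + ∑ i, p i * A (φ i) + ∑ k, r k * B (φ k)
      + ∑ i, ∑ k, Q i k * (A (φ i) * B (φ k)))) (Measure.pi fun _ => μ) ∧
    ∫ φ : ι → α, (∏ l, w l (φ l)) * (d + ∑ i, p i * A (φ i) + ∑ k, r k * B (φ k)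
      + ∑ i, ∑ k, Q i k * (A (φ i) * B (φ k))) ∂(Measure.pi fun _ => μ)
      = (∏ l, Z l) * (d + ∑ i, p i * a i + ∑ k, r k * b k
        + ∑ i, ∑ k, Q i k * (a i * b k) + ∑ i, Q i i * κ i) := by
  have h0 := PairMoments.pi_one h
  have h1 := fun i => PairMoments.pi_left h i
  have h2 := fun k => PairMoments.pi_left (fun l => (h l).swap) k
  have h3 := fun i k => PairMoments.pi_mul h i k
  have key : (fun φ : ι → α => (∏ l, w l (φ l)) * (d + ∑ i, p i * A (φ i) + ∑ k, r k * B (φ k)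
      + ∑ i, ∑ k, Q i k * (A (φ i) * B (φ k)))) =
      fun φ => d * (∏ l, w l (φ l)) + ∑ i, p i * ((∏ l, w l (φ l)) * A (φ i))
        + ∑ k, r k * ((∏ l, w l (φ l)) * B (φ k))
        + ∑ i, ∑ k, Q i k * ((∏ l, w l (φ l)) * (A (φ i) * B (φ k))) := by
    funext φ
    simp only [mul_add, Finset.mul_sum]
    simp only [mul_comm, mul_assoc]
  rw [key]
  have i0 := h0.1.const_mul d
  have i1 := integrable_finsetSum Finset.univ fun i _ => (h1 i).1.const_mul (p i)
  have i2 := integrable_finsetSum Finset.univ fun i _ => (h2 i).1.const_mul (r i)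
  have i3' := fun i => integrable_finsetSum Finset.univ fun k _ => (h3 i k).1.const_mul (Q i k)
  have i3 := integrable_finsetSum Finset.univ fun i _ => i3' i
  refine ⟨((i0.add i1).add i2).add i3, ?_⟩
  have e0 : ∫ φ : ι → α, d * (∏ l, w l (φ l)) ∂(Measure.pi fun _ => μ) = d * ∏ l, Z l := by
    rw [integral_const_mul, h0.2]
  have e1 : ∫ φ : ι → α, ∑ i, p i * ((∏ l, w l (φ l)) * A (φ i)) ∂(Measure.pi fun _ => μ)
      = ∑ i, p i * ((∏ l, Z l) * a i) := by
    rw [integral_finsetSum _ fun i _ => (h1 i).1.const_mul (p i)]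
    simp only [integral_const_mul, (h1 _).2]
  have e2 : ∫ φ : ι → α, ∑ i, r i * ((∏ l, w l (φ l)) * B (φ i)) ∂(Measure.pi fun _ => μ)
      = ∑ i, r i * ((∏ l, Z l) * b i) := by
    rw [integral_finsetSum _ fun i _ => (h2 i).1.const_mul (r i)]
    simp only [integral_const_mul, (h2 _).2]
  have e3 : ∫ φ : ι → α, ∑ i, ∑ k, Q i k * ((∏ l, w l (φ l)) * (A (φ i) * B (φ k)))
      ∂(Measure.pi fun _ => μ)
      = ∑ i, ∑ k, Q i k * ((∏ l, Z l) * (a i * b k + if i = k then κ i else 0)) := by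
    rw [integral_finsetSum _ fun i _ => i3' i]
    refine Finset.sum_congr rfl fun i _ => ?_
    rw [integral_finsetSum _ fun k _ => (h3 i k).1.const_mul (Q i k)]
    simp only [integral_const_mul, (h3 _ _).2]
  have f1 := integral_add ((i0.add i1).add i2) i3
  have f2 := integral_add (i0.add i1) i2
  have f3 := integral_add i0 i1
  simp only [Pi.add_apply] at f1 f2 f3
  rw [f1, f2, f3, e0, e1, e2, e3]
  have e4 : ∑ i, ∑ k, Q i k * ((∏ l, Z l) * (a i * b k + if i = k then κ i else 0))
      = (∏ l, Z l) * (∑ i, ∑ k, Q i k * (a i * b k)) + (∏ l, Z l) * ∑ i, Q i i * κ i := by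
    simp only [mul_add, Finset.mul_sum, Finset.sum_add_distrib]
    congr 1
    · simp only [mul_left_comm]
    · simp only [mul_ite, mul_zero, Finset.sum_ite_eq, Finset.mem_univ, if_true, mul_left_comm]
  rw [e4]
  simp only [mul_add, Finset.mul_sum]
  simp only [mul_comm, mul_left_comm]
  ring

end Pi

/-! ### Gaussian weights on `ℂ` -/

/-- The bound |x|^k ≤ k! (exp x + exp (-x)) absorbs the power into the linear term, replacing c by c
± 1. -/
theorem integrable_pow_mul_cexp_quadratic {β : ℂ} (hβ : 0 < β.re) (c : ℂ) (k : ℕ) :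
    Integrable fun x : ℝ => (x : ℂ) ^ k * Complex.exp (-β * x ^ 2 + c * x) := by
  have h1 := integrable_cexp_quadratic hβ (c + 1) 0
  have h2 := integrable_cexp_quadratic hβ (c - 1) 0
  refine (((h1.norm.add h2.norm).const_mul (k.factorial : ℝ))).mono' (by fun_prop) ?_
  filter_upwards with x
  simp only [Pi.add_apply, norm_mul, norm_pow, Complex.norm_real, Complex.norm_exp]
  have hx : |x| ^ k ≤ k.factorial * (Real.exp x + Real.exp (-x)) := by
    have h3 := Real.pow_div_factorial_le_exp |x| (abs_nonneg x) k
    have h4 : Real.exp |x| ≤ Real.exp x + Real.exp (-x) := by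
      rcases abs_cases x with ⟨h, _⟩ | ⟨h, _⟩ <;> rw [h] <;> linarith [Real.exp_pos x, Real.exp_pos (-x)]
    rw [div_le_iff₀ (by positivity)] at h3
    nlinarith [(Nat.cast_pos (α := ℝ)).2 k.factorial_pos]
  have e1 : (-β * (x : ℂ) ^ 2 + (c + 1) * x + 0).re = x + (-β * (x : ℂ) ^ 2 + c * x).re := by
    simp; ring
  have e2 : (-β * (x : ℂ) ^ 2 + (c - 1) * x + 0).re = -x + (-β * (x : ℂ) ^ 2 + c * x).re := by
    simp; ring
  rw [e1, e2, Real.exp_add, Real.exp_add, Real.norm_eq_abs]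
  calc _ ≤ (k.factorial * (Real.exp x + Real.exp (-x))) *
        Real.exp (-β * (x : ℂ) ^ 2 + c * x).re := by gcongr
    _ = _ := by ring

theorem integral_cexp_quadratic_zero {β : ℂ} (hβ : 0 < β.re) (c : ℂ) :
    ∫ x : ℝ, Complex.exp (-β * x ^ 2 + c * x) =
      (Real.pi / β) ^ (1 / 2 : ℂ) * Complex.exp (c ^ 2 / (4 * β)) := by
  have h := integral_cexp_quadratic (b := -β) (by simpa using hβ) c 0
  simp only [add_zero, neg_neg] at h
  rw [h]
  congr 2
  field_simp
  ring

/-- The derivative of the Gaussian integrates to zero over the line, which is a linear relation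
between the moments of order 0 and 1. Differentiating x times the Gaussian gives the second moment
in the same way. -/
theorem integral_mul_cexp_quadratic {β : ℂ} (hβ : 0 < β.re) (c : ℂ) :
    ∫ x : ℝ, (x : ℂ) * Complex.exp (-β * x ^ 2 + c * x) =
      c / (2 * β) * ∫ x : ℝ, Complex.exp (-β * x ^ 2 + c * x) := by
  have hβ0 : β ≠ 0 := fun h => by simp [h] at hβ
  have i0 := integrable_pow_mul_cexp_quadratic hβ c 0
  have i1 := integrable_pow_mul_cexp_quadratic hβ c 1
  simp only [pow_zero, one_mul, pow_one] at i0 i1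
  have hd : ∀ x : ℝ, HasDerivAt (fun x : ℝ => Complex.exp (-β * x ^ 2 + c * x))
      (-(2 * β) * (x * Complex.exp (-β * x ^ 2 + c * x)) +
        c * Complex.exp (-β * x ^ 2 + c * x)) x := by
    intro x
    have := (((((hasDerivAt_id (x : ℂ)).pow 2).const_mul (-β)).add
      ((hasDerivAt_id (x : ℂ)).const_mul c)).cexp).comp_ofReal
    refine this.congr_deriv ?_
    simp
    ring
  have h := integral_eq_zero_of_hasDerivAt_of_integrable hd
    ((i1.const_mul (-(2 * β))).add (i0.const_mul c)) i0
  rw [integral_add (i1.const_mul (-(2 * β))) (i0.const_mul c), integral_const_mul,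
    integral_const_mul] at h
  generalize (∫ x : ℝ, Complex.exp (-β * x ^ 2 + c * x)) = I₀ at *
  generalize (∫ x : ℝ, (x : ℂ) * Complex.exp (-β * x ^ 2 + c * x)) = I₁ at *
  field_simp
  linear_combination -h

theorem integral_sq_mul_cexp_quadratic {β : ℂ} (hβ : 0 < β.re) (c : ℂ) :
    ∫ x : ℝ, (x : ℂ) ^ 2 * Complex.exp (-β * x ^ 2 + c * x) =
      ((c / (2 * β)) ^ 2 + 1 / (2 * β)) * ∫ x : ℝ, Complex.exp (-β * x ^ 2 + c * x) := by
  have hβ0 : β ≠ 0 := fun h => by simp [h] at hβ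
  have i0 := integrable_pow_mul_cexp_quadratic hβ c 0
  have i1 := integrable_pow_mul_cexp_quadratic hβ c 1
  have i2 := integrable_pow_mul_cexp_quadratic hβ c 2
  simp only [pow_zero, one_mul, pow_one] at i0 i1
  have hd : ∀ x : ℝ, HasDerivAt (fun x : ℝ => (x : ℂ) * Complex.exp (-β * x ^ 2 + c * x))
      (Complex.exp (-β * x ^ 2 + c * x) + -(2 * β) * (x ^ 2 * Complex.exp (-β * x ^ 2 + c * x)) +
        c * (x * Complex.exp (-β * x ^ 2 + c * x))) x := by
    intro x
    have := ((hasDerivAt_id (x : ℂ)).mul (((((hasDerivAt_id (x : ℂ)).pow 2).const_mul (-β)).add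
      ((hasDerivAt_id (x : ℂ)).const_mul c)).cexp)).comp_ofReal
    refine this.congr_deriv ?_
    simp
    ring
  have h := integral_eq_zero_of_hasDerivAt_of_integrable hd
    ((i0.add (i2.const_mul (-(2 * β)))).add (i1.const_mul c)) i1
  have h' := integral_add (i0.add (i2.const_mul (-(2 * β)))) (i1.const_mul c)
  have h'' := integral_add i0 (i2.const_mul (-(2 * β)))
  simp only [Pi.add_apply] at h' h''
  rw [h', h'', integral_const_mul, integral_const_mul, integral_mul_cexp_quadratic hβ c] at h
  generalize (∫ x : ℝ, Complex.exp (-β * x ^ 2 + c * x)) = I₀ at *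
  generalize (∫ x : ℝ, (x : ℂ) ^ 2 * Complex.exp (-β * x ^ 2 + c * x)) = I₂ at *
  field_simp
  field_simp at h
  linear_combination -h

/-- The weight `exp (-β |x|² - i (s̄ x + s x̄))`. -/
noncomputable def gaussWeight (β s x : ℂ) : ℂ :=
  Complex.exp (-β * (‖x‖ : ℂ) ^ 2 - Complex.I * (starRingEnd ℂ s * x + s * starRingEnd ℂ x))

theorem gaussWeight_eq_mul (β s : ℂ) (p : ℝ × ℝ) :
    gaussWeight β s (Complex.measurableEquivRealProd.symm p) =
      Complex.exp (-β * p.1 ^ 2 + (-2 * Complex.I * s.re) * p.1) *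
        Complex.exp (-β * p.2 ^ 2 + (-2 * Complex.I * s.im) * p.2) := by
  rw [gaussWeight, ← Complex.exp_add, ← Complex.mul_conj']
  congr 1
  rw [Complex.measurableEquivRealProd_symm_apply]
  apply Complex.ext <;> simp [pow_two] <;> ring

theorem integrable_complex_of_mul {f g : ℝ → ℂ} {F : ℂ → ℂ} (hf : Integrable f) (hg : Integrable g)
    (hF : ∀ p : ℝ × ℝ, F (Complex.measurableEquivRealProd.symm p) = f p.1 * g p.2) :
    Integrable F ∧ ∫ x, F x = (∫ x, f x) * ∫ x, g x := by
  have hm := Complex.volume_preserving_equiv_real_prod.symm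
  have hc : F ∘ Complex.measurableEquivRealProd.symm = fun p => f p.1 * g p.2 := funext hF
  constructor
  · rw [← hm.integrable_comp_emb (MeasurableEquiv.measurableEmbedding _), hc]
    exact hf.mul_prod hg
  · rw [← hm.integral_comp (MeasurableEquiv.measurableEmbedding _)]
    simp only [hF]
    exact integral_prod_mul f g

/-- Completing the square moves x to -is/β and x̄ to -is̄/β, two points that are in general not
conjugate: x and x̄ act as independent variables with complex means. Each real coordinate has
variance 1/(2β), which makes the covariance of x and x̄ equal to 1/β. -/
theorem gaussWeight_pairMoments {β : ℂ} (hβ : 0 < β.re) (s : ℂ) :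
    PairMoments volume (gaussWeight β s) (fun x => x) (starRingEnd ℂ)
      (Real.pi / β * Complex.exp (-(‖s‖ : ℂ) ^ 2 / β))
      (-Complex.I * s / β) (-Complex.I * starRingEnd ℂ s / β) (1 / β) := by
  have hβ0 : β ≠ 0 := fun h => by simp [h] at hβ
  set e : ℝ → ℝ → ℂ := fun σ x => Complex.exp (-β * x ^ 2 + (-2 * Complex.I * σ) * x) with he
  have i0 : ∀ σ, Integrable (e σ) := fun σ => by
    simpa only [pow_zero, one_mul] using
      integrable_pow_mul_cexp_quadratic hβ (-2 * Complex.I * σ) 0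
  have i1 : ∀ σ, Integrable fun x : ℝ => (x : ℂ) * e σ x := fun σ => by
    simpa only [pow_one] using integrable_pow_mul_cexp_quadratic hβ (-2 * Complex.I * σ) 1
  have i2 : ∀ σ, Integrable fun x : ℝ => (x : ℂ) ^ 2 * e σ x := fun σ =>
    integrable_pow_mul_cexp_quadratic hβ (-2 * Complex.I * σ) 2
  set Z : ℝ → ℂ := fun σ => ∫ x, e σ x with hZ
  have hW : ∀ p, gaussWeight β s (Complex.measurableEquivRealProd.symm p) = e s.re p.1 * e s.im p.2 :=
    gaussWeight_eq_mul β s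
  have c : ∀ p : ℝ × ℝ, Complex.measurableEquivRealProd.symm p = (p.1 : ℂ) + p.2 * Complex.I := by
    intro p
    rw [Complex.measurableEquivRealProd_symm_apply]
    apply Complex.ext <;> simp
  have A0 := integrable_complex_of_mul (F := gaussWeight β s) (i0 s.re) (i0 s.im) hW
  have A1 := integrable_complex_of_mul (F := fun z => gaussWeight β s z * z.re)
    (i1 s.re) (i0 s.im) (by intro p; rw [hW, c]; simp; ring)
  have A2 := integrable_complex_of_mul (F := fun z => gaussWeight β s z * z.im)
    (i0 s.re) (i1 s.im) (by intro p; rw [hW, c]; simp; ring)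
  have A3 := integrable_complex_of_mul (F := fun z => gaussWeight β s z * z.re ^ 2)
    (i2 s.re) (i0 s.im) (by intro p; rw [hW, c]; simp; ring)
  have A4 := integrable_complex_of_mul (F := fun z => gaussWeight β s z * z.im ^ 2)
    (i0 s.re) (i2 s.im) (by intro p; rw [hW, c]; simp; ring)
  have m1 : ∀ σ, ∫ x : ℝ, (x : ℂ) * e σ x = (-2 * Complex.I * σ) / (2 * β) * Z σ := fun σ =>
    integral_mul_cexp_quadratic hβ _
  have m2 : ∀ σ, ∫ x : ℝ, (x : ℂ) ^ 2 * e σ x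
      = (((-2 * Complex.I * σ) / (2 * β)) ^ 2 + 1 / (2 * β)) * Z σ := fun σ =>
    integral_sq_mul_cexp_quadratic hβ _
  have hZZ : Z s.re * Z s.im = Real.pi / β * Complex.exp (-(‖s‖ : ℂ) ^ 2 / β) := by
    simp only [hZ, he]
    rw [integral_cexp_quadratic_zero hβ, integral_cexp_quadratic_zero hβ, mul_mul_mul_comm,
      ← Complex.exp_add, ← Complex.cpow_add _ _
        (div_ne_zero (Complex.ofReal_ne_zero.2 Real.pi_ne_zero) hβ0)]
    congr 1
    · norm_num
    · congr 1
      have hn : (‖s‖ : ℂ) ^ 2 = s.re ^ 2 + s.im ^ 2 := by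
        rw [← Complex.mul_conj', Complex.mul_conj, Complex.normSq_apply]
        push_cast
        ring
      rw [hn]
      field_simp
      linear_combination 4 * ((s.re : ℂ) ^ 2 + s.im ^ 2) * Complex.I_sq
  rw [m1] at A1 A2
  rw [m2] at A3 A4
  have s1 : (s : ℂ) = s.re + s.im * Complex.I := (Complex.re_add_im s).symm
  have s2 : starRingEnd ℂ s = s.re - s.im * Complex.I := by
    rw [s1]; apply Complex.ext <;> simp
  have e1 : (fun z => gaussWeight β s z * z) =
      fun z => gaussWeight β s z * z.re + Complex.I * (gaussWeight β s z * z.im) := by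
    funext z
    linear_combination -gaussWeight β s z * Complex.re_add_im z
  have e2 : (fun z => gaussWeight β s z * starRingEnd ℂ z) =
      fun z => gaussWeight β s z * z.re - Complex.I * (gaussWeight β s z * z.im) := by
    funext z
    have : starRingEnd ℂ z = z.re - z.im * Complex.I := by apply Complex.ext <;> simp
    rw [this]
    ring
  have e3 : (fun z => gaussWeight β s z * (z * starRingEnd ℂ z)) =
      fun z => gaussWeight β s z * z.re ^ 2 + (gaussWeight β s z * z.im ^ 2) := by
    funext z
    rw [← mul_add, Complex.mul_conj, Complex.normSq_apply]
    push_cast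
    ring
  refine ⟨A0.1, ?_, ?_, ?_, A0.2.trans hZZ, ?_, ?_, ?_⟩
  · rw [e1]; exact A1.1.add (A2.1.const_mul _)
  · rw [e2]; exact A1.1.sub (A2.1.const_mul _)
  · rw [e3]; exact A3.1.add A4.1
  · rw [e1, integral_add A1.1 (A2.1.const_mul _), integral_const_mul, A1.2, A2.2, ← hZZ]
    change _ * Z s.re * Z s.im + _ * (Z s.re * _) = _
    field_simp
    linear_combination Z s.re * Z s.im * s1
  · rw [e2, integral_sub A1.1 (A2.1.const_mul _), integral_const_mul, A1.2, A2.2, ← hZZ, s2]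
    change _ * Z s.re * Z s.im - _ * (Z s.re * _) = _
    field_simp
    ring
  · rw [e3, integral_add A3.1 A4.1, A3.2, A4.2, ← hZZ, s2]
    change _ * Z s.re * Z s.im + Z s.re * _ = _
    have : -Complex.I * s = -Complex.I * (s.re + s.im * Complex.I) := by rw [← s1]
    rw [this]
    field_simp
    linear_combination (2 * Z s.re * Z s.im * s.im ^ 2 * Complex.I ^ 2) * Complex.I_sq

theorem integrableOn_pow_mul_cexp_neg_mul_Ioi {γ : ℂ} (hγ : 0 < γ.re) (k : ℕ) :
    IntegrableOn (fun x : ℝ => (x : ℂ) ^ k * Complex.exp (-γ * x)) (Ioi 0) := by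
  have h := integrableOn_rpow_mul_exp_neg_mul_rpow (p := 1) (s := k) (b := γ.re)
    (by have : (0 : ℝ) ≤ k := Nat.cast_nonneg _
        linarith) one_pos hγ
  refine h.mono' (by fun_prop) ?_
  filter_upwards [ae_restrict_mem measurableSet_Ioi] with x hx
  rw [norm_mul, norm_pow, Complex.norm_exp, Complex.norm_real, Real.norm_eq_abs,
    abs_of_pos (mem_Ioi.1 hx), Complex.re_mul_ofReal, Complex.neg_re, Real.rpow_one,
    Real.rpow_natCast]

theorem integral_pow_mul_cexp_neg_mul_Ioi {γ : ℂ} (hγ : 0 < γ.re) (k : ℕ) :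
    ∫ x : ℝ in Ioi 0, (x : ℂ) ^ k * Complex.exp (-γ * x) = k.factorial / γ ^ (k + 1) := by
  have hγ0 : γ ≠ 0 := fun h => by simp [h] at hγ
  induction k with
  | zero =>
    simp only [pow_zero, one_mul, zero_add, Nat.factorial_zero, Nat.cast_one, pow_one]
    rw [integral_exp_mul_complex_Ioi (by simpa using hγ)]
    simp
  | succ k ih =>
    have hd : ∀ x ∈ Ioi (0 : ℝ), HasDerivAt
        (fun x : ℝ => (x : ℂ) ^ (k + 1) * Complex.exp (-γ * x))
        ((k + 1) * ((x : ℂ) ^ k * Complex.exp (-γ * x)) +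
          -γ * ((x : ℂ) ^ (k + 1) * Complex.exp (-γ * x))) x := by
      intro x _
      have := (((hasDerivAt_id (x : ℂ)).pow (k + 1)).mul
        ((hasDerivAt_id (x : ℂ)).const_mul (-γ)).cexp).comp_ofReal
      refine this.congr_deriv ?_
      simp
      ring
    have i1 := (integrableOn_pow_mul_cexp_neg_mul_Ioi hγ k).const_mul ((k : ℂ) + 1)
    have i2 := integrableOn_pow_mul_cexp_neg_mul_Ioi hγ (k + 1)
    have i3 := i2.const_mul (-γ)
    have h := integral_Ioi_of_hasDerivAt_of_tendsto (m := 0)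
      (Continuous.continuousWithinAt (by fun_prop)) hd (i1.add i3)
      (tendsto_zero_of_hasDerivAt_of_integrableOn_Ioi hd (i1.add i3) i2)
    rw [integral_add i1 i3, integral_const_mul, integral_const_mul, ih] at h
    simp only [Complex.ofReal_zero, ne_eq, Nat.add_eq_zero_iff, one_ne_zero, and_false,
      not_false_eq_true, zero_pow, zero_mul, sub_self] at h
    generalize (∫ x : ℝ in Ioi 0, (x : ℂ) ^ (k + 1) * Complex.exp (-γ * x)) = I₁ at *
    rw [Nat.factorial_succ, pow_succ γ (k + 1), eq_div_iff (by positivity)]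
    push_cast
    field_simp at h
    linear_combination -h

theorem integral_comp_sq_Ioi (g : ℝ → ℂ) :
    ∫ y : ℝ in Ioi 0, (y : ℂ) * g (y ^ 2) = (1 / 2) * ∫ x : ℝ in Ioi 0, g x := by
  have h := integral_comp_rpow_Ioi_of_pos (g := g) (p := 2) two_pos
  rw [← h, ← integral_const_mul]
  refine setIntegral_congr_fun measurableSet_Ioi fun y hy => ?_
  have : (2 : ℝ) - 1 = 1 := by norm_num
  simp only [this, Real.rpow_one, Real.rpow_two, Complex.real_smul]
  push_cast
  ring

theorem integrable_norm_pow_mul_cexp {γ : ℂ} (hγ : 0 < γ.re) (k : ℕ) :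
    Integrable fun z : ℂ => Complex.exp (-γ * (‖z‖ : ℂ) ^ 2) * ((‖z‖ : ℂ) ^ 2) ^ k := by
  have := (integrable_fun_norm_addHaar (E := ℂ) (F := ℂ) volume
    (f := fun y : ℝ => Complex.exp (-γ * (y : ℂ) ^ 2) * ((y : ℂ) ^ 2) ^ k))
  rw [this]
  have h := (integrable_rpow_mul_exp_neg_mul_sq hγ (s := (2 * k + 1 : ℕ))
    (by have : (0 : ℝ) ≤ (2 * k + 1 : ℕ) := Nat.cast_nonneg _
        linarith)).integrableOn (s := Ioi 0)
  simp only [Real.rpow_natCast] at h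
  refine h.mono' (by fun_prop) ?_
  filter_upwards [ae_restrict_mem measurableSet_Ioi] with y hy
  rw [Complex.finrank_real_complex, norm_smul, norm_mul, Complex.norm_exp]
  simp only [norm_pow, Complex.norm_real, Real.norm_eq_abs, abs_of_pos (mem_Ioi.1 hy)]
  have : (-γ * (y : ℂ) ^ 2).re = -γ.re * y ^ 2 := by
    rw [← Complex.ofReal_pow, Complex.re_mul_ofReal]
    simp
  rw [this]
  apply le_of_eq
  norm_num
  ring

theorem integral_norm_pow_mul_cexp {γ : ℂ} (hγ : 0 < γ.re) (k : ℕ) :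
    ∫ z : ℂ, Complex.exp (-γ * (‖z‖ : ℂ) ^ 2) * ((‖z‖ : ℂ) ^ 2) ^ k =
      Real.pi * k.factorial / γ ^ (k + 1) := by
  have := integral_fun_norm_addHaar (E := ℂ) (F := ℂ) volume
    (fun y : ℝ => Complex.exp (-γ * (y : ℂ) ^ 2) * ((y : ℂ) ^ 2) ^ k)
  rw [this, Complex.finrank_real_complex]
  have h1 := integral_comp_sq_Ioi (fun x => (x : ℂ) ^ k * Complex.exp (-γ * x))
  rw [integral_pow_mul_cexp_neg_mul_Ioi hγ] at h1
  have h2 : ∫ y : ℝ in Ioi 0, y ^ (2 - 1) • (Complex.exp (-γ * (y : ℂ) ^ 2) * ((y : ℂ) ^ 2) ^ k)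
      = 1 / 2 * (k.factorial / γ ^ (k + 1)) := by
    rw [← h1]
    refine integral_congr_ae ?_
    filter_upwards with y
    simp [mul_comm]
  rw [h2, Measure.real, Complex.volume_ball]
  simp
  ring

/-- Moments of `|z|²` under a centred Gaussian weight. -/
theorem normSq_pairMoments {γ : ℂ} (hγ : 0 < γ.re) :
    PairMoments volume (fun z : ℂ => Complex.exp (-γ * (‖z‖ : ℂ) ^ 2)) (fun z => (‖z‖ : ℂ) ^ 2)
      (fun z => (‖z‖ : ℂ) ^ 2) (Real.pi / γ) (1 / γ) (1 / γ) (1 / γ ^ 2) := by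
  have hγ0 : γ ≠ 0 := fun h => by simp [h] at hγ
  have i0 := integrable_norm_pow_mul_cexp hγ 0
  have i1 := integrable_norm_pow_mul_cexp hγ 1
  have i2 := integrable_norm_pow_mul_cexp hγ 2
  have e0 := integral_norm_pow_mul_cexp hγ 0
  have e1 := integral_norm_pow_mul_cexp hγ 1
  have e2 := integral_norm_pow_mul_cexp hγ 2
  simp only [pow_zero, mul_one, pow_one, zero_add, Nat.factorial_zero, Nat.factorial_one,
    Nat.cast_one, Nat.factorial_two] at i0 i1 i2 e0 e1 e2
  refine ⟨i0, i1, i1, by simpa only [← pow_two] using i2, e0, ?_, ?_, ?_⟩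
  · rw [e1]; field_simp
  · rw [e1]; field_simp
  · simp only [← pow_two]
    rw [e2]; field_simp; norm_num; ring

/-! ### The complex Gaussian law -/

theorem complexGaussian_eq_withDensity {v : ℝ≥0} (hv : v ≠ 0) :
    complexGaussian v = (volume : Measure ℂ).withDensity
      (fun z => ENNReal.ofReal ((Real.pi * v)⁻¹ * Real.exp (-‖z‖ ^ 2 / v))) := by
  have hv2 : v / 2 ≠ 0 := by simpa using hv
  rw [complexGaussian, gaussianReal_of_var_ne_zero _ hv2,
    prod_withDensity (measurable_gaussianPDF _ _) (measurable_gaussianPDF _ _)]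
  have hf : (fun p : ℝ × ℝ => (p.1 : ℂ) + (p.2 : ℂ) * Complex.I) =
      Complex.measurableEquivRealProd.symm := by
    funext p
    rw [Complex.measurableEquivRealProd_symm_apply]
    apply Complex.ext <;> simp
  rw [hf]
  have hm := Complex.volume_preserving_equiv_real_prod.symm
  ext s hs
  rw [Measure.map_apply (MeasurableEquiv.measurable _) hs, withDensity_apply _
    (MeasurableEquiv.measurable _ hs), withDensity_apply _ hs,
    ← hm.setLIntegral_comp_preimage_emb (MeasurableEquiv.measurableEmbedding _)]
  refine setLIntegral_congr_fun (MeasurableEquiv.measurable _ hs) fun p _ => ?_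
  simp only [gaussianPDF]
  rw [← ENNReal.ofReal_mul (gaussianPDFReal_nonneg _ _ _)]
  congr 1
  rw [gaussianPDFReal, gaussianPDFReal, ← hf, ← Complex.normSq_eq_norm_sq,
    mul_mul_mul_comm, ← Real.exp_add, ← mul_inv, Real.mul_self_sqrt (by positivity)]
  have hv' : (v : ℝ) ≠ 0 := by exact_mod_cast hv
  congr 1
  · push_cast
    congr 1
    ring
  · congr 1
    simp [Complex.normSq_apply]
    field_simp
    ring

instance (v : ℝ≥0) : IsProbabilityMeasure (complexGaussian v) := by
  unfold complexGaussian
  exact Measure.isProbabilityMeasure_map (by fun_prop)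

theorem integral_complexGaussian {v : ℝ≥0} (hv : v ≠ 0) (f : ℂ → ℂ) :
    ∫ z, f z ∂(complexGaussian v) =
      ∫ z, ((Real.pi * v : ℂ)⁻¹ * Complex.exp (-(‖z‖ : ℂ) ^ 2 / v)) * f z := by
  rw [complexGaussian_eq_withDensity hv, integral_withDensity_eq_integral_toReal_smul
    (by fun_prop) (by simp)]
  refine integral_congr_ae ?_
  filter_upwards with z
  rw [ENNReal.toReal_ofReal (by positivity), Complex.real_smul]
  push_cast
  ring

theorem integrable_complexGaussian {v : ℝ≥0} (hv : v ≠ 0) (f : ℂ → ℂ) :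
    Integrable f (complexGaussian v) ↔
      Integrable fun z => ((Real.pi * v : ℂ)⁻¹ * Complex.exp (-(‖z‖ : ℂ) ^ 2 / v)) * f z := by
  rw [complexGaussian_eq_withDensity hv, integrable_withDensity_iff_integrable_smul'
    (by fun_prop) (by simp)]
  refine integrable_congr ?_
  filter_upwards with z
  rw [ENNReal.toReal_ofReal (by positivity), Complex.real_smul]
  push_cast
  ring

/-- The moments of the complex Gaussian law against the characters `exp (- i (s̄ z + s z̄))`. -/
theorem complexGaussian_pairMoments {v : ℝ≥0} (hv : v ≠ 0) (s : ℂ) :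
    PairMoments (complexGaussian v)
      (fun z => Complex.exp (-Complex.I * (starRingEnd ℂ s * z + s * starRingEnd ℂ z)))
      (fun x => x) (starRingEnd ℂ)
      (Complex.exp (-(‖s‖ : ℂ) ^ 2 * v))
      (-Complex.I * s * v) (-Complex.I * starRingEnd ℂ s * v) v := by
  have hv' : (v : ℂ) ≠ 0 := by exact_mod_cast hv
  have hβ : 0 < ((v : ℂ)⁻¹).re := by
    have : ((v : ℂ)⁻¹) = ((v⁻¹ : ℝ) : ℂ) := by push_cast; rfl
    rw [this, Complex.ofReal_re]
    positivity
  have h := gaussWeight_pairMoments hβ s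
  have hw : ∀ z f : ℂ, ((Real.pi * v : ℂ)⁻¹ * Complex.exp (-(‖z‖ : ℂ) ^ 2 / v)) *
      (Complex.exp (-Complex.I * (starRingEnd ℂ s * z + s * starRingEnd ℂ z)) * f) =
      (Real.pi * v : ℂ)⁻¹ * (gaussWeight (v : ℂ)⁻¹ s z * f) := by
    intro z f
    rw [gaussWeight, mul_assoc, ← mul_assoc (Complex.exp _), ← Complex.exp_add]
    congr 4
    ring
  have hw1 : ∀ z : ℂ, ((Real.pi * v : ℂ)⁻¹ * Complex.exp (-(‖z‖ : ℂ) ^ 2 / v)) *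
      (Complex.exp (-Complex.I * (starRingEnd ℂ s * z + s * starRingEnd ℂ z))) =
      (Real.pi * v : ℂ)⁻¹ * (gaussWeight (v : ℂ)⁻¹ s z) := by
    intro z
    simpa using hw z 1
  have hZ : (Real.pi * v : ℂ)⁻¹ * (Real.pi / (v : ℂ)⁻¹ * Complex.exp (-(‖s‖ : ℂ) ^ 2 / (v : ℂ)⁻¹))
      = Complex.exp (-(‖s‖ : ℂ) ^ 2 * v) := by
    have : (Real.pi : ℂ) ≠ 0 := by exact_mod_cast Real.pi_ne_zero
    rw [div_inv_eq_mul, div_inv_eq_mul, ← mul_assoc, inv_mul_cancel₀ (by positivity), one_mul]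
  constructor
  · rw [integrable_complexGaussian hv]
    simp only [hw1]
    exact h.integrable.const_mul _
  · rw [integrable_complexGaussian hv]
    simp only [hw]
    exact h.integrable_left.const_mul _
  · rw [integrable_complexGaussian hv]
    simp only [hw]
    exact h.integrable_right.const_mul _
  · rw [integrable_complexGaussian hv]
    simp only [hw]
    exact h.integrable_mul.const_mul _
  · rw [integral_complexGaussian hv]
    simp only [hw1]
    rw [integral_const_mul, h.integral, hZ]
  · rw [integral_complexGaussian hv]
    simp only [hw]
    rw [integral_const_mul, h.integral_left, ← mul_assoc, hZ, div_inv_eq_mul]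
  · rw [integral_complexGaussian hv]
    simp only [hw]
    rw [integral_const_mul, h.integral_right, ← mul_assoc, hZ, div_inv_eq_mul]
  · rw [integral_complexGaussian hv]
    simp only [hw]
    rw [integral_const_mul, h.integral_mul, ← mul_assoc, hZ, div_inv_eq_mul, div_inv_eq_mul,
      div_inv_eq_mul, one_mul]

/-! ### Functions of polynomial growth and rapidly decaying weights -/

/-- A continuous function of at most polynomial growth. -/
def PolyGrowth {E : Type*} [NormedAddCommGroup E] (f : E → ℂ) : Prop :=
  Continuous f ∧ ∃ (C : ℝ) (N : ℕ), ∀ x, ‖f x‖ ≤ C * (1 + ‖x‖) ^ N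

namespace PolyGrowth

variable {E F : Type*} [NormedAddCommGroup E] [NormedAddCommGroup F] {f g : E → ℂ}

theorem exists_bound (hf : PolyGrowth f) :
    ∃ (C : ℝ) (N : ℕ), 0 ≤ C ∧ ∀ x, ‖f x‖ ≤ C * (1 + ‖x‖) ^ N := by
  obtain ⟨_, C, N, h⟩ := hf
  exact ⟨C, N, by simpa using (norm_nonneg _).trans (h 0), h⟩

theorem of_norm_le (hf : Continuous f) {C : ℝ} (h : ∀ x, ‖f x‖ ≤ C * (1 + ‖x‖)) :
    PolyGrowth f := ⟨hf, C, 1, by simpa using h⟩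

theorem of_bounded (hf : Continuous f) {C : ℝ} (h : ∀ x, ‖f x‖ ≤ C) : PolyGrowth f :=
  ⟨hf, C, 0, by simpa using h⟩

theorem const (c : ℂ) : PolyGrowth fun _ : E => c :=
  of_bounded continuous_const (C := ‖c‖) fun _ => le_rfl

theorem mul (hf : PolyGrowth f) (hg : PolyGrowth g) : PolyGrowth fun x => f x * g x := by
  obtain ⟨C, N, hC, h⟩ := hf.exists_bound
  obtain ⟨C', N', hC', h'⟩ := hg.exists_bound
  refine ⟨hf.1.mul hg.1, C * C', N + N', fun x => ?_⟩
  rw [norm_mul, pow_add, mul_mul_mul_comm]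
  exact mul_le_mul (h x) (h' x) (norm_nonneg _) (by positivity)

theorem add (hf : PolyGrowth f) (hg : PolyGrowth g) : PolyGrowth fun x => f x + g x := by
  obtain ⟨C, N, hC, h⟩ := hf.exists_bound
  obtain ⟨C', N', hC', h'⟩ := hg.exists_bound
  refine ⟨hf.1.add hg.1, C + C', N + N', fun x => ?_⟩
  have h1 : (1 : ℝ) ≤ 1 + ‖x‖ := by linarith [norm_nonneg x]
  have e1 : (1 + ‖x‖) ^ N ≤ (1 + ‖x‖) ^ (N + N') := pow_le_pow_right₀ h1 (by omega)
  have e2 : (1 + ‖x‖) ^ N' ≤ (1 + ‖x‖) ^ (N + N') := pow_le_pow_right₀ h1 (by omega)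
  calc ‖f x + g x‖ ≤ ‖f x‖ + ‖g x‖ := norm_add_le _ _
    _ ≤ C * (1 + ‖x‖) ^ N + C' * (1 + ‖x‖) ^ N' := add_le_add (h x) (h' x)
    _ ≤ C * (1 + ‖x‖) ^ (N + N') + C' * (1 + ‖x‖) ^ (N + N') := by gcongr
    _ = _ := by ring

theorem neg (hf : PolyGrowth f) : PolyGrowth fun x => -f x := by
  simpa using (const (-1)).mul hf

theorem sub (hf : PolyGrowth f) (hg : PolyGrowth g) : PolyGrowth fun x => f x - g x := by
  simpa [sub_eq_add_neg] using hf.add hg.neg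

theorem sum {κ : Type*} {f : κ → E → ℂ} {s : Finset κ} (hf : ∀ i ∈ s, PolyGrowth (f i)) :
    PolyGrowth fun x => ∑ i ∈ s, f i x := by
  classical
  induction s using Finset.induction_on with
  | empty => simpa using const 0
  | insert a s ha ih =>
    simp only [Finset.sum_insert ha]
    exact (hf a (Finset.mem_insert_self _ _)).add
      (ih fun i hi => hf i (Finset.mem_insert_of_mem hi))

theorem prod {κ : Type*} {f : κ → E → ℂ} {s : Finset κ} (hf : ∀ i ∈ s, PolyGrowth (f i)) :
    PolyGrowth fun x => ∏ i ∈ s, f i x := by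
  classical
  induction s using Finset.induction_on with
  | empty => simpa using const 1
  | insert a s ha ih =>
    simp only [Finset.prod_insert ha]
    exact (hf a (Finset.mem_insert_self _ _)).mul
      (ih fun i hi => hf i (Finset.mem_insert_of_mem hi))

theorem pow (hf : PolyGrowth f) (k : ℕ) : PolyGrowth fun x => f x ^ k := by
  simpa using prod (s := Finset.range k) (f := fun _ => f) fun _ _ => hf

theorem star (hf : PolyGrowth f) : PolyGrowth fun x => starRingEnd ℂ (f x) := by
  obtain ⟨hc, C, N, h⟩ := hf
  exact ⟨Complex.continuous_conj.comp hc, C, N, by simpa using h⟩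

theorem comp (hf : PolyGrowth f) {φ : F → E} (hφ : Continuous φ) {C : ℝ}
    (h : ∀ x, ‖φ x‖ ≤ C * (1 + ‖x‖)) : PolyGrowth fun x => f (φ x) := by
  obtain ⟨C', N, hC', h'⟩ := hf.exists_bound
  have hC : 0 ≤ C := by simpa using (norm_nonneg _).trans (h 0)
  refine ⟨hf.1.comp hφ, C' * (1 + C) ^ N, N, fun x => (h' _).trans ?_⟩
  rw [mul_assoc, ← mul_pow]
  gcongr
  have := h x
  nlinarith [norm_nonneg x]

theorem det {κ : Type*} [Fintype κ] [DecidableEq κ] {M : E → Matrix κ κ ℂ}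
    (hM : ∀ i j, PolyGrowth fun x => M x i j) : PolyGrowth fun x => (M x).det := by
  simp only [Matrix.det_apply']
  exact sum fun σ _ => (const _).mul (prod fun i _ => hM _ _)

theorem eval {ι : Type*} [Fintype ι] (i : ι) : PolyGrowth fun x : ι → ℂ => x i :=
  of_norm_le (continuous_apply i) (C := 1) fun x => by
    linarith [norm_le_pi_norm x i]

theorem id : PolyGrowth fun x : ℂ => x :=
  of_norm_le continuous_id (C := 1) fun x => by linarith

theorem comp_apply {ι : Type*} [Fintype ι] (hf : PolyGrowth f) (i : ι) :
    PolyGrowth fun x : ι → E => f (x i) :=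
  hf.comp (continuous_apply i) (C := 1) fun x => by linarith [norm_le_pi_norm x i]

theorem comp_fst (hf : PolyGrowth f) : PolyGrowth fun x : E × F => f x.1 :=
  hf.comp continuous_fst (C := 1) fun x => by linarith [norm_fst_le x]

theorem comp_snd (hf : PolyGrowth f) : PolyGrowth fun x : F × E => f x.2 :=
  hf.comp continuous_snd (C := 1) fun x => by linarith [norm_snd_le x]

end PolyGrowth

/-- The non-negative continuous weight `w` has finite moments of all orders. -/
structure RapidWeight {E : Type*} [NormedAddCommGroup E] [MeasurableSpace E] (μ : Measure E)
    (w : E → ℝ) : Prop where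
  continuous : Continuous w
  nonneg : ∀ x, 0 ≤ w x
  integrable : ∀ N : ℕ, Integrable (fun x => (1 + ‖x‖) ^ N * w x) μ

namespace RapidWeight

/-- Most joint integrability statements needed for Fubini reduce to this one: functions of
polynomial growth are closed under the operations that build determinants and sesquilinear forms,
and they include bounded oscillating factors. -/
theorem integrable_mul {E : Type*} [NormedAddCommGroup E] [MeasurableSpace E]
    [OpensMeasurableSpace E] {μ : Measure E} {w : E → ℝ} [SecondCountableTopologyEither E ℂ]
    (hw : RapidWeight μ w) {f : E → ℂ}
    (hf : PolyGrowth f) : Integrable (fun x => f x * w x) μ := by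
  obtain ⟨C, N, hC, h⟩ := hf.exists_bound
  refine ((hw.integrable N).const_mul C).mono'
    (hf.1.mul (Complex.continuous_ofReal.comp hw.continuous)).aestronglyMeasurable ?_
  filter_upwards with x
  rw [norm_mul, Complex.norm_real, Real.norm_of_nonneg (hw.nonneg x), ← mul_assoc]
  exact mul_le_mul_of_nonneg_right (h x) (hw.nonneg x)

/-- For the sup norm, 1 + ‖x‖ ≤ ∏ (1 + ‖xᵢ‖), so the moments are dominated by a product function. -/
theorem pi {ι E : Type*} [Fintype ι] [NormedAddCommGroup E] [MeasurableSpace E]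
    [OpensMeasurableSpace E] [SecondCountableTopology E]
    {μ : Measure E} [SigmaFinite μ] {w : E → ℝ} (hw : RapidWeight μ w) :
    RapidWeight (Measure.pi fun _ : ι => μ) (fun x => ∏ i, w (x i)) where
  continuous := continuous_finsetProd _ fun i _ => hw.continuous.comp (continuous_apply i)
  nonneg x := Finset.prod_nonneg fun i _ => hw.nonneg _
  integrable N := by
    have h := Integrable.fintype_prod (ι := ι) (f := fun _ x => (1 + ‖x‖) ^ N * w x)
      (μ := fun _ => μ) fun _ => hw.integrable N
    refine h.mono' ?_ ?_
    · refine Continuous.aestronglyMeasurable ?_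
      have := fun i => hw.continuous.comp (continuous_apply (A := fun _ : ι => E) i)
      exact ((continuous_const.add continuous_norm).pow N).mul
        (continuous_finsetProd _ fun i _ => this i)
    · filter_upwards with x
      rw [norm_mul, norm_pow, Real.norm_of_nonneg (Finset.prod_nonneg fun i _ => hw.nonneg _),
        Real.norm_of_nonneg (by positivity), Finset.prod_mul_distrib]
      refine mul_le_mul_of_nonneg_right ?_ (Finset.prod_nonneg fun i _ => hw.nonneg _)
      rw [Finset.prod_pow]
      gcongr
      have h1 : ∀ i, (1 : ℝ) ≤ 1 + ‖x i‖ := fun i => by linarith [norm_nonneg (x i)]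
      have h2 : (1 : ℝ) ≤ ∏ i, (1 + ‖x i‖) := by
        simpa using Finset.prod_le_prod (s := Finset.univ) (fun _ _ => zero_le_one)
          fun i _ => h1 i
      have h3 : ‖x‖ ≤ ∏ i, (1 + ‖x i‖) - 1 := by
        rw [pi_norm_le_iff_of_nonneg (by linarith)]
        intro i
        classical
        have h4 : (1 : ℝ) ≤ ∏ j ∈ Finset.univ.erase i, (1 + ‖x j‖) := by
          simpa using Finset.prod_le_prod (s := Finset.univ.erase i) (fun _ _ => zero_le_one)
            fun j _ => h1 j
        rw [← Finset.mul_prod_erase _ _ (Finset.mem_univ i)]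
        nlinarith [h1 i]
      linarith

theorem prod {E F : Type*} [NormedAddCommGroup E] [MeasurableSpace E]
    [OpensMeasurableSpace E] [SecondCountableTopology E] [NormedAddCommGroup F]
    [MeasurableSpace F] [OpensMeasurableSpace F] [SecondCountableTopology F]
    {μ : Measure E} {ν : Measure F} [SFinite μ] [SFinite ν] {w : E → ℝ} {w' : F → ℝ}
    (hw : RapidWeight μ w) (hw' : RapidWeight ν w') :
    RapidWeight (μ.prod ν) (fun x => w x.1 * w' x.2) where
  continuous := (hw.continuous.comp continuous_fst).mul (hw'.continuous.comp continuous_snd)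
  nonneg x := mul_nonneg (hw.nonneg _) (hw'.nonneg _)
  integrable N := by
    have h := (hw.integrable N).mul_prod (hw'.integrable N)
    refine h.mono' ?_ ?_
    · refine Continuous.aestronglyMeasurable ?_
      exact ((continuous_const.add continuous_norm).pow N).mul
        ((hw.continuous.comp continuous_fst).mul (hw'.continuous.comp continuous_snd))
    · filter_upwards with x
      have hp := mul_nonneg (hw.nonneg x.1) (hw'.nonneg x.2)
      rw [norm_mul, norm_pow, Real.norm_of_nonneg hp, Real.norm_of_nonneg (by positivity),
        mul_mul_mul_comm, ← mul_pow]
      refine mul_le_mul_of_nonneg_right ?_ hp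
      gcongr
      have := norm_prod_le_iff.2 ⟨le_add_of_nonneg_right (norm_nonneg x.2),
        le_add_of_nonneg_left (norm_nonneg x.1)⟩
      nlinarith [norm_nonneg x.1, norm_nonneg x.2]

end RapidWeight

/-- Splitting at ‖z‖ = 1 gives (1 + ‖z‖)^N ≤ 2^N (1 + ‖z‖^(2N)), which leaves only even radial
moments. -/
theorem rapidWeight_gaussian {β : ℝ} (hβ : 0 < β) :
    RapidWeight (volume : Measure ℂ) (fun z => Real.exp (-β * ‖z‖ ^ 2)) where
  continuous := by fun_prop
  nonneg z := (Real.exp_pos _).le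
  integrable N := by
    have h := fun k => (integrable_norm_pow_mul_cexp (γ := β) (by simpa using hβ) k).norm
    have h0 := h 0
    have h1 := h N
    refine ((h0.add h1).const_mul (2 ^ N)).mono' (by fun_prop) ?_
    filter_upwards with z
    simp only [Pi.add_apply, norm_mul, norm_pow, Complex.norm_real, norm_norm, Complex.norm_exp,
      pow_zero, mul_one]
    have e : (-(β : ℂ) * (‖z‖ : ℂ) ^ 2).re = -β * ‖z‖ ^ 2 := by
      norm_cast
    rw [e, Real.norm_of_nonneg (by positivity), Real.norm_of_nonneg (Real.exp_pos _).le,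
      ← mul_one_add, mul_left_comm, mul_comm]
    refine mul_le_mul_of_nonneg_left ?_ (Real.exp_pos _).le
    have hz := norm_nonneg z
    rcases le_total ‖z‖ 1 with h | h
    · calc (1 + ‖z‖) ^ N ≤ 2 ^ N := by gcongr; linarith
        _ ≤ 2 ^ N * (1 + (‖z‖ ^ 2) ^ N) := by
          refine le_mul_of_one_le_right (by positivity) ?_
          have : 0 ≤ (‖z‖ ^ 2) ^ N := by positivity
          linarith
    · calc (1 + ‖z‖) ^ N ≤ (2 * ‖z‖ ^ 2) ^ N := by gcongr; nlinarith
        _ = 2 ^ N * (‖z‖ ^ 2) ^ N := mul_pow _ _ _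
        _ ≤ 2 ^ N * (1 + (‖z‖ ^ 2) ^ N) := by gcongr; linarith

theorem rapidWeight_complexGaussian {v : ℝ≥0} (hv : v ≠ 0) :
    RapidWeight (complexGaussian v) (fun _ => 1) where
  continuous := continuous_const
  nonneg _ := zero_le_one
  integrable N := by
    have hv' : (0 : ℝ) < v := by positivity
    have h := (rapidWeight_gaussian (inv_pos.2 hv')).integrable N
    have h2 := (integrable_complexGaussian hv (fun z => (((1 + ‖z‖) ^ N : ℝ) : ℂ))).2 ?_
    · refine h2.norm.congr ?_
      filter_upwards with z
      rw [Complex.norm_real, mul_one, Real.norm_of_nonneg (by positivity)]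
    · refine (h.ofReal (𝕜 := ℂ)).const_mul ((Real.pi * v : ℂ)⁻¹) |>.congr ?_
      filter_upwards with z
      simp only [RCLike.ofReal_mul, Complex.coe_algebraMap]
      push_cast
      rw [div_eq_inv_mul]
      have : -(v : ℂ)⁻¹ * (‖z‖ : ℂ) ^ 2 = (v : ℂ)⁻¹ * -(‖z‖ : ℂ) ^ 2 := by ring
      simp only [← this]
      simp
      ring

/-! ### Determinants and rank-one perturbations -/

section Det

variable {ι : Type*} [Fintype ι] [DecidableEq ι]

theorem det_scalar_add_vecMulVec {R : Type*} [CommRing R] [Nontrivial R] (c : R) (u v : ι → R) :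
    (Matrix.scalar ι c + Matrix.vecMulVec u v).det =
      c ^ Fintype.card ι + (u ⬝ᵥ v) * c ^ (Fintype.card ι - 1) := by
  have h := Matrix.eval_charpoly (Matrix.vecMulVec (-u) v) c
  rw [Matrix.charpoly_vecMulVec, Matrix.neg_vecMulVec, sub_neg_eq_add] at h
  rw [← h]
  simp

/-- Multiplying by the adjugate turns M + uvᵀ into det M · 1 plus a rank-one matrix, and a power of
det M is then cancelled. No inverse of M is used, so the formula holds over a domain, in particular
over polynomials. -/
theorem det_add_vecMulVec_of_det_ne_zero {R : Type*} [CommRing R] [IsDomain R]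
    {M : Matrix ι ι R} (hM : M.det ≠ 0) (u v : ι → R) :
    (M + Matrix.vecMulVec u v).det = M.det + v ⬝ᵥ (M.adjugate *ᵥ u) := by
  rcases isEmpty_or_nonempty ι with h | h
  · simp [dotProduct]
  have h1 : M.adjugate * (M + Matrix.vecMulVec u v) =
      Matrix.scalar ι M.det + Matrix.vecMulVec (M.adjugate *ᵥ u) v := by
    rw [mul_add, Matrix.adjugate_mul, Matrix.mul_vecMulVec]
    congr 1
    ext i j
    simp [Matrix.one_apply, Matrix.diagonal_apply]
  have h2 := congrArg Matrix.det h1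
  rw [Matrix.det_mul, Matrix.det_adjugate, det_scalar_add_vecMulVec] at h2
  have hc : Fintype.card ι = Fintype.card ι - 1 + 1 := by
    have := Fintype.card_pos (α := ι)
    omega
  rw [hc, pow_succ, Nat.add_sub_cancel] at h2
  refine mul_left_cancel₀ (pow_ne_zero (Fintype.card ι - 1) hM) ?_
  rw [h2, dotProduct_comm]
  ring

open Polynomial in
/-- The polynomial `det (X + M)`. -/
noncomputable def shiftPoly (M : Matrix ι ι ℂ) : ℂ[X] := (M.map C + Matrix.scalar ι X).det

theorem eval_shiftPoly (M : Matrix ι ι ℂ) (q : ℂ) :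
    (shiftPoly M).eval q = (M + Matrix.scalar ι q).det := by
  rw [shiftPoly, ← Polynomial.coe_evalRingHom, RingHom.map_det]
  congr 1
  ext i j
  by_cases h : i = j <;> simp [h]

theorem shiftPoly_eq_charpoly (M : Matrix ι ι ℂ) : shiftPoly M = (-M).charpoly := by
  refine Polynomial.funext fun q => ?_
  rw [eval_shiftPoly, Matrix.eval_charpoly, sub_neg_eq_add, add_comm]

theorem shiftPoly_ne_zero (M : Matrix ι ι ℂ) : shiftPoly M ≠ 0 := by
  rw [shiftPoly_eq_charpoly]
  exact (Matrix.charpoly_monic _).ne_zero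

open Polynomial in
-- As a polynomial in X, det (X + M) is monic and hence nonzero, so the rank-one formula holds for
-- every M. Being affine in u and in v separately is what limits Gaussian averages over a column to
-- first moments and covariances.
theorem shiftPoly_add_vecMulVec (M : Matrix ι ι ℂ) (u v : ι → ℂ) :
    shiftPoly (M + Matrix.vecMulVec u v) = shiftPoly M +
      ∑ i, ∑ k, (u i * v k) • (M.map C + Matrix.scalar ι X).adjugate k i := by
  have h := det_add_vecMulVec_of_det_ne_zero (shiftPoly_ne_zero M) (fun i => C (u i))
    (fun i => C (v i))
  have e : (M + Matrix.vecMulVec u v).map C + Matrix.scalar ι X =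
      M.map C + Matrix.scalar ι X + Matrix.vecMulVec (fun i => C (u i)) (fun i => C (v i)) := by
    ext i j
    simp [Matrix.vecMulVec_apply]
    ring
  rw [shiftPoly, e, h, shiftPoly]
  congr 1
  simp only [dotProduct, Matrix.mulVec, Finset.mul_sum]
  rw [Finset.sum_comm]
  refine Finset.sum_congr rfl fun i _ => Finset.sum_congr rfl fun k _ => ?_
  rw [Polynomial.smul_eq_C_mul, map_mul]
  ring

open Polynomial in
-- In the Leibniz expansion X occurs only at fixed points of σ; differentiating there leaves the
-- expansion of a diagonal cofactor. The same sum of diagonal cofactors is the covariance term of a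
-- Gaussian column, and so averaging becomes a derivative in q.
theorem derivative_shiftPoly (M : Matrix ι ι ℂ) :
    derivative (shiftPoly M) = ∑ i, (M.map C + Matrix.scalar ι X).adjugate i i := by
  simp only [Matrix.adjugate_apply]
  rw [shiftPoly, Matrix.det_apply, map_sum]
  simp only [Matrix.det_apply]
  rw [Finset.sum_comm]
  refine Finset.sum_congr rfl fun σ _ => ?_
  rw [← Finset.smul_sum, Units.smul_def, map_zsmul, Polynomial.derivative_prod_finset]
  congr 1
  conv_rhs => rw [← Equiv.sum_comp σ]
  refine Finset.sum_congr rfl fun i _ => ?_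
  conv_rhs => rw [← Finset.mul_prod_erase Finset.univ _ (Finset.mem_univ i), mul_comm]
  congr 1
  swap
  · by_cases h : σ i = i
    · simp [h]
    · have h' : i ≠ σ i := fun h'' => h h''.symm
      simp [h, h']
  · refine Finset.prod_congr rfl fun j hj => ?_
    rw [Matrix.updateRow_apply, if_neg]
    intro h
    exact (Finset.mem_erase.1 hj).1 (σ.injective h)

/-- The coefficients of the expansion of `det (q + B diag(y) C)` in powers of `q` and `y`: the
principal minors of `C B`. -/
noncomputable def gramMinor (B C' : Matrix ι ι ℂ) (J : Finset ι) : ℂ :=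
  Matrix.det (Matrix.of fun i j => if i ∈ J then (C' * B) i j else (1 : Matrix ι ι ℂ) i j)

open Polynomial in
/-- `det (q + B diag(y) C)` is multi-affine in `y` and homogeneous in `(q, y)`. -/
theorem shiftPoly_mul_diagonal_mul (B C' : Matrix ι ι ℂ) (y : ι → ℂ) :
    shiftPoly (B * Matrix.diagonal y * C') =
      ∑ J : Finset ι, ((∏ j ∈ J, y j) * gramMinor B C' J) • X ^ (Fintype.card ι - J.card) := by
  refine Polynomial.funext fun q => ?_
  -- Cyclicity of the characteristic polynomial moves diag(y) to the left, where yᵢ scales row i of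
  -- C B. The determinant is then expanded by multilinearity in the rows, J being the set of rows
  -- taken from diag(y) C B.
  have h1 : shiftPoly (B * Matrix.diagonal y * C') =
      shiftPoly (Matrix.diagonal y * (C' * B)) := by
    rw [shiftPoly_eq_charpoly, shiftPoly_eq_charpoly, Matrix.mul_assoc, ← mul_neg,
      Matrix.charpoly_mul_comm, neg_mul, Matrix.mul_assoc]
  rw [h1, eval_shiftPoly]
  have h2 : (Matrix.diagonal y * (C' * B) + Matrix.scalar ι q) =
      Matrix.of ((fun i j => y i * (C' * B) i j) + fun i j => q * (1 : Matrix ι ι ℂ) i j) := by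
    ext i j
    simp [Matrix.diagonal_mul, Matrix.one_apply, Matrix.diagonal_apply]
  rw [h2]
  have h3 := (Matrix.detRowAlternating (n := ι) (R := ℂ)).toMultilinearMap.map_add_univ
    (fun i j => y i * (C' * B) i j) (fun i j => q * (1 : Matrix ι ι ℂ) i j)
  refine h3.trans ?_
  rw [Polynomial.eval_finsetSum]
  refine Finset.sum_congr rfl fun J _ => ?_
  have h4 : (J.piecewise (fun i j => y i * (C' * B) i j) fun i j => q * (1 : Matrix ι ι ℂ) i j) =
      fun i => (J.piecewise y fun _ => q) i •
        fun j => if i ∈ J then (C' * B) i j else (1 : Matrix ι ι ℂ) i j := by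
    funext i j
    by_cases h : i ∈ J <;> simp [h]
  rw [h4, MultilinearMap.map_smul_univ]
  simp only [AlternatingMap.coe_multilinearMap, smul_eq_mul,
    Polynomial.eval_smul, Polynomial.eval_pow, Polynomial.eval_X]
  rw [Finset.prod_piecewise]
  simp only [Finset.univ_inter, Finset.prod_const, ← Finset.compl_eq_univ_sdiff,
    Finset.card_compl]
  rw [mul_right_comm]
  rfl

/-! ### Gaussian averages of determinants -/

open Polynomial in
/-- Averaging `det (q + X + (b + h) (c + h̄)ᵀ)` against a character in the Gaussian vector `h`:
`b` and `c` are shifted, and half a heat operator acts on the dependence on `q`. -/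
theorem integral_shiftPoly_column {v : ℝ≥0} (hv : v ≠ 0) (s b c : ι → ℂ) (M : Matrix ι ι ℂ)
    (ℓ : ℂ[X] →ₗ[ℂ] ℂ) :
    Integrable (fun h : ι → ℂ =>
      (∏ i, Complex.exp (-Complex.I * (starRingEnd ℂ (s i) * h i + s i * starRingEnd ℂ (h i)))) *
        ℓ (shiftPoly (M + Matrix.vecMulVec (b + h) (c + star h))))
      (Measure.pi fun _ => complexGaussian v) ∧
    ∫ h : ι → ℂ,
      (∏ i, Complex.exp (-Complex.I * (starRingEnd ℂ (s i) * h i + s i * starRingEnd ℂ (h i)))) *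
        ℓ (shiftPoly (M + Matrix.vecMulVec (b + h) (c + star h)))
      ∂(Measure.pi fun _ => complexGaussian v) =
    (∏ i, Complex.exp (-(‖s i‖ : ℂ) ^ 2 * v)) *
      (ℓ (shiftPoly (M + Matrix.vecMulVec (fun i => b i + -Complex.I * s i * v)
        (fun i => c i + -Complex.I * starRingEnd ℂ (s i) * v))) +
        v * ℓ (derivative (shiftPoly M))) := by
  set Q : ι → ι → ℂ := fun i k => ℓ ((M.map C + Matrix.scalar ι X).adjugate k i) with hQ
  -- x and y are unrelated here: the expansion is used with y = x̄ under the integral, and again at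
  -- the two complex means, which are not conjugate.
  have key : ∀ x y : ι → ℂ, ℓ (shiftPoly (M + Matrix.vecMulVec (b + x) (c + y))) =
      (ℓ (shiftPoly M) + ∑ i, ∑ k, Q i k * (b i * c k)) + ∑ i, (∑ k, Q i k * c k) * x i
        + ∑ k, (∑ i, Q i k * b i) * y k + ∑ i, ∑ k, Q i k * (x i * y k) := by
    intro x y
    rw [shiftPoly_add_vecMulVec, map_add, map_sum]
    simp only [map_sum, map_smul, smul_eq_mul, Finset.sum_mul]
    rw [Finset.sum_comm (f := fun k i => Q i k * b i * y k), add_assoc, add_assoc, add_assoc]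
    congr 1
    simp only [← Finset.sum_add_distrib, Pi.add_apply, hQ]
    refine Finset.sum_congr rfl fun i _ => Finset.sum_congr rfl fun k _ => ?_
    ring
  have h := PairMoments.pi_affine (fun i => complexGaussian_pairMoments hv (s i))
    (ℓ (shiftPoly M) + ∑ i, ∑ k, Q i k * (b i * c k)) (fun i => ∑ k, Q i k * c k)
    (fun k => ∑ i, Q i k * b i) Q
  have hk : ∀ h : ι → ℂ, ℓ (shiftPoly (M + Matrix.vecMulVec (b + h) (c + star h))) = _ :=
    fun h => key h (star h)
  simp only [hk]
  refine ⟨h.1, h.2.trans ?_⟩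
  congr 1
  have e1 := key (fun i => -Complex.I * s i * v) (fun i => -Complex.I * starRingEnd ℂ (s i) * v)
  have e2 : (fun i => b i + -Complex.I * s i * v) = b + fun i => -Complex.I * s i * v := rfl
  have e3 : (fun i => c i + -Complex.I * starRingEnd ℂ (s i) * v) =
    c + fun i => -Complex.I * starRingEnd ℂ (s i) * v := rfl
  rw [e2, e3, e1, derivative_shiftPoly, map_sum, Finset.mul_sum]
  congr 1
  exact Finset.sum_congr rfl fun i _ => mul_comm _ _

/-- Splits the subsets according to whether they contain the first column, for the induction on the
number of columns. -/
theorem sum_finset_fin_succ {m : ℕ} (f : Finset (Fin (m + 1)) → ℂ) :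
    ∑ T, f T = ∑ T : Finset (Fin m), f (T.map (Fin.succEmb m)) +
      ∑ T : Finset (Fin m), f (insert 0 (T.map (Fin.succEmb m))) := by
  rw [← Finset.powerset_univ, Fin.univ_succ, Finset.cons_eq_insert, Finset.sum_powerset_insert]
  · have h : (Finset.univ.map (Fin.succEmb m)).powerset = Finset.univ.map
        ⟨fun T : Finset (Fin m) => T.map (Fin.succEmb m), Finset.map_injective _⟩ := by
      ext T
      simp [Finset.subset_map_iff, eq_comm]
    simp only [Fin.succEmb] at h ⊢
    rw [h, Finset.sum_map, Finset.sum_map]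
    rfl
  · simp

open Polynomial in
/-- Linear functionals of `det (q + M)` are polynomials in the entries of `M`. -/
theorem PolyGrowth.shiftPoly {E : Type*} [NormedAddCommGroup E] {M : E → Matrix ι ι ℂ}
    (hM : ∀ i j, PolyGrowth fun x => M x i j) (ℓ : ℂ[X] →ₗ[ℂ] ℂ) :
    PolyGrowth fun x => ℓ (shiftPoly (M x)) := by
  -- det (X + M) has degree `card ι`, so it is interpolated from `card ι + 1` values; ℓ of it is
  -- then a fixed combination of determinants.
  set s := Finset.range (Fintype.card ι + 1)
  set v : ℕ → ℂ := fun k => k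
  have h : ∀ x, ℓ (DeformedGinibre.shiftPoly (M x)) = ∑ k ∈ s,
      (M x + Matrix.scalar ι (v k)).det * ℓ (Lagrange.basis s v k) := by
    intro x
    have := Lagrange.eq_interpolate (s := s) (v := v) (f := DeformedGinibre.shiftPoly (M x))
      (fun a _ b _ hab => by simpa [v] using hab) (by
        rw [shiftPoly_eq_charpoly, Matrix.charpoly_degree_eq_dim, Finset.card_range]
        exact_mod_cast Nat.lt_succ_self _)
    conv_lhs => rw [this, Lagrange.interpolate_apply]
    simp only [← Polynomial.smul_eq_C_mul, map_sum, map_smul, smul_eq_mul, eval_shiftPoly]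
  simp only [h]
  refine sum fun k _ => (det fun i j => ?_).mul (const _)
  exact (hM i j).add (const _)

open Polynomial in
/-- Averaging `det (q + X + ∑ (b_j + h_j) (c_j + h̄_j)ᵀ)` over Gaussian columns `h_j`. -/
theorem integral_shiftPoly_columns {v : ℝ≥0} (hv : v ≠ 0) {m : ℕ} (s b c : Fin m → ι → ℂ)
    (M : Matrix ι ι ℂ) (ℓ : ℂ[X] →ₗ[ℂ] ℂ) :
    Integrable (fun h : Fin m → ι → ℂ =>
      (∏ j, ∏ i, Complex.exp (-Complex.I * (starRingEnd ℂ (s j i) * h j i +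
        s j i * starRingEnd ℂ (h j i)))) *
        ℓ (shiftPoly (M + ∑ j, Matrix.vecMulVec (b j + h j) (c j + star (h j)))))
      (Measure.pi fun _ => Measure.pi fun _ => complexGaussian v) ∧
    ∫ h : Fin m → ι → ℂ,
      (∏ j, ∏ i, Complex.exp (-Complex.I * (starRingEnd ℂ (s j i) * h j i +
        s j i * starRingEnd ℂ (h j i)))) *
        ℓ (shiftPoly (M + ∑ j, Matrix.vecMulVec (b j + h j) (c j + star (h j))))
      ∂(Measure.pi fun _ => Measure.pi fun _ => complexGaussian v) =
    (∏ j, ∏ i, Complex.exp (-(‖s j i‖ : ℂ) ^ 2 * v)) *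
      ∑ T : Finset (Fin m), (v : ℂ) ^ T.card * ℓ (derivative^[T.card] (shiftPoly (M +
        ∑ j, if j ∈ T then 0 else Matrix.vecMulVec (fun i => b j i + -Complex.I * s j i * v)
        (fun i => c j i + -Complex.I * starRingEnd ℂ (s j i) * v)))) := by
  have hint : ∀ (m : ℕ) (s b c : Fin m → ι → ℂ) (M : Matrix ι ι ℂ) (ℓ : ℂ[X] →ₗ[ℂ] ℂ),
      Integrable (fun h : Fin m → ι → ℂ =>
      (∏ j, ∏ i, Complex.exp (-Complex.I * (starRingEnd ℂ (s j i) * h j i +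
        s j i * starRingEnd ℂ (h j i)))) *
        ℓ (shiftPoly (M + ∑ j, Matrix.vecMulVec (b j + h j) (c j + star (h j)))))
      (Measure.pi fun _ => Measure.pi fun _ => complexGaussian v) := by
    intro m s b c M ℓ
    have hw := (((rapidWeight_complexGaussian hv).pi (ι := ι)).pi (ι := Fin m))
    have hx : ∀ j i, PolyGrowth fun h : Fin m → ι → ℂ => h j i := fun j i =>
      (PolyGrowth.eval i).comp_apply j
    have hf : PolyGrowth fun h : Fin m → ι → ℂ =>
        (∏ j, ∏ i, Complex.exp (-Complex.I * (starRingEnd ℂ (s j i) * h j i +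
        s j i * starRingEnd ℂ (h j i)))) *
        ℓ (shiftPoly (M + ∑ j, Matrix.vecMulVec (b j + h j) (c j + star (h j)))) := by
      refine PolyGrowth.mul (.prod fun j _ => .prod fun i _ => ?_) (.shiftPoly (fun i k => ?_) ℓ)
      · refine PolyGrowth.of_bounded ?_ (C := 1) fun h => ?_
        · refine Complex.continuous_exp.comp (continuous_const.mul ((continuous_const.mul
            (hx j i).1).add (continuous_const.mul (hx j i).star.1)))
        · rw [Complex.norm_exp]
          simp
          ring_nf
          rfl
      · simp only [Matrix.add_apply, Matrix.sum_apply, Matrix.vecMulVec_apply, Pi.add_apply,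
          Pi.star_apply]
        exact (PolyGrowth.const _).add (.sum fun j _ => ((PolyGrowth.const _).add (hx j i)).mul
          ((PolyGrowth.const _).add (hx j k).star))
    simpa using hw.integrable_mul hf
  refine ⟨hint m s b c M ℓ, ?_⟩
  -- Averaging the first column gives two terms: either a rank-one matrix joins M, or a derivative
  -- joins ℓ. Both therefore vary in the induction, and T collects the columns of the second kind.
  induction m generalizing M ℓ with
  | zero =>
    have : (default : Finset (Fin 0)) = ∅ := rfl
    simp [this]
  | succ m ih =>
    have hmp := (measurePreserving_piFinSuccAbove
      (fun _ : Fin (m + 1) => Measure.pi fun _ : ι => complexGaussian v) 0).symm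
    have hi := (hmp.integrable_comp_emb (MeasurableEquiv.measurableEmbedding _)).2
      (hint (m + 1) s b c M ℓ)
    rw [← hmp.integral_comp (MeasurableEquiv.measurableEmbedding _)]
    have hval : ∀ (x : ι → ℂ) (h : Fin m → ι → ℂ),
        (MeasurableEquiv.piFinSuccAbove (fun _ : Fin (m + 1) => ι → ℂ) 0).symm (x, h) =
          Fin.cons x h := fun x h => by
      simp [MeasurableEquiv.piFinSuccAbove, Fin.insertNthEquiv]
    refine (integral_prod_symm _ hi).trans ?_
    simp only [Function.comp_apply, hval, Fin.prod_univ_succ, Fin.sum_univ_succ, Fin.cons_zero, Fin.cons_succ]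
    set s₀ := s 0
    set bt : Fin m → ι → ℂ := fun j => b j.succ
    set ct : Fin m → ι → ℂ := fun j => c j.succ
    set st : Fin m → ι → ℂ := fun j => s j.succ
    set b' : ι → ℂ := fun i => b 0 i + -Complex.I * s 0 i * v with hb'
    set c' : ι → ℂ := fun i => c 0 i + -Complex.I * starRingEnd ℂ (s 0 i) * v with hc'
    set E₀ := ∏ i, Complex.exp (-(‖s 0 i‖ : ℂ) ^ 2 * v)
    set W : (Fin m → ι → ℂ) → ℂ := fun h => ∏ j, ∏ i, Complex.exp (-Complex.I *
      (starRingEnd ℂ (st j i) * h j i + st j i * starRingEnd ℂ (h j i))) with hW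
    set S : (Fin m → ι → ℂ) → Matrix ι ι ℂ :=
      fun h => ∑ j, Matrix.vecMulVec (bt j + h j) (ct j + star (h j)) with hS
    set ℓ' : ℂ[X] →ₗ[ℂ] ℂ := ℓ ∘ₗ derivative with hℓ'
    have inner : ∀ h : Fin m → ι → ℂ, (∫ x : ι → ℂ,
        (∏ i, Complex.exp (-Complex.I * (starRingEnd ℂ (s 0 i) * x i +
          s 0 i * starRingEnd ℂ (x i)))) * W h *
        ℓ (shiftPoly (M + (Matrix.vecMulVec (b 0 + x) (c 0 + star x) + S h)))
        ∂(Measure.pi fun _ => complexGaussian v)) =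
        E₀ * (W h * ℓ (shiftPoly ((M + Matrix.vecMulVec b' c') + S h)) +
          v * (W h * ℓ' (shiftPoly (M + S h)))) := by
      intro h
      have e := (integral_shiftPoly_column hv (s 0) (b 0) (c 0) (M + S h) ℓ).2
      have e' : ∀ x : ι → ℂ, M + (Matrix.vecMulVec (b 0 + x) (c 0 + star x) + S h) =
        M + S h + Matrix.vecMulVec (b 0 + x) (c 0 + star x) := fun x => by abel
      simp only [e', mul_right_comm _ (W h)]
      rw [integral_mul_const, e, add_right_comm M]
      simp only [hℓ', LinearMap.comp_apply]
      ring
    refine (integral_congr_ae (Filter.Eventually.of_forall inner)).trans ?_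
    have iA := hint m st bt ct (M + Matrix.vecMulVec b' c') ℓ
    have iB := hint m st bt ct M ℓ'
    rw [integral_const_mul, integral_add iA (iB.const_mul _), integral_const_mul,
      ih st bt ct (M + Matrix.vecMulVec b' c') ℓ, ih st bt ct M ℓ', sum_finset_fin_succ]
    have hcard : ∀ T : Finset (Fin m), (insert 0 (T.map (Fin.succEmb m))).card = T.card + 1 := by
      intro T
      rw [Finset.card_insert_of_notMem (by simp), Finset.card_map]
    simp only [Finset.card_map, hcard, Finset.mem_insert, Finset.mem_map, Fin.coe_succEmb,
      Fin.succ_inj, exists_eq_right, Fin.succ_ne_zero, and_false, exists_false, or_false,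
      if_true, if_false, zero_add, false_or, hℓ', LinearMap.comp_apply, add_assoc,
      ← Function.iterate_succ_apply' derivative, pow_succ', Finset.mul_sum, mul_add, mul_assoc]
    congr 1
    refine Finset.sum_congr rfl fun T _ => ?_
    ring

end Det

/-! ### Averaging the derivative of the determinant over independent columns -/

section Average

variable {n : ℕ}

open Polynomial in
-- Deleting the columns in T kills every monomial indexed by a J that meets T, so J survives exactly
-- for T ⊆ Jᶜ. Counting these T by size gives the binomial expansion of (1 + v ∂_q)^(n - |J|) acting
-- on q^(n - |J|).
theorem sum_heat_shiftPoly (B C' : Matrix (Fin n) (Fin n) ℂ) (v : ℂ) (ℓ : ℂ[X] →ₗ[ℂ] ℂ) :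
    ∑ T : Finset (Fin n), v ^ T.card * ℓ (derivative^[T.card] (shiftPoly
      (B * Matrix.diagonal (fun j => if j ∈ T then 0 else 1) * C'))) =
    ∑ J : Finset (Fin n), gramMinor B C' J * ∑ k ∈ Finset.range (n - J.card + 1),
      (n - J.card).choose k * (v ^ k * ℓ (derivative^[k] (X ^ (n - J.card)))) := by
  have h1 : ∀ T : Finset (Fin n), v ^ T.card * ℓ (derivative^[T.card] (shiftPoly
      (B * Matrix.diagonal (fun j => if j ∈ T then 0 else 1) * C'))) =
      ∑ J : Finset (Fin n), if T ⊆ Jᶜ then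
        gramMinor B C' J * (v ^ T.card * ℓ (derivative^[T.card] (X ^ (n - J.card)))) else 0 := by
    intro T
    rw [shiftPoly_mul_diagonal_mul, Polynomial.iterate_derivative_sum, map_sum, Finset.mul_sum]
    refine Finset.sum_congr rfl fun J _ => ?_
    rw [Polynomial.iterate_derivative_smul, map_smul, smul_eq_mul, Fintype.card_fin]
    by_cases hT : T ⊆ Jᶜ
    · have : ∏ j ∈ J, (if j ∈ T then (0 : ℂ) else 1) = 1 := by
        refine Finset.prod_eq_one fun j hj => if_neg fun hjT => ?_
        exact (Finset.mem_compl.1 (hT hjT)) hj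
      rw [if_pos hT, this]
      ring
    · have : ∏ j ∈ J, (if j ∈ T then (0 : ℂ) else 1) = 0 := by
        obtain ⟨j, hj, hj'⟩ := Finset.not_subset.1 hT
        exact Finset.prod_eq_zero (by simpa using hj') (if_pos hj)
      rw [if_neg hT, this]
      ring
  simp only [h1]
  rw [Finset.sum_comm]
  refine Finset.sum_congr rfl fun J _ => ?_
  rw [← Finset.sum_filter, ← Finset.mul_sum]
  congr 1
  have h2 : (Finset.univ.filter fun T : Finset (Fin n) => T ⊆ Jᶜ) = Jᶜ.powerset := by
    ext T; simp
  rw [h2, Finset.sum_powerset_apply_card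
    (fun k => v ^ k * ℓ (derivative^[k] (X ^ (n - J.card)))), Finset.card_compl,
    Fintype.card_fin]
  simp only [nsmul_eq_mul]

/-- For a ≠ b, the rotation by the angle π / (a - b) preserves the measure and multiplies the
integrand by -1. -/
theorem integral_pow_mul_conj_pow {N : ℝ} (hN : 0 < N) (a b : ℕ) :
    ∫ w : ℂ, w ^ a * starRingEnd ℂ w ^ b * (Real.exp (-N * ‖w‖ ^ 2) : ℂ) =
      if a = b then (Real.pi : ℂ) * b.factorial / (N : ℂ) ^ (b + 1) else 0 := by
  split_ifs with h
  · subst h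
    rw [← integral_norm_pow_mul_cexp (γ := N) (by simpa using hN)]
    congr 1
    funext w
    rw [← mul_pow, Complex.mul_conj', mul_comm]
    push_cast
    rfl
  · set θ : ℝ := Real.pi / ((a : ℝ) - b)
    have hab : (a : ℝ) - b ≠ 0 := sub_ne_zero.2 (by exact_mod_cast h)
    have hmp := (rotation (Circle.exp θ)).measurePreserving
    have h1 := hmp.integral_comp (rotation (Circle.exp θ)).toHomeomorph.measurableEmbedding
      (fun w : ℂ => w ^ a * starRingEnd ℂ w ^ b * (Real.exp (-N * ‖w‖ ^ 2) : ℂ))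
    simp only [rotation_apply, map_mul, norm_mul, Circle.norm_coe, one_mul, mul_pow] at h1
    have h2 : ((Circle.exp θ : Circle) : ℂ) ^ a *
        (starRingEnd ℂ (Circle.exp θ : Circle)) ^ b = -1 := by
      rw [← Circle.coe_inv_eq_conj, ← Circle.exp_neg, Circle.coe_exp, Circle.coe_exp,
        ← Complex.exp_nat_mul, ← Complex.exp_nat_mul, ← Complex.exp_add, ← Complex.exp_pi_mul_I]
      congr 1
      have : ((a : ℂ) - b) ≠ 0 := by exact_mod_cast hab
      simp only [θ]
      push_cast
      field_simp
      ring
    have h3 : ∀ w : ℂ, ((Circle.exp θ : Circle) : ℂ) ^ a * w ^ a *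
        ((starRingEnd ℂ (Circle.exp θ : Circle)) ^ b * starRingEnd ℂ w ^ b) *
        (Real.exp (-N * ‖w‖ ^ 2) : ℂ) =
        -(w ^ a * starRingEnd ℂ w ^ b * (Real.exp (-N * ‖w‖ ^ 2) : ℂ)) := by
      intro w
      rw [mul_mul_mul_comm, h2]
      ring
    simp only [h3, integral_neg] at h1
    exact CharZero.eq_neg_self_iff.1 h1.symm

/-- `(1/m!) (d/dq)` of the heat flow of `q ^ m`. -/
noncomputable def heatSum (v q : ℂ) (m : ℕ) : ℂ :=
  ∑ k ∈ Finset.range (m + 1), m.choose k * (v ^ k * (m.descFactorial (k + 1) * q ^ (m - (k + 1))))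

theorem integrable_polyGrowth_mul_gaussian {N : ℝ} (hN : 0 < N) {f : ℂ → ℂ} (hf : PolyGrowth f) :
    Integrable fun w : ℂ => f w * (Real.exp (-N * ‖w‖ ^ 2) : ℂ) :=
  (rapidWeight_gaussian hN).integrable_mul hf

/-- Expand both powers binomially and use Re w = (w + w̄)/2. Only equal powers of w and w̄ survive,
which pairs the index a of one expansion with a + 1 of the other; this offset by one yields the
extra derivative and the odd power of ε. -/
theorem integral_binomial {N : ℝ} (hN : 0 < N) (ε : ℝ) (m : ℕ) :
    ∫ w : ℂ, (w.re : ℂ) * ((w - ε) * (starRingEnd ℂ w - ε)) ^ m * (Real.exp (-N * ‖w‖ ^ 2) : ℂ) =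
      -(Real.pi * ε / N ^ 2) * heatSum (1 / N) ((ε : ℂ) ^ 2) m := by
  have hN' : (N : ℂ) ≠ 0 := by exact_mod_cast hN.ne'
  set E : ℂ → ℂ := fun w => (Real.exp (-N * ‖w‖ ^ 2) : ℂ) with hE
  have hint : ∀ a b : ℕ, Integrable fun w : ℂ => w ^ a * starRingEnd ℂ w ^ b * E w := fun a b =>
    integrable_polyGrowth_mul_gaussian hN ((PolyGrowth.id.pow a).mul (PolyGrowth.id.star.pow b))
  set K : ℕ → ℕ → ℂ := fun a b => m.choose a * m.choose b * ((-ε) ^ (m - a) * (-ε) ^ (m - b))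
    with hK
  have key : ∀ w : ℂ, (w.re : ℂ) * ((w - ε) * (starRingEnd ℂ w - ε)) ^ m * E w =
      ∑ a ∈ Finset.range (m + 1), ∑ b ∈ Finset.range (m + 1), K a b / 2 *
        (w ^ (a + 1) * starRingEnd ℂ w ^ b * E w + w ^ b * starRingEnd ℂ w ^ (a + 1) * E w) := by
    intro w
    have hre : (w.re : ℂ) = (w + starRingEnd ℂ w) / 2 := by
      rw [Complex.add_conj]; push_cast; ring
    have h1 : (w - ε) ^ m = ∑ a ∈ Finset.range (m + 1), w ^ a * (-ε : ℂ) ^ (m - a) * m.choose a := by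
      rw [sub_eq_add_neg, add_pow]
    have h2 : (starRingEnd ℂ w - ε) ^ m =
        ∑ a ∈ Finset.range (m + 1), starRingEnd ℂ w ^ a * (-ε : ℂ) ^ (m - a) * m.choose a := by
      rw [sub_eq_add_neg, add_pow]
    have h3 : w * ((w - ε) ^ m * (starRingEnd ℂ w - ε) ^ m) =
        ∑ a ∈ Finset.range (m + 1), ∑ b ∈ Finset.range (m + 1), K a b *
          (w ^ (a + 1) * starRingEnd ℂ w ^ b) := by
      rw [h1, h2, Finset.sum_mul_sum, Finset.mul_sum]
      refine Finset.sum_congr rfl fun a _ => ?_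
      rw [Finset.mul_sum]
      refine Finset.sum_congr rfl fun b _ => ?_
      simp only [hK, pow_succ]
      ring
    have h4 : starRingEnd ℂ w * ((w - ε) ^ m * (starRingEnd ℂ w - ε) ^ m) =
        ∑ a ∈ Finset.range (m + 1), ∑ b ∈ Finset.range (m + 1), K a b *
          (w ^ b * starRingEnd ℂ w ^ (a + 1)) := by
      rw [mul_comm (_ ^ m), h1, h2, Finset.sum_mul_sum, Finset.mul_sum]
      refine Finset.sum_congr rfl fun a _ => ?_
      rw [Finset.mul_sum]
      refine Finset.sum_congr rfl fun b _ => ?_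
      simp only [hK, pow_succ]
      ring
    have h5 : (w.re : ℂ) * ((w - ε) * (starRingEnd ℂ w - ε)) ^ m * E w =
        (w * ((w - ε) ^ m * (starRingEnd ℂ w - ε) ^ m) +
          starRingEnd ℂ w * ((w - ε) ^ m * (starRingEnd ℂ w - ε) ^ m)) * (E w / 2) := by
      rw [hre, mul_pow]
      ring
    rw [h5, h3, h4, ← Finset.sum_add_distrib, Finset.sum_mul]
    refine Finset.sum_congr rfl fun a _ => ?_
    rw [← Finset.sum_add_distrib, Finset.sum_mul]
    refine Finset.sum_congr rfl fun b _ => ?_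
    ring
  refine (integral_congr_ae (Filter.Eventually.of_forall key)).trans ?_
  have i2 : ∀ a b, Integrable fun w : ℂ => K a b / 2 *
        (w ^ (a + 1) * starRingEnd ℂ w ^ b * E w + w ^ b * starRingEnd ℂ w ^ (a + 1) * E w) :=
    fun a b => ((hint _ _).add (hint _ _)).const_mul _
  rw [integral_finsetSum _ fun a _ => integrable_finsetSum _ fun b _ => i2 a b, heatSum,
    Finset.mul_sum]
  refine Finset.sum_congr rfl fun a ha => ?_
  rw [integral_finsetSum _ fun b _ => i2 a b]
  have h6 : ∀ b ∈ Finset.range (m + 1), (∫ w : ℂ, K a b / 2 *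
        (w ^ (a + 1) * starRingEnd ℂ w ^ b * E w + w ^ b * starRingEnd ℂ w ^ (a + 1) * E w)) =
      if a + 1 = b then K a b * (Real.pi * b.factorial / N ^ (b + 1)) else 0 := by
    intro b _
    rw [integral_const_mul, integral_add (hint _ _) (hint _ _), integral_pow_mul_conj_pow hN,
      integral_pow_mul_conj_pow hN]
    by_cases hab : a + 1 = b
    · subst hab
      simp
      ring
    · simp [hab, Ne.symm hab]
  rw [Finset.sum_congr rfl h6, Finset.sum_ite_eq]
  rw [Finset.mem_range] at ha
  split_ifs with hb
  · rw [Finset.mem_range] at hb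
    obtain ⟨r, rfl⟩ : ∃ r, m = a + 1 + r := ⟨m - (a + 1), by omega⟩
    simp only [hK, Nat.descFactorial_eq_factorial_mul_choose]
    have e1 : a + 1 + r - a = r + 1 := by omega
    have e2 : a + 1 + r - (a + 1) = r := by omega
    rw [e1, e2, ← pow_add]
    have e3 : (-(ε : ℂ)) ^ (r + 1 + r) = -ε * (ε ^ 2) ^ r := by
      rw [show r + 1 + r = 2 * r + 1 by ring, pow_succ, pow_mul, neg_sq, mul_comm]
    rw [e3, one_div, inv_pow]
    push_cast
    field_simp
    ring
  -- The top index a = m has no partner m + 1; correspondingly the falling factorial of m of length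
  -- m + 1 vanishes.
  · have : a = m := by
      rw [Finset.mem_range] at hb
      omega
    subst this
    simp

/-- This is the origin of u. With w = u + ε one has Re w = u₁ + ε and (w - ε)(w̄ - ε) = |u|², so ∂_q
(1 + v ∂_q)^m q^m at ε² becomes a planar average of |u|^(2m). Since |u|² merely takes the place of
q, the monomials reassemble into a determinant. -/
theorem integral_shifted_pow {N : ℝ} (hN : 0 < N) (ε : ℝ) (m : ℕ) :
    Integrable (fun u : ℝ × ℝ => ((u.1 : ℂ) + ε) * ((u.1 : ℂ) ^ 2 + (u.2 : ℂ) ^ 2) ^ m *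
      Complex.exp (-N * ((u.1 + ε) ^ 2 + u.2 ^ 2))) ∧
    ∫ u : ℝ × ℝ, ((u.1 : ℂ) + ε) * ((u.1 : ℂ) ^ 2 + (u.2 : ℂ) ^ 2) ^ m *
      Complex.exp (-N * ((u.1 + ε) ^ 2 + u.2 ^ 2)) =
      -(Real.pi * ε / N ^ 2) * heatSum (1 / N) ((ε : ℂ) ^ 2) m := by
  have hi : Integrable fun w : ℂ => (w.re : ℂ) * ((w - ε) * (starRingEnd ℂ w - ε)) ^ m *
      (Real.exp (-N * ‖w‖ ^ 2) : ℂ) := by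
    refine integrable_polyGrowth_mul_gaussian hN (PolyGrowth.mul ?_ (PolyGrowth.pow ?_ m))
    · exact .of_norm_le (by fun_prop) (C := 1) fun x => by
        rw [Complex.norm_real]
        linarith [Complex.abs_re_le_norm x, Real.norm_eq_abs x.re]
    · exact (PolyGrowth.id.sub (.const _)).mul (PolyGrowth.id.star.sub (.const _))
  have hm := (Complex.volume_preserving_equiv_real_prod).symm.comp
    (measurePreserving_add_right (volume : Measure (ℝ × ℝ)) (ε, (0 : ℝ)))
  have hemb : MeasurableEmbedding (⇑Complex.measurableEquivRealProd.symm ∘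
      fun x : ℝ × ℝ => x + (ε, (0 : ℝ))) :=
    (MeasurableEquiv.measurableEmbedding _).comp (measurableEmbedding_addRight _)
  have hval : ∀ u : ℝ × ℝ, (fun w : ℂ => (w.re : ℂ) * ((w - ε) * (starRingEnd ℂ w - ε)) ^ m *
      (Real.exp (-N * ‖w‖ ^ 2) : ℂ)) ((⇑Complex.measurableEquivRealProd.symm ∘
      fun x : ℝ × ℝ => x + (ε, (0 : ℝ))) u) =
      ((u.1 : ℂ) + ε) * ((u.1 : ℂ) ^ 2 + (u.2 : ℂ) ^ 2) ^ m *
      Complex.exp (-N * ((u.1 + ε) ^ 2 + u.2 ^ 2)) := by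
    intro u
    simp only [Function.comp_apply, Complex.measurableEquivRealProd_symm_apply, Prod.fst_add,
      Prod.snd_add, add_zero, ← Complex.normSq_eq_norm_sq]
    congr 1
    · congr 1
      · simp
      · congr 1
        apply Complex.ext <;> simp [pow_two]
        ring
    · rw [Complex.ofReal_exp]
      congr 1
      simp [Complex.normSq_apply]
      ring_nf
      simp
  constructor
  · refine ((hm.integrable_comp_emb hemb).2 hi).congr ?_
    filter_upwards with u using hval u
  · rw [← integral_binomial hN, ← hm.integral_comp hemb]
    exact integral_congr_ae (Filter.Eventually.of_forall fun u => (hval u).symm)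

open Polynomial in
theorem eval_derivative_iterate_X_pow (q : ℂ) (m k : ℕ) :
    ((Polynomial.leval q ∘ₗ derivative : ℂ[X] →ₗ[ℂ] ℂ) (derivative^[k] (X ^ m))) =
      m.descFactorial (k + 1) * q ^ (m - (k + 1)) := by
  rw [LinearMap.comp_apply, ← Function.iterate_succ_apply' derivative,
    Polynomial.iterate_derivative_X_pow_eq_natCast_mul]
  simp

open Polynomial in
/-- The Gaussian average of the `q`-derivative of `det (q + M M^*)`, against a character, as a
two-dimensional Gaussian integral over `u`. -/
theorem integral_derivative_det {v : ℝ≥0} (hv : v ≠ 0) {ε : ℝ} (hε : ε ≠ 0)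
    (s b c : Fin n → Fin n → ℂ) :
    ∫ h : Fin n → Fin n → ℂ,
      (∏ j, ∏ i, Complex.exp (-Complex.I * (starRingEnd ℂ (s j i) * h j i +
        s j i * starRingEnd ℂ (h j i)))) *
        (derivative (shiftPoly (∑ j, Matrix.vecMulVec (b j + h j) (c j + star (h j))))).eval
          ((ε : ℂ) ^ 2)
      ∂(Measure.pi fun _ => Measure.pi fun _ => complexGaussian v) =
    (∏ j, ∏ i, Complex.exp (-(‖s j i‖ : ℂ) ^ 2 * v)) *
      (-((v : ℂ)⁻¹ ^ 2 / (Real.pi * ε)) * ∫ u : ℝ × ℝ,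
        ((u.1 : ℂ) + ε) * Complex.exp (-(v : ℂ)⁻¹ * ((u.1 + ε) ^ 2 + u.2 ^ 2)) *
        (∑ j, Matrix.vecMulVec (fun i => b j i + -Complex.I * s j i * v)
          (fun i => c j i + -Complex.I * starRingEnd ℂ (s j i) * v) +
          Matrix.scalar (Fin n) ((u.1 : ℂ) ^ 2 + (u.2 : ℂ) ^ 2)).det) := by
  set B : Matrix (Fin n) (Fin n) ℂ := Matrix.of fun i j => b j i + -Complex.I * s j i * v
  set C' : Matrix (Fin n) (Fin n) ℂ :=
    Matrix.of fun j i => c j i + -Complex.I * starRingEnd ℂ (s j i) * v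
  have hBC : ∀ y : Fin n → ℂ, B * Matrix.diagonal y * C' = ∑ j, y j •
      Matrix.vecMulVec (fun i => b j i + -Complex.I * s j i * v)
          (fun i => c j i + -Complex.I * starRingEnd ℂ (s j i) * v) := by
    intro y
    ext i k
    rw [Matrix.mul_apply, Matrix.sum_apply]
    refine Finset.sum_congr rfl fun j _ => ?_
    rw [Matrix.mul_diagonal, Matrix.smul_apply, Matrix.vecMulVec_apply]
    simp only [B, C', Matrix.of_apply, smul_eq_mul]
    ring
  have h := (integral_shiftPoly_columns hv s b c (0 : Matrix (Fin n) (Fin n) ℂ)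
    (Polynomial.leval ((ε : ℂ) ^ 2) ∘ₗ derivative)).2
  simp only [zero_add, LinearMap.comp_apply, Polynomial.leval_apply] at h
  rw [h]
  congr 1
  have hT : ∀ T : Finset (Fin n), (∑ j, if j ∈ T then 0 else
      Matrix.vecMulVec (fun i => b j i + -Complex.I * s j i * v)
        (fun i => c j i + -Complex.I * starRingEnd ℂ (s j i) * v)) =
      B * Matrix.diagonal (fun j => if j ∈ T then 0 else 1) * C' := by
    intro T
    rw [hBC]
    refine Finset.sum_congr rfl fun j _ => ?_
    split_ifs <;> simp
  simp only [hT]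
  have h1 := sum_heat_shiftPoly B C' v (Polynomial.leval ((ε : ℂ) ^ 2) ∘ₗ derivative)
  simp only [eval_derivative_iterate_X_pow] at h1
  simp only [LinearMap.comp_apply, Polynomial.leval_apply] at h1
  rw [h1]
  have hone : ∑ j, Matrix.vecMulVec (fun i => b j i + -Complex.I * s j i * v)
          (fun i => c j i + -Complex.I * starRingEnd ℂ (s j i) * v) =
      B * Matrix.diagonal (fun _ => 1) * C' := by
    rw [hBC]; simp
  have hv' : (0 : ℝ) < (v : ℝ)⁻¹ := by positivity
  have hu := fun m => integral_shifted_pow hv' ε m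
  -- With no column deleted the expansion has the same coefficients `gramMinor`, so the two sides
  -- are compared one J at a time.
  have hdet : ∀ q : ℂ, (B * Matrix.diagonal (fun _ => 1) * C' + Matrix.scalar (Fin n) q).det =
      ∑ J : Finset (Fin n), gramMinor B C' J * q ^ (n - J.card) := by
    intro q
    rw [← eval_shiftPoly, shiftPoly_mul_diagonal_mul, Polynomial.eval_finsetSum]
    simp
  simp only [hone, hdet, Finset.mul_sum]
  have hJ : ∀ (J : Finset (Fin n)) (u : ℝ × ℝ),
      ((u.1 : ℂ) + ε) * Complex.exp (-(v : ℂ)⁻¹ * ((u.1 + ε) ^ 2 + u.2 ^ 2)) *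
        (gramMinor B C' J * ((u.1 : ℂ) ^ 2 + (u.2 : ℂ) ^ 2) ^ (n - J.card)) =
      gramMinor B C' J * (((u.1 : ℂ) + ε) * ((u.1 : ℂ) ^ 2 + (u.2 : ℂ) ^ 2) ^ (n - J.card) *
      Complex.exp (-(v⁻¹ : ℝ) * ((u.1 + ε) ^ 2 + u.2 ^ 2))) := by
    intro J u
    push_cast
    ring
  simp only [hJ]
  rw [integral_finsetSum _ fun J _ => (hu _).1.const_mul _, Finset.mul_sum]
  refine Finset.sum_congr rfl fun J _ => ?_
  rw [integral_const_mul, (hu _).2, ← Finset.mul_sum]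
  have hvc : (v : ℂ) ≠ 0 := by exact_mod_cast hv
  have hεc : (ε : ℂ) ≠ 0 := by exact_mod_cast hε
  have hpi : (Real.pi : ℂ) ≠ 0 := by exact_mod_cast Real.pi_ne_zero
  have hs : heatSum (1 / (v⁻¹ : ℝ)) ((ε : ℂ) ^ 2) (n - J.card) = ∑ k ∈ Finset.range (n - J.card + 1),
      (n - J.card).choose k * ((v : ℂ) ^ k * ((n - J.card).descFactorial (k + 1) *
        ((ε : ℂ) ^ 2) ^ (n - J.card - (k + 1)))) := by
    rw [heatSum]
    simp
  rw [hs]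
  push_cast
  field_simp

end Average

/-! ### Quadratic factors and oscillating exponentials -/

section QuadFactor

variable {n : ℕ}

/-- The sesquilinear form `φ₁^* M φ₂`. -/
noncomputable def sesq (M : Matrix (Fin n) (Fin n) ℂ) (φ₁ φ₂ : Fin n → ℂ) : ℂ :=
  star φ₁ ⬝ᵥ (M *ᵥ φ₂)

theorem sesq_eq_sum (M : Matrix (Fin n) (Fin n) ℂ) (φ₁ φ₂ : Fin n → ℂ) :
    sesq M φ₁ φ₂ = ∑ i, ∑ j, starRingEnd ℂ (φ₁ i) * M i j * φ₂ j := by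
  simp only [sesq, dotProduct, Matrix.mulVec, Finset.mul_sum, Pi.star_apply, RCLike.star_def,
    mul_assoc]

theorem sesq_mulVec_right (M N : Matrix (Fin n) (Fin n) ℂ) (φ₁ φ₂ : Fin n → ℂ) :
    sesq M φ₁ (N *ᵥ φ₂) = sesq (M * N) φ₁ φ₂ := by
  rw [sesq, sesq, Matrix.mulVec_mulVec]

theorem sesq_mulVec_left (M N : Matrix (Fin n) (Fin n) ℂ) (φ₁ φ₂ : Fin n → ℂ) :
    sesq M (N *ᵥ φ₁) φ₂ = sesq (Nᴴ * M) φ₁ φ₂ := by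
  rw [sesq, sesq, Matrix.star_mulVec, ← Matrix.dotProduct_mulVec, Matrix.mulVec_mulVec]

theorem sesq_diagonal (d : Fin n → ℂ) (φ : Fin n → ℂ) :
    sesq (Matrix.diagonal d) φ φ = ∑ i, d i * (‖φ i‖ : ℂ) ^ 2 := by
  simp only [sesq, dotProduct, Matrix.mulVec_diagonal, Pi.star_apply, RCLike.star_def]
  refine Finset.sum_congr rfl fun i _ => ?_
  rw [← Complex.conj_mul']
  ring

theorem sesq_one (φ : Fin n → ℂ) : sesq 1 φ φ = ∑ i, (‖φ i‖ : ℂ) ^ 2 := by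
  rw [← Matrix.diagonal_one, sesq_diagonal]
  simp

theorem sesq_smul_left (M : Matrix (Fin n) (Fin n) ℂ) (c : ℂ) (φ₁ φ₂ : Fin n → ℂ) :
    sesq M (c • φ₁) φ₂ = starRingEnd ℂ c * sesq M φ₁ φ₂ := by
  rw [sesq, sesq, star_smul, smul_dotProduct, smul_eq_mul, starRingEnd_apply]

theorem sesq_smul_right (M : Matrix (Fin n) (Fin n) ℂ) (c : ℂ) (φ₁ φ₂ : Fin n → ℂ) :
    sesq M φ₁ (c • φ₂) = c * sesq M φ₁ φ₂ := by
  rw [sesq, sesq, Matrix.mulVec_smul, dotProduct_smul, smul_eq_mul]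

theorem PolyGrowth.sesq {E : Type*} [NormedAddCommGroup E] (M : Matrix (Fin n) (Fin n) ℂ)
    {f g : E → Fin n → ℂ} (hf : ∀ i, PolyGrowth fun x => f x i) (hg : ∀ i, PolyGrowth fun x => g x i) :
    PolyGrowth fun x => sesq M (f x) (g x) := by
  simp only [sesq_eq_sum]
  exact .sum fun i _ => .sum fun j _ => ((hf i).star.mul (.const _)).mul (hg j)

/-- The oscillating factor `exp (-2 i Re (φ₁^* a φ₂))`. -/
noncomputable def osc (a : Matrix (Fin n) (Fin n) ℂ) (x : (Fin n → ℂ) × (Fin n → ℂ)) : ℂ :=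
  Complex.exp (-Complex.I * (sesq a x.1 x.2 + starRingEnd ℂ (sesq a x.1 x.2)))

/-- The quadratic factor produced by a rank two perturbation of `a a^*`. -/
noncomputable def quadFactor (a G : Matrix (Fin n) (Fin n) ℂ) (δ : ℂ)
    (x : (Fin n → ℂ) × (Fin n → ℂ)) : ℂ :=
  (1 - Complex.I * δ * sesq (G * a) x.1 x.2) * (1 - Complex.I * δ * sesq (aᴴ * G) x.2 x.1) -
    δ ^ 2 * (sesq G x.1 x.1 * sesq (1 - aᴴ * G * a) x.2 x.2)

/-- The squared Euclidean norm. -/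
noncomputable def sqNorm (φ : Fin n → ℂ) : ℝ := ∑ i, ‖φ i‖ ^ 2

theorem osc_eq (a : Matrix (Fin n) (Fin n) ℂ) (x : (Fin n → ℂ) × (Fin n → ℂ)) :
    osc a x = Complex.exp ((-2 * (sesq a x.1 x.2).re : ℝ) * Complex.I) := by
  rw [osc, Complex.add_conj]
  congr 1
  push_cast
  ring

theorem norm_osc (a : Matrix (Fin n) (Fin n) ℂ) (x : (Fin n → ℂ) × (Fin n → ℂ)) :
    ‖osc a x‖ = 1 := by
  rw [osc_eq, Complex.norm_exp_ofReal_mul_I]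

theorem continuous_sesq (M : Matrix (Fin n) (Fin n) ℂ) :
    Continuous fun x : (Fin n → ℂ) × (Fin n → ℂ) => sesq M x.1 x.2 :=
  (PolyGrowth.sesq M (fun i => (PolyGrowth.eval i).comp_fst)
    (fun i => (PolyGrowth.eval i).comp_snd)).1

theorem continuous_osc (a : Matrix (Fin n) (Fin n) ℂ) : Continuous (osc a) := by
  have := continuous_sesq a
  unfold osc
  fun_prop

theorem PolyGrowth.osc (a : Matrix (Fin n) (Fin n) ℂ) : PolyGrowth (osc a) :=
  .of_bounded (continuous_osc a) (C := 1) fun x => (norm_osc a x).le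

theorem PolyGrowth.quadFactor (a G : Matrix (Fin n) (Fin n) ℂ) (δ : ℂ) :
    PolyGrowth (quadFactor a G δ) := by
  have h1 : ∀ i, PolyGrowth fun x : (Fin n → ℂ) × (Fin n → ℂ) => x.1 i :=
    fun i => (PolyGrowth.eval i).comp_fst
  have h2 : ∀ i, PolyGrowth fun x : (Fin n → ℂ) × (Fin n → ℂ) => x.2 i :=
    fun i => (PolyGrowth.eval i).comp_snd
  refine .sub (.mul ?_ ?_) ((PolyGrowth.const _).mul (.mul (.sesq _ h1 h1) (.sesq _ h2 h2)))
  · exact (PolyGrowth.const _).sub ((PolyGrowth.const _).mul (.sesq _ h1 h2))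
  · exact (PolyGrowth.const _).sub ((PolyGrowth.const _).mul (.sesq _ h2 h1))

theorem continuous_sqNorm : Continuous (sqNorm : (Fin n → ℂ) → ℝ) := by
  unfold sqNorm
  fun_prop

theorem rapidWeight_sqNorm {β : ℝ} (hβ : 0 < β) :
    RapidWeight (volume : Measure (Fin n → ℂ)) fun φ => Real.exp (-β * sqNorm φ) := by
  have e : (fun φ : Fin n → ℂ => Real.exp (-β * sqNorm φ)) =
      fun φ => ∏ i, Real.exp (-β * ‖φ i‖ ^ 2) := by
    funext φ
    rw [← Real.exp_sum, sqNorm, Finset.mul_sum]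
  rw [e]
  exact (rapidWeight_gaussian hβ).pi

theorem rapidWeight_sqNorm_prod {β₁ β₂ : ℝ} (hβ₁ : 0 < β₁) (hβ₂ : 0 < β₂) :
    RapidWeight (volume : Measure ((Fin n → ℂ) × (Fin n → ℂ))) fun x =>
      Real.exp (-β₁ * sqNorm x.1) * Real.exp (-β₂ * sqNorm x.2) :=
  (rapidWeight_sqNorm hβ₁).prod (rapidWeight_sqNorm hβ₂)

theorem integrable_polyGrowth_mul_cexp {β₁ β₂ : ℂ} (hβ₁ : 0 < β₁.re) (hβ₂ : 0 < β₂.re)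
    {f : (Fin n → ℂ) × (Fin n → ℂ) → ℂ} (hf : PolyGrowth f) :
    Integrable fun x => Complex.exp (-β₁ * sqNorm x.1 - β₂ * sqNorm x.2) * f x := by
  have h1 : PolyGrowth fun x : (Fin n → ℂ) × (Fin n → ℂ) =>
      Complex.exp ((-(β₁.im * sqNorm x.1 + β₂.im * sqNorm x.2) : ℝ) * Complex.I) := by
    refine .of_bounded ?_ (C := 1) fun x => (Complex.norm_exp_ofReal_mul_I _).le
    have := continuous_sqNorm (n := n)
    fun_prop
  refine ((rapidWeight_sqNorm_prod hβ₁ hβ₂).integrable_mul (hf.mul h1)).congr ?_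
  filter_upwards with x
  rw [mul_assoc, mul_comm]
  congr 1
  rw [← Real.exp_add, Complex.ofReal_exp, ← Complex.exp_add]
  congr 1
  apply Complex.ext <;> simp <;> ring

theorem sum_mul_eq_sesq (M N : Matrix (Fin n) (Fin n) ℂ) (φ : Fin n → ℂ) :
    ∑ k, (star φ ᵥ* M) k * (N *ᵥ φ) k = sesq (M * N) φ φ := by
  rw [sesq, ← Matrix.mulVec_mulVec, Matrix.dotProduct_mulVec]
  rfl

/-- Gaussian integration over the second vector. -/
theorem integral_snd_quadFactor (a G : Matrix (Fin n) (Fin n) ℂ) (δ : ℂ) {β : ℂ} (hβ : 0 < β.re)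
    (φ₁ : Fin n → ℂ) :
    ∫ φ₂ : Fin n → ℂ, Complex.exp (-β * sqNorm φ₂) * (quadFactor a G δ (φ₁, φ₂) * osc a (φ₁, φ₂)) =
      (Real.pi / β) ^ n * Complex.exp (-sesq (a * aᴴ) φ₁ φ₁ / β) *
        (1 - δ / β * (sesq (G * (a * aᴴ)) φ₁ φ₁ + sesq (a * aᴴ * G) φ₁ φ₁)
          + δ ^ 2 / β ^ 2 * (sesq (G * (a * aᴴ)) φ₁ φ₁ * sesq (a * aᴴ * G) φ₁ φ₁ +
            sesq G φ₁ φ₁ * sesq (a * aᴴ - a * aᴴ * G * (a * aᴴ)) φ₁ φ₁)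
          - δ ^ 2 / β * (sesq (G * (a * aᴴ) * G) φ₁ φ₁ +
            sesq G φ₁ φ₁ * (n - (G * (a * aᴴ)).trace))) := by
  -- For fixed φ₁ the character has frequency s in φ₂, and the quadratic factor is affine in φ₂ and
  -- in its conjugate: p and r carry the two linear parts, and K the remaining sesquilinear form.
  set s : Fin n → ℂ := aᴴ *ᵥ φ₁ with hs
  set p : Fin n → ℂ := star φ₁ ᵥ* (G * a) with hp
  set r : Fin n → ℂ := (aᴴ * G) *ᵥ φ₁ with hr
  set K : Matrix (Fin n) (Fin n) ℂ := 1 - aᴴ * G * a with hK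
  have hsc : ∀ k, starRingEnd ℂ (s k) = (star φ₁ ᵥ* a) k := by
    intro k
    have := congrFun (Matrix.star_mulVec aᴴ φ₁) k
    rw [Matrix.conjTranspose_conjTranspose] at this
    rw [← this]
    rfl
  have h := (PairMoments.pi_affine (fun l => gaussWeight_pairMoments hβ (s l)) 1
    (fun k => -Complex.I * δ * p k) (fun k => -Complex.I * δ * r k)
    (fun i k => -δ ^ 2 * (p i * r k + sesq G φ₁ φ₁ * K k i))).2
  have hosc : ∀ φ₂ : Fin n → ℂ, ∏ l, gaussWeight β (s l) (φ₂ l) =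
      Complex.exp (-β * sqNorm φ₂) * osc a (φ₁, φ₂) := by
    intro φ₂
    simp only [gaussWeight, osc, sqNorm]
    rw [← Complex.exp_sum, ← Complex.exp_add]
    congr 1
    have e1 : sesq a φ₁ φ₂ = ∑ k, starRingEnd ℂ (s k) * φ₂ k := by
      simp only [hsc]
      rw [sesq, Matrix.dotProduct_mulVec]
      rfl
    rw [e1]
    simp only [map_sum, map_mul, Complex.conj_conj]
    push_cast
    rw [Finset.sum_sub_distrib, Finset.mul_sum, ← Finset.sum_add_distrib, Finset.mul_sum,
      sub_eq_add_neg, ← Finset.sum_neg_distrib]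
    congr 1
    exact Finset.sum_congr rfl fun i _ => by ring
  have hquad : ∀ φ₂ : Fin n → ℂ, quadFactor a G δ (φ₁, φ₂) =
      1 + ∑ i, -Complex.I * δ * p i * φ₂ i + ∑ k, -Complex.I * δ * r k * starRingEnd ℂ (φ₂ k) +
        ∑ i, ∑ k, -δ ^ 2 * (p i * r k + sesq G φ₁ φ₁ * K k i) * (φ₂ i * starRingEnd ℂ (φ₂ k)) := by
    intro φ₂
    have e1 : sesq (G * a) φ₁ φ₂ = ∑ i, p i * φ₂ i := by
      rw [sesq, Matrix.dotProduct_mulVec]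
      rfl
    have e2 : sesq (aᴴ * G) φ₂ φ₁ = ∑ k, r k * starRingEnd ℂ (φ₂ k) := by
      rw [sesq, dotProduct_comm]
      rfl
    have e3 : sesq K φ₂ φ₂ = ∑ i, ∑ k, K k i * (φ₂ i * starRingEnd ℂ (φ₂ k)) := by
      rw [sesq_eq_sum, Finset.sum_comm]
      exact Finset.sum_congr rfl fun i _ => Finset.sum_congr rfl fun k _ => by ring
    have e4 : ∑ i, ∑ k, -δ ^ 2 * (p i * r k + sesq G φ₁ φ₁ * K k i) *
        (φ₂ i * starRingEnd ℂ (φ₂ k)) =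
        -δ ^ 2 * ((∑ i, p i * φ₂ i) * (∑ k, r k * starRingEnd ℂ (φ₂ k)) +
          sesq G φ₁ φ₁ * ∑ i, ∑ k, K k i * (φ₂ i * starRingEnd ℂ (φ₂ k))) := by
      rw [Finset.sum_mul_sum, Finset.mul_sum, ← Finset.sum_add_distrib, Finset.mul_sum]
      refine Finset.sum_congr rfl fun i _ => ?_
      rw [Finset.mul_sum, ← Finset.sum_add_distrib, Finset.mul_sum]
      exact Finset.sum_congr rfl fun k _ => by ring
    rw [e4, quadFactor]
    simp only [e1, e2, ← hK, e3]
    simp only [mul_assoc, ← Finset.mul_sum]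
    linear_combination (δ ^ 2 * (∑ i, p i * φ₂ i) * ∑ k, r k * starRingEnd ℂ (φ₂ k)) *
      Complex.I_sq
  have hl : ∀ φ₂ : Fin n → ℂ,
      Complex.exp (-β * sqNorm φ₂) * (quadFactor a G δ (φ₁, φ₂) * osc a (φ₁, φ₂)) =
      (∏ l, gaussWeight β (s l) (φ₂ l)) *
      (1 + ∑ i, -Complex.I * δ * p i * φ₂ i + ∑ k, -Complex.I * δ * r k * starRingEnd ℂ (φ₂ k) +
        ∑ i, ∑ k, -δ ^ 2 * (p i * r k + sesq G φ₁ φ₁ * K k i) *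
          (φ₂ i * starRingEnd ℂ (φ₂ k))) := by
    intro φ₂
    rw [hosc, ← hquad]
    ring
  simp only [hl]
  refine h.trans ?_
  have f0 : ∏ l, (Real.pi / β * Complex.exp (-(‖s l‖ : ℂ) ^ 2 / β)) =
      (Real.pi / β) ^ n * Complex.exp (-sesq (a * aᴴ) φ₁ φ₁ / β) := by
    rw [Finset.prod_mul_distrib, Finset.prod_const, Finset.card_univ, Fintype.card_fin,
      ← Complex.exp_sum]
    congr 2
    rw [← Finset.sum_div, Finset.sum_neg_distrib]
    congr 2
    rw [← sesq_one, hs, sesq_mulVec_left, sesq_mulVec_right, Matrix.conjTranspose_conjTranspose,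
      mul_one]
  have f1 : ∑ k, p k * s k = sesq (G * (a * aᴴ)) φ₁ φ₁ := by
    rw [hp, hs, sum_mul_eq_sesq, mul_assoc]
  have f2 : ∑ k, r k * starRingEnd ℂ (s k) = sesq (a * aᴴ * G) φ₁ φ₁ := by
    simp only [hsc]
    rw [mul_assoc a, ← sum_mul_eq_sesq]
    exact Finset.sum_congr rfl fun k _ => mul_comm _ _
  have f3 : ∑ i, ∑ k, K k i * (s i * starRingEnd ℂ (s k)) =
      sesq (a * aᴴ - a * aᴴ * G * (a * aᴴ)) φ₁ φ₁ := by
    have : sesq K s s = ∑ i, ∑ k, K k i * (s i * starRingEnd ℂ (s k)) := by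
      rw [sesq_eq_sum, Finset.sum_comm]
      exact Finset.sum_congr rfl fun i _ => Finset.sum_congr rfl fun k _ => by ring
    rw [← this, hs, sesq_mulVec_left, sesq_mulVec_right, Matrix.conjTranspose_conjTranspose, hK]
    congr 1
    simp only [mul_sub, sub_mul, mul_one, mul_assoc]
  have f4 : ∑ i, p i * r i = sesq (G * (a * aᴴ) * G) φ₁ φ₁ := by
    rw [hp, hr, sum_mul_eq_sesq]
    simp only [mul_assoc]
  have f5 : ∑ i, K i i = n - (G * (a * aᴴ)).trace := by
    change K.trace = _
    rw [hK, Matrix.trace_sub, Matrix.trace_one, Fintype.card_fin, Matrix.mul_assoc,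
      Matrix.trace_mul_comm, Matrix.mul_assoc]
  rw [f0]
  congr 1
  have g1 : ∑ i, -Complex.I * δ * p i * (-Complex.I * s i / β) =
      -δ / β * sesq (G * (a * aᴴ)) φ₁ φ₁ := by
    rw [← f1, Finset.mul_sum]
    refine Finset.sum_congr rfl fun i _ => ?_
    linear_combination (δ * p i * s i / β) * Complex.I_sq
  have g2 : ∑ i, -Complex.I * δ * r i * (-Complex.I * starRingEnd ℂ (s i) / β) =
      -δ / β * sesq (a * aᴴ * G) φ₁ φ₁ := by
    rw [← f2, Finset.mul_sum]
    refine Finset.sum_congr rfl fun i _ => ?_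
    linear_combination (δ * r i * starRingEnd ℂ (s i) / β) * Complex.I_sq
  have g3 : ∑ i, ∑ k, -δ ^ 2 * (p i * r k + sesq G φ₁ φ₁ * K k i) *
      (-Complex.I * s i / β * (-Complex.I * starRingEnd ℂ (s k) / β)) =
      δ ^ 2 / β ^ 2 * (sesq (G * (a * aᴴ)) φ₁ φ₁ * sesq (a * aᴴ * G) φ₁ φ₁ +
            sesq G φ₁ φ₁ * sesq (a * aᴴ - a * aᴴ * G * (a * aᴴ)) φ₁ φ₁) := by
    rw [← f1, ← f2, ← f3, Finset.sum_mul_sum, Finset.mul_sum, ← Finset.sum_add_distrib,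
      Finset.mul_sum]
    refine Finset.sum_congr rfl fun i _ => ?_
    rw [Finset.mul_sum, ← Finset.sum_add_distrib, Finset.mul_sum]
    refine Finset.sum_congr rfl fun k _ => ?_
    linear_combination (-δ ^ 2 * (p i * r k + sesq G φ₁ φ₁ * K k i) *
      (s i / β * (starRingEnd ℂ (s k) / β))) * Complex.I_sq
  have g4 : ∑ i, -δ ^ 2 * (p i * r i + sesq G φ₁ φ₁ * K i i) * (1 / β) =
      -(δ ^ 2 / β * (sesq (G * (a * aᴴ) * G) φ₁ φ₁ +
            sesq G φ₁ φ₁ * (n - (G * (a * aᴴ)).trace))) := by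
    rw [← f4, ← f5, ← Finset.sum_mul, Finset.mul_sum, ← Finset.sum_add_distrib, ← Finset.mul_sum]
    ring
  rw [g1, g2, g3, g4]
  ring

end QuadFactor

/-! ### Diagonalization and the Gaussian mean of a quadratic factor -/

section Diagonalization

variable {n : ℕ}

theorem sqNorm_mulVec_unitary {U : Matrix (Fin n) (Fin n) ℂ} (hU : Uᴴ * U = 1) (φ : Fin n → ℂ) :
    sqNorm (U *ᵥ φ) = sqNorm φ := by
  have h : ∀ φ : Fin n → ℂ, (sqNorm φ : ℂ) = sesq 1 φ φ := fun φ => by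
    rw [sesq_one, sqNorm]; push_cast; rfl
  have : (sqNorm (U *ᵥ φ) : ℂ) = sqNorm φ := by
    rw [h, h, sesq_mulVec_left, sesq_mulVec_right, mul_one, hU]
  exact_mod_cast this

/-- An invertible linear map scales Lebesgue measure by a constant. The constant is 1 because the
Euclidean unit ball is invariant and has positive finite measure; it is described by `sqNorm`, the
ambient norm being the sup norm. -/
theorem measurePreserving_mulVec_unitary {U : Matrix (Fin n) (Fin n) ℂ} (hU : Uᴴ * U = 1) :
    MeasurePreserving (fun φ : Fin n → ℂ => U *ᵥ φ) volume volume := by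
  set L : (Fin n → ℂ) →ₗ[ℝ] (Fin n → ℂ) := (Matrix.mulVecLin U).restrictScalars ℝ
  have hL : ∀ φ, L φ = U *ᵥ φ := fun φ => rfl
  have hUU : U * Uᴴ = 1 := mul_eq_one_comm.1 hU
  have hdet : LinearMap.det L ≠ 0 := by
    have h1 : L ∘ₗ ((Matrix.mulVecLin Uᴴ).restrictScalars ℝ) = LinearMap.id := by
      refine LinearMap.ext fun φ => ?_
      change U *ᵥ (Uᴴ *ᵥ φ) = φ
      rw [Matrix.mulVec_mulVec, hUU, Matrix.one_mulVec]
    have h2 := congrArg LinearMap.det h1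
    rw [LinearMap.det_comp, LinearMap.det_id] at h2
    exact left_ne_zero_of_mul_eq_one h2
  have hmap := Measure.map_linearMap_addHaar_eq_smul_addHaar
    (volume : Measure (Fin n → ℂ)) hdet
  have hcont : Continuous (L : (Fin n → ℂ) → (Fin n → ℂ)) := L.continuous_of_finiteDimensional
  set S : Set (Fin n → ℂ) := {φ | sqNorm φ < 1} with hS
  have hSo : IsOpen S := isOpen_lt continuous_sqNorm continuous_const
  have hpre : L ⁻¹' S = S := by
    ext φ
    simp only [hS, mem_preimage, mem_ofPred_eq, hL, sqNorm_mulVec_unitary hU]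
  have h0 : volume S ≠ 0 := by
    refine (hSo.measure_pos volume ⟨0, ?_⟩).ne'
    simp [hS, sqNorm]
  have hfin : volume S ≠ ⊤ := by
    refine (lt_of_le_of_lt (measure_mono ?_)
      (measure_closedBall_lt_top (μ := volume) (x := (0 : Fin n → ℂ)) (r := 1))).ne
    intro φ hφ
    rw [mem_closedBall_zero_iff, pi_norm_le_iff_of_nonneg zero_le_one]
    intro i
    have h1 : ‖φ i‖ ^ 2 ≤ sqNorm φ :=
      Finset.single_le_sum (f := fun i => ‖φ i‖ ^ 2) (fun i _ => by positivity) (Finset.mem_univ i)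
    have h2 : sqNorm φ < 1 := hφ
    nlinarith [norm_nonneg (φ i)]
  have h1 := congrArg (fun μ : Measure (Fin n → ℂ) => μ S) hmap
  simp only [Measure.smul_apply, smul_eq_mul] at h1
  rw [Measure.map_apply hcont.measurable hSo.measurableSet, hpre] at h1
  have hc : ENNReal.ofReal |(LinearMap.det L)⁻¹| = 1 :=
    ((ENNReal.mul_eq_right h0 hfin).1 h1.symm)
  rw [hc, one_smul] at hmap
  exact ⟨hcont.measurable, hmap⟩

theorem measurableEmbedding_mulVec_unitary {U : Matrix (Fin n) (Fin n) ℂ} (hU : Uᴴ * U = 1) :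
    MeasurableEmbedding (fun φ : Fin n → ℂ => U *ᵥ φ) := by
  have hUU : U * Uᴴ = 1 := mul_eq_one_comm.1 hU
  let e : (Fin n → ℂ) ≃ₜ (Fin n → ℂ) :=
    { toFun := fun φ => U *ᵥ φ
      invFun := fun φ => Uᴴ *ᵥ φ
      left_inv := fun φ => by simp [Matrix.mulVec_mulVec, hU]
      right_inv := fun φ => by simp [Matrix.mulVec_mulVec, hUU]
      continuous_toFun := Continuous.matrix_mulVec continuous_const continuous_id
      continuous_invFun := Continuous.matrix_mulVec continuous_const continuous_id }
  exact e.measurableEmbedding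

/-- The identity behind the Gaussian average of the quadratic factor, in terms of the
resolvents `g = (λ + q)⁻¹` and `m = (λ - w)⁻¹`. -/
theorem resolvent_sum_identity {lam g m : Fin n → ℂ} {q w δ : ℂ}
    (hg : ∀ k, (lam k + q) * g k = 1) (hm : ∀ k, (lam k - w) * m k = 1) :
    1 - 2 * δ * ∑ k, lam k * g k * m k
      - δ ^ 2 * ∑ k, (lam k * g k ^ 2 + g k * (n - ∑ j, lam j * g j)) * m k
      + δ ^ 2 * ((∑ k, lam k * g k * m k) * (∑ k, lam k * g k * m k)
        + (∑ k, g k * m k) * (∑ k, (lam k - lam k ^ 2 * g k) * m k)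
        + ∑ k, ((lam k * g k) ^ 2 + g k * (lam k - lam k ^ 2 * g k)) * m k ^ 2) =
    (1 - δ * ∑ k, m k + q * δ * ∑ k, g k * m k) ^ 2 + w * q * (δ * ∑ k, g k * m k) ^ 2
      + (q + w) * δ ^ 2 * (∑ k, g k * m k ^ 2 - q * ∑ k, g k ^ 2 * m k ^ 2) := by
  have a1 : ∑ k, lam k * g k * m k = ∑ k, m k - q * ∑ k, g k * m k := by
    rw [Finset.mul_sum, ← Finset.sum_sub_distrib]
    exact Finset.sum_congr rfl fun k _ => by linear_combination m k * hg k
  have a2 : ∑ k, m k - q * ∑ k, g k * m k = ∑ k, g k + w * ∑ k, g k * m k := by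
    rw [Finset.mul_sum, ← Finset.sum_sub_distrib, Finset.mul_sum, ← Finset.sum_add_distrib]
    exact Finset.sum_congr rfl fun k _ => by
      linear_combination (-m k) * hg k + g k * hm k
  have a3 : (n : ℂ) - ∑ j, lam j * g j = q * ∑ k, g k := by
    rw [Finset.mul_sum]
    have : (n : ℂ) = ∑ _k : Fin n, (1 : ℂ) := by simp
    rw [this, ← Finset.sum_sub_distrib]
    exact Finset.sum_congr rfl fun k _ => by linear_combination -hg k
  have a4 : ∑ k, (lam k * g k ^ 2 + g k * (n - ∑ j, lam j * g j)) * m k =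
      ∑ k, g k * m k - q * ∑ k, g k ^ 2 * m k + q * (∑ k, g k) * ∑ k, g k * m k := by
    rw [a3]
    generalize (∑ k, g k) = s
    rw [Finset.mul_sum, Finset.mul_sum, ← Finset.sum_sub_distrib, ← Finset.sum_add_distrib]
    exact Finset.sum_congr rfl fun k _ => by linear_combination (g k * m k) * hg k
  have a5 : ∑ k, (lam k - lam k ^ 2 * g k) * m k =
      q * (∑ k, m k - q * ∑ k, g k * m k) := by
    rw [mul_sub, Finset.mul_sum, Finset.mul_sum, Finset.mul_sum, ← Finset.sum_sub_distrib]
    exact Finset.sum_congr rfl fun k _ => by linear_combination (-(lam k - q) * m k) * hg k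
  have a6 : ∑ k, ((lam k * g k) ^ 2 + g k * (lam k - lam k ^ 2 * g k)) * m k ^ 2 =
      ∑ k, g k * m k + w * ∑ k, g k * m k ^ 2 := by
    rw [Finset.mul_sum, ← Finset.sum_add_distrib]
    exact Finset.sum_congr rfl fun k _ => by
      linear_combination (g k * m k) * hm k
  have a7 : ∑ k, g k ^ 2 * m k =
      ∑ k, g k * m k ^ 2 - (q + w) * ∑ k, g k ^ 2 * m k ^ 2 := by
    rw [Finset.mul_sum, ← Finset.sum_sub_distrib]
    exact Finset.sum_congr rfl fun k _ => by
      linear_combination (g k * m k ^ 2) * hg k - (g k ^ 2 * m k) * hm k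
  -- All sums are now expressed through M, R, Sg, A and B. The one relation left between them is
  -- `a2`, the two evaluations of ∑ λ g m, and it closes the identity.
  rw [a4, a5, a6, a7, a1]
  generalize (∑ k, g k * m k ^ 2) = A
  generalize (∑ k, g k ^ 2 * m k ^ 2) = B
  generalize (∑ k, m k) = M at *
  generalize (∑ k, g k * m k) = R at *
  generalize (∑ k, g k) = Sg at *
  linear_combination (δ ^ 2 * q * R) * a2

/-- The average of the quadratic factor over a Gaussian weight. -/
noncomputable def quadMean (Y : Matrix (Fin n) (Fin n) ℂ) (q w δ : ℂ) : ℂ :=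
  let Gq := (Y + Matrix.scalar (Fin n) q)⁻¹
  let Gw := (Y + Matrix.scalar (Fin n) (-w))⁻¹
  (1 - δ * Gw.trace + q * δ * (Gq * Gw).trace) ^ 2 + w * q * (δ * (Gq * Gw).trace) ^ 2
    + (q + w) * δ ^ 2 * ((Gq * Gw ^ 2).trace - q * (Gq ^ 2 * Gw ^ 2).trace)

theorem diagonal_add_scalar_inv {d : Fin n → ℂ} {q : ℂ} (h : ∀ k, d k + q ≠ 0) :
    (Matrix.diagonal d + Matrix.scalar (Fin n) q)⁻¹ = Matrix.diagonal fun k => (d k + q)⁻¹ := by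
  rw [Matrix.scalar_apply, Matrix.diagonal_add]
  refine Matrix.inv_eq_left_inv ?_
  rw [Matrix.diagonal_mul_diagonal, ← Matrix.diagonal_one]
  congr 1
  funext k
  exact inv_mul_cancel₀ (h k)

theorem quadMean_diagonal {d : Fin n → ℂ} {q w : ℂ} (δ : ℂ) (hq : ∀ k, d k + q ≠ 0)
    (hw : ∀ k, d k - w ≠ 0) :
    quadMean (Matrix.diagonal d) q w δ =
      (1 - δ * ∑ k, (d k - w)⁻¹ + q * δ * ∑ k, (d k + q)⁻¹ * (d k - w)⁻¹) ^ 2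
      + w * q * (δ * ∑ k, (d k + q)⁻¹ * (d k - w)⁻¹) ^ 2
      + (q + w) * δ ^ 2 * (∑ k, (d k + q)⁻¹ * (d k - w)⁻¹ ^ 2
        - q * ∑ k, (d k + q)⁻¹ ^ 2 * (d k - w)⁻¹ ^ 2) := by
  have hw' : ∀ k, d k + -w ≠ 0 := fun k => by rw [← sub_eq_add_neg]; exact hw k
  simp only [quadMean]
  rw [diagonal_add_scalar_inv hq, diagonal_add_scalar_inv hw']
  simp only [Matrix.diagonal_pow, Matrix.diagonal_mul_diagonal, Matrix.trace_diagonal,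
    Pi.pow_apply, sub_eq_add_neg]

theorem integrable_quadFactor (a G : Matrix (Fin n) (Fin n) ℂ) (δ : ℂ) {β₁ β₂ : ℂ}
    (hβ₁ : 0 < β₁.re) (hβ₂ : 0 < β₂.re) :
    Integrable fun x : (Fin n → ℂ) × (Fin n → ℂ) =>
      Complex.exp (-β₁ * sqNorm x.1 - β₂ * sqNorm x.2) * (quadFactor a G δ x * osc a x) :=
  integrable_polyGrowth_mul_cexp hβ₁ hβ₂ ((PolyGrowth.quadFactor a G δ).mul (PolyGrowth.osc a))

/-- Integrating out the second vector replaces β₁ by β₁ + λ/β₂ in the direction of an eigenvalue λ;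
1/β₂ has positive real part, so the Gaussian decay persists. -/
theorem re_add_div_pos {β₁ β₂ : ℂ} (hβ₁ : 0 < β₁.re) (hβ₂ : 0 < β₂.re) {x : ℝ} (hx : 0 ≤ x) :
    0 < (β₁ + x / β₂).re := by
  rw [Complex.add_re, Complex.div_re]
  simp only [Complex.ofReal_re, Complex.ofReal_im, zero_mul, zero_div, add_zero]
  have : 0 ≤ x * β₂.re / Complex.normSq β₂ :=
    div_nonneg (mul_nonneg hx hβ₂.le) (Complex.normSq_nonneg _)
  linarith

theorem add_mul_ne_zero {β₁ β₂ : ℂ} (hβ₁ : 0 < β₁.re) (hβ₂ : 0 < β₂.re) {x : ℝ} (hx : 0 ≤ x) :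
    (x : ℂ) + β₁ * β₂ ≠ 0 := by
  intro h
  have hβ : β₂ ≠ 0 := fun h => by simp [h] at hβ₂
  have h1 : β₁ + x / β₂ = 0 := by
    field_simp
    linear_combination h
  have := re_add_div_pos hβ₁ hβ₂ hx
  rw [h1] at this
  simp at this

/-- The second vector is integrated first, against its character. When a a* is diagonal, the forms
left in φ₁ depend only on the |φ₁ₖ|², so that the φ₁-integral needs just the first two moments of
|z|² under centred Gaussian weights. -/
theorem integral_quadFactor_diagonal {a : Matrix (Fin n) (Fin n) ℂ} {lam : Fin n → ℝ}
    (ha : a * aᴴ = Matrix.diagonal fun k => (lam k : ℂ)) (hlam : ∀ k, 0 ≤ lam k)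
    {q : ℝ} (hq : 0 < q) (δ : ℂ) {β₁ β₂ : ℂ} (hβ₁ : 0 < β₁.re) (hβ₂ : 0 < β₂.re) :
    ∫ x : (Fin n → ℂ) × (Fin n → ℂ), Complex.exp (-β₁ * sqNorm x.1 - β₂ * sqNorm x.2) *
      (quadFactor a ((a * aᴴ + Matrix.scalar (Fin n) (q : ℂ))⁻¹) δ x * osc a x) =
      (Real.pi : ℂ) ^ (2 * n) / (a * aᴴ + Matrix.scalar (Fin n) (β₁ * β₂)).det *
        quadMean (a * aᴴ) q (-(β₁ * β₂)) δ := by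
  have hβ : β₂ ≠ 0 := fun h => by simp [h] at hβ₂
  rw [Measure.volume_eq_prod, integral_prod _ (integrable_quadFactor _ _ _ hβ₁ hβ₂), ha]
  have hq' : ∀ k, (lam k : ℂ) + (q : ℂ) ≠ 0 := fun k => by
    have := hlam k
    exact_mod_cast (by positivity : lam k + q ≠ 0)
  have hw' : ∀ k, (lam k : ℂ) - -(β₁ * β₂) ≠ 0 := fun k => by
    rw [sub_neg_eq_add]; exact add_mul_ne_zero hβ₁ hβ₂ (hlam k)
  set g : Fin n → ℂ := fun k => ((lam k : ℂ) + q)⁻¹ with hg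
  set m : Fin n → ℂ := fun k => ((lam k : ℂ) - -(β₁ * β₂))⁻¹ with hm
  rw [diagonal_add_scalar_inv hq', quadMean_diagonal δ hq' hw']
  change ∫ x : Fin n → ℂ, ∫ y : Fin n → ℂ,
    Complex.exp (-β₁ * sqNorm x - β₂ * sqNorm y) *
    (quadFactor a (Matrix.diagonal g) δ (x, y) * osc a (x, y)) = _
  have hfst : ∀ x : Fin n → ℂ, (∫ y : Fin n → ℂ,
      Complex.exp (-β₁ * sqNorm x - β₂ * sqNorm y) *
      (quadFactor a (Matrix.diagonal g) δ (x, y) * osc a (x, y))) =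
      (Real.pi / β₂) ^ n * ((∏ l, Complex.exp (-(β₁ + lam l / β₂) * (‖x l‖ : ℂ) ^ 2)) *
        (1 + ∑ i, (-2 * δ / β₂ * (lam i * g i) - δ ^ 2 / β₂ * (lam i * g i ^ 2 +
            g i * (n - ∑ j, lam j * g j))) * (‖x i‖ : ℂ) ^ 2
          + ∑ k, (0 : ℂ) * (‖x k‖ : ℂ) ^ 2
          + ∑ i, ∑ k, δ ^ 2 / β₂ ^ 2 * (lam i * g i * (lam k * g k) +
            g i * (lam k - lam k ^ 2 * g k)) * ((‖x i‖ : ℂ) ^ 2 * (‖x k‖ : ℂ) ^ 2))) := by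
    intro x
    have e1 : ∀ y : Fin n → ℂ, Complex.exp (-β₁ * sqNorm x - β₂ * sqNorm y) *
        (quadFactor a (Matrix.diagonal g) δ (x, y) * osc a (x, y)) =
        Complex.exp (-β₁ * sqNorm x) * (Complex.exp (-β₂ * sqNorm y) *
        (quadFactor a (Matrix.diagonal g) δ (x, y) * osc a (x, y))) := by
      intro y
      rw [← mul_assoc (Complex.exp (-β₁ * sqNorm x)), ← Complex.exp_add]
      ring_nf
    simp only [e1]
    rw [integral_const_mul, integral_snd_quadFactor a _ δ hβ₂ x, ha]
    simp only [Matrix.diagonal_mul_diagonal, Matrix.diagonal_sub, sesq_diagonal,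
      Matrix.trace_diagonal]
    have e2 : Complex.exp (-β₁ * sqNorm x) *
        Complex.exp (-(∑ i, (lam i : ℂ) * (‖x i‖ : ℂ) ^ 2) / β₂) =
        ∏ l, Complex.exp (-(β₁ + lam l / β₂) * (‖x l‖ : ℂ) ^ 2) := by
      rw [← Complex.exp_sum, ← Complex.exp_add, sqNorm]
      congr 1
      push_cast
      rw [neg_div, Finset.sum_div, ← Finset.sum_neg_distrib, Finset.mul_sum,
        ← Finset.sum_add_distrib]
      exact Finset.sum_congr rfl fun i _ => by ring
    rw [← e2]
    have e3 : ∑ i, ∑ k, δ ^ 2 / β₂ ^ 2 * (lam i * g i * (lam k * g k) +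
            g i * (lam k - lam k ^ 2 * g k)) * ((‖x i‖ : ℂ) ^ 2 * (‖x k‖ : ℂ) ^ 2) =
        δ ^ 2 / β₂ ^ 2 * ((∑ i, g i * lam i * (‖x i‖ : ℂ) ^ 2) *
          (∑ i, lam i * g i * (‖x i‖ : ℂ) ^ 2) + (∑ i, g i * (‖x i‖ : ℂ) ^ 2) *
          ∑ i, (lam i - lam i * g i * lam i) * (‖x i‖ : ℂ) ^ 2) := by
      rw [Finset.sum_mul_sum, Finset.sum_mul_sum, ← Finset.sum_add_distrib, Finset.mul_sum]
      refine Finset.sum_congr rfl fun i _ => ?_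
      rw [← Finset.sum_add_distrib, Finset.mul_sum]
      exact Finset.sum_congr rfl fun k _ => by ring
    have e4 : ∑ i, (-2 * δ / β₂ * (lam i * g i) - δ ^ 2 / β₂ * (lam i * g i ^ 2 +
            g i * (n - ∑ j, lam j * g j))) * (‖x i‖ : ℂ) ^ 2 =
        -(δ / β₂ * (∑ i, g i * lam i * (‖x i‖ : ℂ) ^ 2 + ∑ i, lam i * g i * (‖x i‖ : ℂ) ^ 2))
        - δ ^ 2 / β₂ * (∑ i, g i * lam i * g i * (‖x i‖ : ℂ) ^ 2 +
          (∑ i, g i * (‖x i‖ : ℂ) ^ 2) * (n - ∑ i, g i * lam i)) := by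
      have e5 : ∑ j, (lam j : ℂ) * g j = ∑ i, g i * lam i :=
        Finset.sum_congr rfl fun i _ => mul_comm _ _
      rw [e5]
      generalize (∑ i, g i * (lam i : ℂ)) = S
      rw [Finset.sum_mul, ← Finset.sum_add_distrib, ← Finset.sum_add_distrib, Finset.mul_sum,
        Finset.mul_sum, ← Finset.sum_neg_distrib, ← Finset.sum_sub_distrib]
      exact Finset.sum_congr rfl fun i _ => by ring
    rw [e3, e4]
    simp only [zero_mul, Finset.sum_const_zero, add_zero]
    ring
  simp only [hfst]
  rw [integral_const_mul]
  have hγ : ∀ l, 0 < (β₁ + lam l / β₂).re := fun l => re_add_div_pos hβ₁ hβ₂ (hlam l)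
  have h := (PairMoments.pi_affine (fun l => normSq_pairMoments (hγ l)) 1
    (fun i => -2 * δ / β₂ * (lam i * g i) - δ ^ 2 / β₂ * (lam i * g i ^ 2 +
            g i * (n - ∑ j, lam j * g j))) (fun _ => 0)
    (fun i k => δ ^ 2 / β₂ ^ 2 * (lam i * g i * (lam k * g k) +
            g i * (lam k - lam k ^ 2 * g k)))).2
  rw [volume_pi, h, Matrix.scalar_apply, Matrix.diagonal_add, Matrix.det_diagonal, ← mul_assoc]
  -- The mean of |φ₁ₖ|² is β₂ times the resolvent at β₁β₂. The powers of β₂ then cancel those in the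
  -- coefficients, and only the product β₁β₂ remains.
  have hy : ∀ k, 1 / (β₁ + lam k / β₂) = β₂ * m k := by
    intro k
    have h1 := hw' k
    have h2 : β₁ + lam k / β₂ ≠ 0 := fun h => by
      have := hγ k; rw [h] at this; simp at this
    have h3 : β₁ * β₂ + lam k ≠ 0 := by
      convert h1 using 1; ring
    have h4 : (lam k : ℂ) - -(β₁ * β₂) = β₁ * β₂ + lam k := by ring
    simp only [hm, h4]
    field_simp
  congr 1
  · have : ∀ k, (Real.pi : ℂ) / (β₁ + lam k / β₂) = Real.pi * β₂ / (lam k + β₁ * β₂) := by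
      intro k
      rw [div_eq_mul_one_div, hy]
      simp only [hm, sub_neg_eq_add]
      ring
    simp only [this]
    rw [Finset.prod_div_distrib, Finset.prod_const, Finset.card_univ, Fintype.card_fin]
    have := pow_ne_zero n hβ
    rw [mul_div_assoc', ← mul_pow]
    congr 1
    rw [two_mul, pow_add, ← mul_pow]
    congr 1
    field_simp
  · have hy2 : ∀ k, 1 / (β₁ + lam k / β₂) ^ 2 = (β₂ * m k) ^ 2 := by
      intro k
      rw [← hy, div_pow, one_pow]
    simp only [hy, hy2]
    have hgid : ∀ k, ((lam k : ℂ) + q) * g k = 1 := fun k => mul_inv_cancel₀ (hq' k)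
    have hmid : ∀ k, ((lam k : ℂ) - -(β₁ * β₂)) * m k = 1 := fun k => mul_inv_cancel₀ (hw' k)
    rw [← resolvent_sum_identity hgid hmid]
    have c1 : ∑ i, ∑ k, δ ^ 2 / β₂ ^ 2 * (lam i * g i * (lam k * g k) +
            g i * (lam k - lam k ^ 2 * g k)) * (β₂ * m i * (β₂ * m k)) =
        δ ^ 2 * ((∑ k, lam k * g k * m k) * (∑ k, lam k * g k * m k)
        + (∑ k, g k * m k) * (∑ k, (lam k - lam k ^ 2 * g k) * m k)) := by
      rw [Finset.sum_mul_sum, Finset.sum_mul_sum, ← Finset.sum_add_distrib, Finset.mul_sum]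
      refine Finset.sum_congr rfl fun i _ => ?_
      rw [← Finset.sum_add_distrib, Finset.mul_sum]
      exact Finset.sum_congr rfl fun k _ => by field_simp
    have c2 : ∑ i, (-2 * δ / β₂ * (lam i * g i) - δ ^ 2 / β₂ * (lam i * g i ^ 2 +
            g i * (n - ∑ j, lam j * g j))) * (β₂ * m i) =
        -(2 * δ * ∑ k, lam k * g k * m k)
        - δ ^ 2 * ∑ k, (lam k * g k ^ 2 + g k * (n - ∑ j, lam j * g j)) * m k := by
      generalize (∑ j, (lam j : ℂ) * g j) = S
      rw [Finset.mul_sum, Finset.mul_sum, ← Finset.sum_neg_distrib, ← Finset.sum_sub_distrib]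
      exact Finset.sum_congr rfl fun i _ => by field_simp
    have c3 : ∑ i, δ ^ 2 / β₂ ^ 2 * (lam i * g i * (lam i * g i) +
            g i * (lam i - lam i ^ 2 * g i)) * (β₂ * m i) ^ 2 =
        δ ^ 2 * ∑ k, ((lam k * g k) ^ 2 + g k * (lam k - lam k ^ 2 * g k)) * m k ^ 2 := by
      rw [Finset.mul_sum]
      exact Finset.sum_congr rfl fun i _ => by field_simp
    rw [c1, c2, c3]
    simp only [zero_mul, Finset.sum_const_zero, add_zero]
    ring

theorem conj_add_scalar {U : Matrix (Fin n) (Fin n) ℂ} (hU : Uᴴ * U = 1)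
    (Y : Matrix (Fin n) (Fin n) ℂ) (c : ℂ) :
    Uᴴ * Y * U + Matrix.scalar (Fin n) c = Uᴴ * (Y + Matrix.scalar (Fin n) c) * U := by
  rw [mul_add, add_mul, ← (Matrix.scalar_commute c (fun r => mul_comm _ _) Uᴴ).eq,
    mul_assoc _ Uᴴ, hU, mul_one]

theorem det_conj_add_scalar {U : Matrix (Fin n) (Fin n) ℂ} (hU : Uᴴ * U = 1)
    (Y : Matrix (Fin n) (Fin n) ℂ) (c : ℂ) :
    (Uᴴ * Y * U + Matrix.scalar (Fin n) c).det = (Y + Matrix.scalar (Fin n) c).det := by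
  rw [conj_add_scalar hU, Matrix.det_mul_right_comm, Matrix.det_mul, hU, Matrix.det_one, one_mul]

theorem inv_conj_add_scalar {U : Matrix (Fin n) (Fin n) ℂ} (hU : Uᴴ * U = 1)
    (Y : Matrix (Fin n) (Fin n) ℂ) (c : ℂ) :
    (Uᴴ * Y * U + Matrix.scalar (Fin n) c)⁻¹ = Uᴴ * (Y + Matrix.scalar (Fin n) c)⁻¹ * U := by
  have hUU : U * Uᴴ = 1 := mul_eq_one_comm.1 hU
  rw [conj_add_scalar hU, Matrix.mul_inv_rev, Matrix.mul_inv_rev, Matrix.inv_eq_left_inv hU,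
    Matrix.inv_eq_left_inv hUU, mul_assoc]

theorem quadMean_conj {U : Matrix (Fin n) (Fin n) ℂ} (hU : Uᴴ * U = 1)
    (Y : Matrix (Fin n) (Fin n) ℂ) (q w δ : ℂ) :
    quadMean (Uᴴ * Y * U) q w δ = quadMean Y q w δ := by
  have hUU : U * Uᴴ = 1 := mul_eq_one_comm.1 hU
  have h2 : ∀ M N : Matrix (Fin n) (Fin n) ℂ, Uᴴ * M * U * (Uᴴ * N * U) = Uᴴ * (M * N) * U := by
    intro M N
    calc Uᴴ * M * U * (Uᴴ * N * U) = Uᴴ * M * (U * Uᴴ) * (N * U) := by simp only [mul_assoc]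
      _ = _ := by rw [hUU, mul_one]; simp only [mul_assoc]
  have h3 : ∀ M : Matrix (Fin n) (Fin n) ℂ, (Uᴴ * M * U).trace = M.trace := by
    intro M
    rw [Matrix.trace_mul_comm, ← mul_assoc, hUU, one_mul]
  simp only [quadMean, inv_conj_add_scalar hU, pow_two (Uᴴ * _ * U), h2, h3, ← pow_two]

/-- Replacing a by U* a amounts to rotating the first vector alone. Diagonalizing a a* therefore
costs one unitary change of variable, and a* a need not be diagonal. -/
theorem quadFactor_conj {U : Matrix (Fin n) (Fin n) ℂ} (hU : Uᴴ * U = 1)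
    (a G : Matrix (Fin n) (Fin n) ℂ) (δ : ℂ) (x : (Fin n → ℂ) × (Fin n → ℂ)) :
    quadFactor (Uᴴ * a) (Uᴴ * G * U) δ x = quadFactor a G δ (U *ᵥ x.1, x.2) := by
  have hUU : U * Uᴴ = 1 := mul_eq_one_comm.1 hU
  have h1 : ∀ M N : Matrix (Fin n) (Fin n) ℂ, M * U * (Uᴴ * N) = M * N := by
    intro M N
    rw [mul_assoc, ← mul_assoc U, hUU, one_mul]
  simp only [quadFactor, sesq_mulVec_left, sesq_mulVec_right, h1, Matrix.conjTranspose_mul,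
    Matrix.conjTranspose_conjTranspose]
  have h2 : aᴴ * U * (Uᴴ * G * U) = aᴴ * G * U := by
    rw [mul_assoc Uᴴ, h1, mul_assoc]
  rw [h2, mul_assoc Uᴴ G a, mul_assoc Uᴴ G U, h1]

theorem osc_conj (U a : Matrix (Fin n) (Fin n) ℂ) (x : (Fin n → ℂ) × (Fin n → ℂ)) :
    osc (Uᴴ * a) x = osc a (U *ᵥ x.1, x.2) := by
  simp only [osc, sesq_mulVec_left]

open scoped ComplexOrder in
/-- A unitary matrix diagonalizing `a a^*`. -/
theorem exists_diagonalization (a : Matrix (Fin n) (Fin n) ℂ) :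
    ∃ (U : Matrix (Fin n) (Fin n) ℂ) (lam : Fin n → ℝ), Uᴴ * U = 1 ∧ (∀ k, 0 ≤ lam k) ∧
      Uᴴ * (a * aᴴ) * U = Matrix.diagonal fun k => (lam k : ℂ) := by
  have hps := Matrix.posSemidef_self_mul_conjTranspose a
  have hU : star (hps.isHermitian.eigenvectorUnitary : Matrix (Fin n) (Fin n) ℂ) *
      hps.isHermitian.eigenvectorUnitary = 1 :=
    Unitary.coe_star_mul_self _
  refine ⟨hps.isHermitian.eigenvectorUnitary, hps.isHermitian.eigenvalues, hU,
    hps.eigenvalues_nonneg, ?_⟩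
  have h := hps.isHermitian.spectral_theorem
  rw [Unitary.conjStarAlgAut_apply] at h
  set U := (hps.isHermitian.eigenvectorUnitary : Matrix (Fin n) (Fin n) ℂ)
  rw [← Matrix.star_eq_conjTranspose]
  conv_lhs => rw [h]
  calc star U * (U * Matrix.diagonal (RCLike.ofReal ∘ hps.isHermitian.eigenvalues) * star U) * U
      = (star U * U) * Matrix.diagonal (RCLike.ofReal ∘ hps.isHermitian.eigenvalues) *
        (star U * U) := by simp only [mul_assoc]
    _ = _ := by rw [hU, one_mul, mul_one]; rfl

/-- The Gaussian average of the oscillating quadratic factor. -/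
theorem integral_quadFactor (a : Matrix (Fin n) (Fin n) ℂ) {q : ℝ} (hq : 0 < q) (δ : ℂ)
    {β₁ β₂ : ℂ} (hβ₁ : 0 < β₁.re) (hβ₂ : 0 < β₂.re) :
    ∫ x : (Fin n → ℂ) × (Fin n → ℂ), Complex.exp (-β₁ * sqNorm x.1 - β₂ * sqNorm x.2) *
      (quadFactor a ((a * aᴴ + Matrix.scalar (Fin n) (q : ℂ))⁻¹) δ x * osc a x) =
      (Real.pi : ℂ) ^ (2 * n) / (a * aᴴ + Matrix.scalar (Fin n) (β₁ * β₂)).det *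
        quadMean (a * aᴴ) q (-(β₁ * β₂)) δ := by
  obtain ⟨U, lam, hU, hlam, hd⟩ := exists_diagonalization a
  have ha : Uᴴ * a * (Uᴴ * a)ᴴ = Uᴴ * (a * aᴴ) * U := by
    simp only [Matrix.conjTranspose_mul, Matrix.conjTranspose_conjTranspose, mul_assoc]
  have h := integral_quadFactor_diagonal (ha.trans hd) hlam hq δ hβ₁ hβ₂
  rw [ha, det_conj_add_scalar hU, quadMean_conj hU, inv_conj_add_scalar hU] at h
  rw [← h]
  have hmp := (measurePreserving_mulVec_unitary hU).prod
    (MeasurePreserving.id (volume : Measure (Fin n → ℂ)))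
  have hemb : MeasurableEmbedding
      (Prod.map (fun φ : Fin n → ℂ => U *ᵥ φ) (id : (Fin n → ℂ) → (Fin n → ℂ))) :=
    (measurableEmbedding_mulVec_unitary hU).prodMap MeasurableEmbedding.id
  rw [Measure.volume_eq_prod, ← hmp.integral_comp hemb]
  refine integral_congr_ae (Filter.Eventually.of_forall fun x => ?_)
  simp only [quadFactor_conj hU, osc_conj, Prod.map, id, sqNorm_mulVec_unitary hU]

/-- Each eigenvalue factor is λ + β₁β₂ = β₂ (β₁ + λ/β₂), whose second factor has positive real part.
With β_j = -i t_j this covers all t_j in the upper half plane. -/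
theorem det_add_scalar_ne_zero (a : Matrix (Fin n) (Fin n) ℂ) {β₁ β₂ : ℂ}
    (hβ₁ : 0 < β₁.re) (hβ₂ : 0 < β₂.re) :
    (a * aᴴ + Matrix.scalar (Fin n) (β₁ * β₂)).det ≠ 0 := by
  obtain ⟨U, lam, hU, hlam, hd⟩ := exists_diagonalization a
  rw [← det_conj_add_scalar hU, hd, Matrix.scalar_apply, Matrix.diagonal_add, Matrix.det_diagonal]
  exact Finset.prod_ne_zero_iff.2 fun k _ => add_mul_ne_zero hβ₁ hβ₂ (hlam k)

end Diagonalization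

/-! ### Rank two perturbations and resolvents -/

section RankTwo

variable {n : ℕ}

theorem quadFactor_zero (a G : Matrix (Fin n) (Fin n) ℂ) (x : (Fin n → ℂ) × (Fin n → ℂ)) :
    quadFactor a G 0 x = 1 := by
  simp [quadFactor]

theorem quadMean_zero (Y : Matrix (Fin n) (Fin n) ℂ) (q w : ℂ) : quadMean Y q w 0 = 1 := by
  simp [quadMean]

/-- The perturbation is U V with two columns, so the matrix determinant lemma reduces it to the 2 ×
2 determinant of 1 + V N⁻¹ U, which is `quadFactor`. The term δ²|φ₂|² in V comes from the product of
the two rank-one corrections, and accounts for 1 - a* G a there. -/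
theorem det_rank_two_perturbation (a : Matrix (Fin n) (Fin n) ℂ) (q δ : ℂ)
    (hdet : (a * aᴴ + Matrix.scalar (Fin n) q).det ≠ 0) (x : (Fin n → ℂ) × (Fin n → ℂ)) :
    ((a - (Complex.I * δ) • Matrix.vecMulVec x.1 (star x.2)) *
      (aᴴ - (Complex.I * δ) • Matrix.vecMulVec x.2 (star x.1)) + Matrix.scalar (Fin n) q).det =
    (a * aᴴ + Matrix.scalar (Fin n) q).det *
      quadFactor a ((a * aᴴ + Matrix.scalar (Fin n) q)⁻¹) δ x := by
  obtain ⟨φ₁, φ₂⟩ := x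
  set N := a * aᴴ + Matrix.scalar (Fin n) q with hN
  set U : Matrix (Fin n) (Fin 2) ℂ := Matrix.of fun i => ![(a *ᵥ φ₂) i, φ₁ i] with hU
  set V : Matrix (Fin 2) (Fin n) ℂ := Matrix.of ![-(Complex.I * δ) • star φ₁,
    -(Complex.I * δ) • (star φ₂ ᵥ* aᴴ) - (δ ^ 2 * (star φ₂ ⬝ᵥ φ₂)) • star φ₁] with hV
  have e1 : (a - (Complex.I * δ) • Matrix.vecMulVec φ₁ (star φ₂)) *
      (aᴴ - (Complex.I * δ) • Matrix.vecMulVec φ₂ (star φ₁)) + Matrix.scalar (Fin n) q =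
      N + U * V := by
    have : U * V = Matrix.vecMulVec (a *ᵥ φ₂) (-(Complex.I * δ) • star φ₁) +
        Matrix.vecMulVec φ₁ (-(Complex.I * δ) • (star φ₂ ᵥ* aᴴ) -
          (δ ^ 2 * (star φ₂ ⬝ᵥ φ₂)) • star φ₁) := by
      ext i j
      simp [Matrix.mul_apply, hU, hV, Fin.sum_univ_two, Matrix.vecMulVec_apply]
      ring
    rw [this, hN, sub_mul, mul_sub, mul_sub, Matrix.smul_mul, Matrix.smul_mul, Matrix.mul_smul,
      Matrix.mul_smul, Matrix.vecMulVec_mul, Matrix.mul_vecMulVec, Matrix.vecMulVec_mul_vecMulVec]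
    ext i j
    simp only [Matrix.add_apply, Matrix.sub_apply, Matrix.smul_apply, Matrix.vecMulVec_apply,
      Pi.smul_apply, Pi.sub_apply, smul_eq_mul]
    linear_combination (δ ^ 2 * (star φ₂ ⬝ᵥ φ₂) * φ₁ i * star φ₁ j) * Complex.I_sq
  rw [e1, Matrix.det_add_mul _ _ (isUnit_iff_ne_zero.2 hdet)]
  congr 1
  rw [Matrix.det_fin_two]
  have ent : ∀ i j, (V * N⁻¹ * U) i j = V i ⬝ᵥ (N⁻¹ *ᵥ U.col j) := by
    intro i j
    rw [Matrix.mul_assoc]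
    rfl
  have c0 : U.col 0 = a *ᵥ φ₂ := by
    funext i; simp [hU]
  have c1 : U.col 1 = φ₁ := by
    funext i; simp [hU]
  have v0 : V 0 = -(Complex.I * δ) • star φ₁ := rfl
  have v1 : V 1 = -(Complex.I * δ) • (star φ₂ ᵥ* aᴴ) - (δ ^ 2 * (star φ₂ ⬝ᵥ φ₂)) • star φ₁ := rfl
  have s1 : star φ₁ ⬝ᵥ (N⁻¹ *ᵥ (a *ᵥ φ₂)) = sesq (N⁻¹ * a) φ₁ φ₂ := by
    rw [sesq, Matrix.mulVec_mulVec]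
  have s2 : star φ₁ ⬝ᵥ (N⁻¹ *ᵥ φ₁) = sesq N⁻¹ φ₁ φ₁ := rfl
  have s3 : (star φ₂ ᵥ* aᴴ) ⬝ᵥ (N⁻¹ *ᵥ (a *ᵥ φ₂)) = sesq (aᴴ * N⁻¹ * a) φ₂ φ₂ := by
    rw [sesq, ← Matrix.dotProduct_mulVec, Matrix.mulVec_mulVec, Matrix.mulVec_mulVec, mul_assoc]
  have s4 : (star φ₂ ᵥ* aᴴ) ⬝ᵥ (N⁻¹ *ᵥ φ₁) = sesq (aᴴ * N⁻¹) φ₂ φ₁ := by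
    rw [sesq, ← Matrix.dotProduct_mulVec, Matrix.mulVec_mulVec]
  have s5 : star φ₂ ⬝ᵥ φ₂ = sesq 1 φ₂ φ₂ := by
    rw [sesq, Matrix.one_mulVec]
  have s6 : sesq (1 - aᴴ * N⁻¹ * a) φ₂ φ₂ = sesq 1 φ₂ φ₂ - sesq (aᴴ * N⁻¹ * a) φ₂ φ₂ := by
    simp only [sesq, Matrix.sub_mulVec, dotProduct_sub]
  simp only [Matrix.add_apply, ent, c0, c1, v0, v1, sub_dotProduct, smul_dotProduct, s1, s2, s3, s4,
    s5, smul_eq_mul, Matrix.one_apply_eq, quadFactor, s6]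
  simp
  linear_combination (-δ ^ 2 * sesq N⁻¹ φ₁ φ₁ * sesq (aᴴ * N⁻¹ * a) φ₂ φ₂) * Complex.I_sq

end RankTwo

/-! ### The resolvent trace as a quotient, and M M* as a sum over columns -/

section Average

variable {n : ℕ}

theorem inv_det_eq_integral (M : Matrix (Fin n) (Fin n) ℂ) {ε : ℝ} (hε : 0 < ε) :
    ((M * Mᴴ + Matrix.scalar (Fin n) ((ε : ℂ) ^ 2)).det)⁻¹ =
      ((Real.pi : ℂ) ^ (2 * n))⁻¹ * ∫ x : (Fin n → ℂ) × (Fin n → ℂ),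
        Complex.exp (-ε * sqNorm x.1 - ε * sqNorm x.2) * osc M x := by
  have hε' : 0 < (ε : ℂ).re := by simpa using hε
  -- At δ = 0 both the quadratic factor and its mean are 1, so the choice q = 1 is immaterial.
  have h := integral_quadFactor M one_pos 0 hε' hε'
  simp only [quadFactor_zero, quadMean_zero, one_mul, mul_one, ← pow_two] at h
  rw [h]
  have hpi : (Real.pi : ℂ) ^ (2 * n) ≠ 0 := by
    exact_mod_cast pow_ne_zero _ Real.pi_ne_zero
  field_simp

theorem trace_inv_add_scalar (M : Matrix (Fin n) (Fin n) ℂ) (q : ℂ) :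
    (M + Matrix.scalar (Fin n) q)⁻¹.trace =
      (Polynomial.derivative (shiftPoly M)).eval q * ((M + Matrix.scalar (Fin n) q).det)⁻¹ := by
  rw [Matrix.inv_def, Matrix.trace_smul, smul_eq_mul, Ring.inverse_eq_inv', mul_comm]
  congr 1
  rw [derivative_shiftPoly, Polynomial.eval_finsetSum, Matrix.trace]
  refine Finset.sum_congr rfl fun i _ => ?_
  rw [Matrix.diag_apply]
  have : (Polynomial.evalRingHom q).mapMatrix
      (M.map Polynomial.C + Matrix.scalar (Fin n) Polynomial.X) = M + Matrix.scalar (Fin n) q := by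
    ext i j
    simp [Matrix.diagonal_apply]
    split_ifs <;> simp
  rw [← this, ← RingHom.map_adjugate]
  rfl

theorem measurableEmbedding_shift (ε : ℝ) :
    MeasurableEmbedding (fun w : ℂ => (w.re - ε, w.im)) ∧
      MeasurePreserving (fun w : ℂ => (w.re - ε, w.im)) := by
  have hm := (measurePreserving_sub_right (volume : Measure (ℝ × ℝ)) (ε, (0 : ℝ))).comp
    Complex.volume_preserving_equiv_real_prod
  have hemb : MeasurableEmbedding ((fun x : ℝ × ℝ => x - (ε, (0 : ℝ))) ∘
      ⇑Complex.measurableEquivRealProd) :=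
    (measurableEmbedding_subRight _).comp (MeasurableEquiv.measurableEmbedding _)
  have : ((fun x : ℝ × ℝ => x - (ε, (0 : ℝ))) ∘ ⇑Complex.measurableEquivRealProd) =
      fun w : ℂ => (w.re - ε, w.im) := by
    funext w
    ext <;> simp [Complex.measurableEquivRealProd_apply]
  rw [this] at hm hemb
  exact ⟨hemb, hm⟩

theorem rapidWeight_shifted {N : ℝ} (hN : 0 < N) (ε : ℝ) :
    RapidWeight (volume : Measure (ℝ × ℝ)) fun u =>
      Real.exp (-N * ((u.1 + ε) ^ 2 + u.2 ^ 2)) := by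
  refine ⟨by fun_prop, fun _ => (Real.exp_pos _).le, fun k => ?_⟩
  obtain ⟨hemb, hm⟩ := measurableEmbedding_shift ε
  rw [← hm.integrable_comp_emb hemb]
  have h1 : PolyGrowth fun w : ℂ => (((1 + ‖(w.re - ε, w.im)‖) ^ k : ℝ) : ℂ) := by
    have : PolyGrowth fun w : ℂ => ((‖(w.re - ε, w.im)‖ : ℝ) : ℂ) := by
      refine .of_norm_le (by fun_prop) (C := 1 + |ε|) fun w => ?_
      rw [Complex.norm_real, norm_norm, Prod.norm_def]
      have := Complex.abs_re_le_norm w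
      have := Complex.abs_im_le_norm w
      have := norm_nonneg w
      refine max_le ?_ ?_
      · refine (norm_sub_le _ _).trans ?_
        simp only [Real.norm_eq_abs]
        nlinarith [abs_nonneg ε]
      · simp only [Real.norm_eq_abs]
        nlinarith [abs_nonneg ε]
    push_cast
    exact ((PolyGrowth.const 1).add this).pow k
  refine ((rapidWeight_gaussian hN).integrable_mul h1).re.congr ?_
  filter_upwards with w
  rw [← Complex.ofReal_mul, RCLike.re_to_complex, Complex.ofReal_re,
    ← Complex.normSq_eq_norm_sq, Complex.normSq_apply]
  simp only [Function.comp_apply, sub_add_cancel, pow_two]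

/-- The matrix `a + h` whose `j`-th column is `a_{·j} + h j`. -/
def addColumns (a : Matrix (Fin n) (Fin n) ℂ) (h : Fin n → Fin n → ℂ) :
    Matrix (Fin n) (Fin n) ℂ :=
  Matrix.of fun i j => a i j + h j i

/-- Puts M M* into the form averaged by `integral_shiftPoly_columns`, a sum of one rank-one matrix
per column. -/
theorem addColumns_mul_conjTranspose (a : Matrix (Fin n) (Fin n) ℂ) (h : Fin n → Fin n → ℂ) :
    addColumns a h * (addColumns a h)ᴴ = ∑ j, Matrix.vecMulVec ((fun i => a i j) + h j)
      ((fun i => starRingEnd ℂ (a i j)) + star (h j)) := by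
  ext i k
  rw [Matrix.mul_apply, Matrix.sum_apply]
  refine Finset.sum_congr rfl fun j _ => ?_
  simp [addColumns, Matrix.vecMulVec_apply]

/-- The oscillating factor is a character of the noise, with frequency x₁ᵢ x̄₂ⱼ at the entry (i, j).
-/
theorem osc_addColumns (a : Matrix (Fin n) (Fin n) ℂ) (h : Fin n → Fin n → ℂ)
    (x : (Fin n → ℂ) × (Fin n → ℂ)) :
    osc (addColumns a h) x = osc a x * ∏ j, ∏ i, Complex.exp (-Complex.I *
      (starRingEnd ℂ (x.1 i * starRingEnd ℂ (x.2 j)) * h j i +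
        x.1 i * starRingEnd ℂ (x.2 j) * starRingEnd ℂ (h j i))) := by
  simp only [← Complex.exp_sum]
  rw [osc, osc, ← Complex.exp_add, sesq_eq_sum, sesq_eq_sum]
  congr 1
  simp only [map_sum, ← Finset.mul_sum]
  rw [← mul_add, Finset.sum_comm (f := fun j i =>
    starRingEnd ℂ (x.1 i * starRingEnd ℂ (x.2 j)) * h j i +
      x.1 i * starRingEnd ℂ (x.2 j) * starRingEnd ℂ (h j i))]
  congr 1
  simp only [← Finset.sum_add_distrib]
  refine Finset.sum_congr rfl fun j _ => Finset.sum_congr rfl fun i _ => ?_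
  simp only [addColumns, Matrix.of_apply, map_mul, map_add, Complex.conj_conj]
  ring

end Average

/-! ### Averaging the resolvent over the Ginibre matrix -/

section Reduction

variable {n : ℕ}

/-- The integrand over `(φ₁, φ₂)` left after averaging over the Ginibre matrix. -/
noncomputable def vectorIntegrand (a : Matrix (Fin n) (Fin n) ℂ) (ε v : ℝ) (q : ℂ)
    (x : (Fin n → ℂ) × (Fin n → ℂ)) : ℂ :=
  Complex.exp (-ε * sqNorm x.1 - ε * sqNorm x.2) * (Complex.exp (-v * (sqNorm x.1 * sqNorm x.2)) *
    osc a x * ((a - (Complex.I * v) • Matrix.vecMulVec x.1 (star x.2)) *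
      (aᴴ - (Complex.I * v) • Matrix.vecMulVec x.2 (star x.1)) + Matrix.scalar (Fin n) q).det)

theorem sqNorm_nonneg (φ : Fin n → ℂ) : 0 ≤ sqNorm φ :=
  Finset.sum_nonneg fun _ _ => by positivity

theorem PolyGrowth.exp_sqNorm_mul {v : ℝ} (hv : 0 ≤ v) :
    PolyGrowth fun x : (Fin n → ℂ) × (Fin n → ℂ) =>
      Complex.exp (-v * (sqNorm x.1 * sqNorm x.2)) := by
  refine .of_bounded ?_ (C := 1) fun x => ?_
  · have := continuous_sqNorm (n := n)
    fun_prop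
  · rw [Complex.norm_exp]
    have h1 : (-(v : ℂ) * (sqNorm x.1 * sqNorm x.2)).re = -(v * (sqNorm x.1 * sqNorm x.2)) := by
      norm_cast
      ring
    rw [h1, Real.exp_le_one_iff, neg_nonpos]
    exact mul_nonneg hv (mul_nonneg (sqNorm_nonneg _) (sqNorm_nonneg _))

theorem PolyGrowth.det_vecMulVec (a : Matrix (Fin n) (Fin n) ℂ) (v : ℂ) :
    PolyGrowth fun p : (ℝ × ℝ) × ((Fin n → ℂ) × (Fin n → ℂ)) =>
      ((a - (Complex.I * v) • Matrix.vecMulVec p.2.1 (Star.star p.2.2)) *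
      (aᴴ - (Complex.I * v) • Matrix.vecMulVec p.2.2 (Star.star p.2.1)) +
        Matrix.scalar (Fin n) ((p.1.1 : ℂ) ^ 2 + (p.1.2 : ℂ) ^ 2)).det := by
  have h1 : ∀ i, PolyGrowth fun p : (ℝ × ℝ) × ((Fin n → ℂ) × (Fin n → ℂ)) => p.2.1 i :=
    fun i => (PolyGrowth.eval i).comp_fst.comp_snd
  have h2 : ∀ i, PolyGrowth fun p : (ℝ × ℝ) × ((Fin n → ℂ) × (Fin n → ℂ)) => p.2.2 i :=
    fun i => (PolyGrowth.eval i).comp_snd.comp_snd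
  have h0 : PolyGrowth fun t : ℝ => (t : ℂ) :=
    .of_norm_le (by fun_prop) (C := 1) fun t => by
      rw [Complex.norm_real]; linarith [norm_nonneg t]
  have h3 : PolyGrowth fun p : (ℝ × ℝ) × ((Fin n → ℂ) × (Fin n → ℂ)) =>
      (p.1.1 : ℂ) ^ 2 + (p.1.2 : ℂ) ^ 2 :=
    (h0.comp_fst.comp_fst.pow 2).add (h0.comp_snd.comp_fst.pow 2)
  refine .det fun i j => ?_
  simp only [Matrix.add_apply, Matrix.mul_apply, Matrix.sub_apply, Matrix.smul_apply,
    Matrix.vecMulVec_apply, Matrix.scalar_apply, Matrix.diagonal_apply, smul_eq_mul, Pi.star_apply,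
    RCLike.star_def]
  refine .add (.sum fun k _ => .mul ?_ ?_) ?_
  · exact (PolyGrowth.const _).sub ((PolyGrowth.const _).mul ((h1 i).mul (h2 k).star))
  · exact (PolyGrowth.const _).sub ((PolyGrowth.const _).mul ((h2 k).mul (h1 j).star))
  · split_ifs
    · exact h3
    · exact .const 0

/-- Serves twice: for exchanging u with the vectors in `integral_trace_resolvent`, and for the
absolute convergence of the outermost integral in `converges`. -/
theorem integrable_vectorIntegrand (a : Matrix (Fin n) (Fin n) ℂ) {ε v N : ℝ} (hε : 0 < ε)
    (hv : 0 ≤ v) (hN : 0 < N) :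
    Integrable (fun p : (ℝ × ℝ) × ((Fin n → ℂ) × (Fin n → ℂ)) =>
      ((p.1.1 : ℂ) + ε) * Complex.exp (-N * ((p.1.1 + ε) ^ 2 + p.1.2 ^ 2)) *
        vectorIntegrand a ε v ((p.1.1 : ℂ) ^ 2 + (p.1.2 : ℂ) ^ 2) p.2)
      ((volume : Measure (ℝ × ℝ)).prod (volume : Measure ((Fin n → ℂ) × (Fin n → ℂ)))) := by
  have h0 : PolyGrowth fun t : ℝ => (t : ℂ) :=
    .of_norm_le (by fun_prop) (C := 1) fun t => by
      rw [Complex.norm_real]; linarith [norm_nonneg t]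
  have hw : RapidWeight (volume : Measure ((ℝ × ℝ) × ((Fin n → ℂ) × (Fin n → ℂ)))) fun p =>
      Real.exp (-N * ((p.1.1 + ε) ^ 2 + p.1.2 ^ 2)) *
        (Real.exp (-ε * sqNorm p.2.1) * Real.exp (-ε * sqNorm p.2.2)) :=
    (rapidWeight_shifted hN ε).prod (rapidWeight_sqNorm_prod (n := n) hε hε)
  have hO : OpensMeasurableSpace ((ℝ × ℝ) × ((Fin n → ℂ) × (Fin n → ℂ))) := inferInstance
  have h := @RapidWeight.integrable_mul _ _ _ hO _ _ inferInstance hw _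
    (((h0.comp_fst.add (.const (ε : ℂ))).comp_fst.mul
    (((PolyGrowth.exp_sqNorm_mul hv).mul (.osc a)).comp_snd)).mul (.det_vecMulVec a v))
  refine h.congr ?_
  filter_upwards with p
  have e1 : Complex.exp (-N * ((p.1.1 + ε) ^ 2 + p.1.2 ^ 2)) =
      (Real.exp (-N * ((p.1.1 + ε) ^ 2 + p.1.2 ^ 2)) : ℂ) := by
    push_cast; rfl
  have e2 : Complex.exp (-ε * sqNorm p.2.1 - ε * sqNorm p.2.2) =
      (Real.exp (-ε * sqNorm p.2.1) : ℂ) * (Real.exp (-ε * sqNorm p.2.2) : ℂ) := by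
    push_cast
    rw [← Complex.exp_add]
    ring_nf
  rw [vectorIntegrand, e1, e2]
  push_cast
  ring

theorem rapidWeight_columns {v : ℝ≥0} (hv : v ≠ 0) :
    RapidWeight (Measure.pi fun _ : Fin n => Measure.pi fun _ : Fin n => complexGaussian v)
      fun _ => 1 := by
  have h := ((rapidWeight_complexGaussian hv).pi (ι := Fin n)).pi (ι := Fin n)
  simpa using h

theorem continuous_osc_addColumns (a : Matrix (Fin n) (Fin n) ℂ) :
    Continuous fun p : (Fin n → Fin n → ℂ) × ((Fin n → ℂ) × (Fin n → ℂ)) =>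
      osc (addColumns a p.1) p.2 := by
  simp only [osc, sesq_eq_sum, addColumns, Matrix.of_apply]
  fun_prop

/-- The Ginibre average of `Tr (M M^* + ε²)⁻¹`, `M = a + h`, as an integral over `u` and a pair of
vectors. -/
theorem integral_trace_resolvent (a : Matrix (Fin n) (Fin n) ℂ) {ε : ℝ} (hε : 0 < ε) {v : ℝ≥0}
    (hv : v ≠ 0) :
    ∫ h, (addColumns a h * (addColumns a h)ᴴ + Matrix.scalar (Fin n) ((ε : ℂ) ^ 2))⁻¹.trace
      ∂(Measure.pi fun _ : Fin n => Measure.pi fun _ : Fin n => complexGaussian v) =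
    ((Real.pi : ℂ) ^ (2 * n))⁻¹ * (-((v : ℂ)⁻¹ ^ 2 / (Real.pi * ε)) * ∫ u : ℝ × ℝ,
      ((u.1 : ℂ) + ε) * Complex.exp (-(v : ℂ)⁻¹ * ((u.1 + ε) ^ 2 + u.2 ^ 2)) *
        ∫ x, vectorIntegrand a ε v ((u.1 : ℂ) ^ 2 + (u.2 : ℂ) ^ 2) x) := by
  set D : (Fin n → Fin n → ℂ) → ℂ := fun h =>
    (Polynomial.derivative (shiftPoly (addColumns a h * (addColumns a h)ᴴ))).eval ((ε : ℂ) ^ 2)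
    with hD
  set E : (Fin n → ℂ) × (Fin n → ℂ) → ℂ := fun x =>
    Complex.exp (-ε * sqNorm x.1 - ε * sqNorm x.2) with hE
  have h1 : ∀ h, (addColumns a h * (addColumns a h)ᴴ +
      Matrix.scalar (Fin n) ((ε : ℂ) ^ 2))⁻¹.trace =
      ((Real.pi : ℂ) ^ (2 * n))⁻¹ * ∫ x, D h * (E x * osc (addColumns a h) x) := by
    intro h
    rw [trace_inv_add_scalar, inv_det_eq_integral _ hε, integral_const_mul]
    ring
  simp only [h1]
  rw [integral_const_mul]
  congr 1
  have hDp : PolyGrowth D := by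
    refine PolyGrowth.shiftPoly (M := fun h => addColumns a h * (addColumns a h)ᴴ) (fun i j => ?_)
      (Polynomial.leval ((ε : ℂ) ^ 2) ∘ₗ Polynomial.derivative)
    simp only [Matrix.mul_apply, Matrix.conjTranspose_apply, addColumns, Matrix.of_apply,
      RCLike.star_def]
    have he : ∀ i j, PolyGrowth fun h : Fin n → Fin n → ℂ => a i j + h j i := fun i j =>
      (PolyGrowth.const _).add ((PolyGrowth.eval i).comp_apply j)
    exact .sum fun k _ => (he i k).mul (he j k).star
  -- The character has modulus one and D grows polynomially, so Gaussian decay in h and in x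
  -- suffices for Fubini.
  have hint : Integrable (Function.uncurry fun h x => D h * (E x * osc (addColumns a h) x))
      ((Measure.pi fun _ : Fin n => Measure.pi fun _ : Fin n => complexGaussian v).prod
        volume) := by
    have hb : PolyGrowth fun p : (Fin n → Fin n → ℂ) × ((Fin n → ℂ) × (Fin n → ℂ)) =>
        osc (addColumns a p.1) p.2 :=
      .of_bounded (continuous_osc_addColumns a) (C := 1) fun p => (norm_osc _ _).le
    refine (((rapidWeight_columns hv).prod (rapidWeight_sqNorm_prod (n := n) hε hε)).integrable_mul
      (hDp.comp_fst.mul hb)).congr ?_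
    filter_upwards with p
    have e2 : E p.2 = (Real.exp (-ε * sqNorm p.2.1) : ℂ) * (Real.exp (-ε * sqNorm p.2.2) : ℂ) := by
      rw [hE]
      push_cast
      rw [← Complex.exp_add]
      ring_nf
    simp only [Function.uncurry, e2]
    push_cast
    ring
  rw [integral_integral_swap hint]
  have h2 : ∀ x : (Fin n → ℂ) × (Fin n → ℂ),
      (∫ h, D h * (E x * osc (addColumns a h) x)
        ∂(Measure.pi fun _ : Fin n => Measure.pi fun _ : Fin n => complexGaussian v)) =
      -((v : ℂ)⁻¹ ^ 2 / (Real.pi * ε)) * ∫ u : ℝ × ℝ,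
        ((u.1 : ℂ) + ε) * Complex.exp (-(v : ℂ)⁻¹ * ((u.1 + ε) ^ 2 + u.2 ^ 2)) *
        vectorIntegrand a ε v ((u.1 : ℂ) ^ 2 + (u.2 : ℂ) ^ 2) x := by
    intro x
    have h3 : ∀ h, D h * (E x * osc (addColumns a h) x) =
        E x * osc a x * ((∏ j, ∏ i, Complex.exp (-Complex.I *
        (starRingEnd ℂ (x.1 i * starRingEnd ℂ (x.2 j)) * h j i +
        x.1 i * starRingEnd ℂ (x.2 j) * starRingEnd ℂ (h j i)))) * D h) := by
      intro h
      rw [osc_addColumns]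
      ring
    simp only [h3]
    rw [integral_const_mul]
    have h4 := integral_derivative_det hv hε.ne' (fun j i => x.1 i * starRingEnd ℂ (x.2 j))
      (fun j i => a i j) (fun j i => starRingEnd ℂ (a i j))
    simp only [hD, addColumns_mul_conjTranspose]
    rw [h4]
    -- The squared frequencies |x₁ᵢ|²|x₂ⱼ|² sum to a product of norms: this is the quartic weight.
    have h5 : ∏ j, ∏ i, Complex.exp (-(‖x.1 i * starRingEnd ℂ (x.2 j)‖ : ℂ) ^ 2 * v) =
        Complex.exp (-(v : ℝ) * (sqNorm x.1 * sqNorm x.2)) := by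
      simp only [← Complex.exp_sum]
      congr 1
      simp only [sqNorm]
      push_cast
      rw [mul_comm (∑ i, (‖x.1 i‖ : ℂ) ^ 2), Finset.sum_mul_sum, Finset.mul_sum]
      refine Finset.sum_congr rfl fun j _ => ?_
      rw [Finset.mul_sum]
      refine Finset.sum_congr rfl fun i _ => ?_
      rw [norm_mul, RCLike.norm_conj]
      push_cast
      ring
    -- Both factors receive a correction with the same coefficient -iv, so they are no longer
    -- adjoint to each other.
    have h6 : ∀ q : ℂ, (∑ j, Matrix.vecMulVec
        (fun i => a i j + -Complex.I * (x.1 i * starRingEnd ℂ (x.2 j)) * v)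
        (fun i => starRingEnd ℂ (a i j) +
          -Complex.I * starRingEnd ℂ (x.1 i * starRingEnd ℂ (x.2 j)) * v) +
          Matrix.scalar (Fin n) q) =
        (a - (Complex.I * (v : ℝ)) • Matrix.vecMulVec x.1 (star x.2)) *
      (aᴴ - (Complex.I * (v : ℝ)) • Matrix.vecMulVec x.2 (star x.1)) +
        Matrix.scalar (Fin n) q := by
      intro q
      congr 1
      ext i k
      rw [Matrix.mul_apply, Matrix.sum_apply]
      refine Finset.sum_congr rfl fun j _ => ?_
      simp [Matrix.vecMulVec_apply]
      ring
    rw [h5]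
    simp only [h6]
    rw [mul_left_comm, ← mul_assoc (E x * osc a x), mul_assoc, ← integral_const_mul,
      ← integral_const_mul, ← integral_const_mul]
    rw [← integral_const_mul]
    refine integral_congr_ae (Filter.Eventually.of_forall fun u => ?_)
    simp only [vectorIntegrand, hE]
    ring
  simp only [h2]
  rw [integral_const_mul]
  congr 1
  have hv' : (0 : ℝ) < (v : ℝ)⁻¹ := by positivity
  have hi := integrable_vectorIntegrand a hε v.2 hv'
  rw [integral_integral_swap (f := fun x (u : ℝ × ℝ) =>
    ((u.1 : ℂ) + ε) * Complex.exp (-(v : ℂ)⁻¹ * ((u.1 + ε) ^ 2 + u.2 ^ 2)) *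
        vectorIntegrand a ε v ((u.1 : ℂ) ^ 2 + (u.2 : ℂ) ^ 2) x)]
  · simp only [integral_const_mul]
  · refine hi.swap.congr ?_
    filter_upwards with p
    simp only [Function.comp_apply, Function.uncurry, Prod.fst_swap, Prod.snd_swap]
    push_cast
    rfl

end Reduction

/-! ### Radial densities -/

section Polar

variable {n : ℕ}

/-- The radial part of Lebesgue measure on `ℂⁿ` in the variable `y = |φ|²`. -/
noncomputable def radialMeasure (n : ℕ) : Measure ℝ :=
  (volume.restrict (Ioi 0)).withDensity fun y => ENNReal.ofReal (y ^ (n - 1) / 2)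

instance : SFinite (radialMeasure n) := by
  unfold radialMeasure; infer_instance

/-- Under y = r², the polar density r^(2n-1) dr becomes y^(n-1)/2 dy. -/
theorem map_sq_volumeIoiPow (hn : n ≠ 0) :
    (Measure.volumeIoiPow (2 * n - 1)).map (fun r : Ioi (0 : ℝ) => (r : ℝ) ^ 2) =
      radialMeasure n := by
  refine Measure.ext_of_lintegral _ fun g hg => ?_
  rw [lintegral_map hg (by fun_prop), Measure.volumeIoiPow, radialMeasure,
    lintegral_withDensity_eq_lintegral_mul _ (by fun_prop)
      (g := fun r : Ioi (0 : ℝ) => g ((r : ℝ) ^ 2)) (hg.comp (by fun_prop)),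
    lintegral_withDensity_eq_lintegral_mul _ (by fun_prop) hg]
  simp only [Pi.mul_apply]
  rw [lintegral_subtype_comap measurableSet_Ioi
      (f := fun r : ℝ => ENNReal.ofReal (r ^ (2 * n - 1)) * g (r ^ 2))]
  have himg : (fun r : ℝ => r ^ 2) '' Ioi 0 = Ioi 0 := by
    ext y
    constructor
    · rintro ⟨r, hr, rfl⟩
      exact pow_pos (mem_Ioi.1 hr) 2
    · intro hy
      exact ⟨√y, Real.sqrt_pos.2 hy, Real.sq_sqrt (le_of_lt hy)⟩
  have hinj : InjOn (fun r : ℝ => r ^ 2) (Ioi 0) := fun x hx y hy h =>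
    (pow_left_inj₀ (le_of_lt hx) (le_of_lt hy) two_ne_zero).1 h
  conv_rhs => rw [← himg]
  rw [lintegral_image_eq_lintegral_abs_deriv_mul measurableSet_Ioi
    (fun x _ => (hasDerivAt_pow 2 x).hasDerivWithinAt) hinj]
  refine setLIntegral_congr_fun measurableSet_Ioi fun r hr => ?_
  have hr' : 0 < r := hr
  rw [← mul_assoc, ← ENNReal.ofReal_mul (abs_nonneg _)]
  congr 2
  rw [abs_of_pos (by positivity)]
  obtain ⟨m, rfl⟩ : ∃ m, n = m + 1 := ⟨n - 1, by omega⟩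
  have : 2 * (m + 1) - 1 = 2 * m + 1 := by omega
  rw [this, Nat.add_sub_cancel, ← pow_mul]
  push_cast
  ring

/-- Polar coordinates for the Euclidean norm, carried back to the space with the sup norm; σ is the
unnormalized surface measure of the unit sphere. -/
theorem exists_spherical_measure (hn : n ≠ 0) :
    ∃ σ : Measure (Fin n → ℂ), IsFiniteMeasure σ ∧ (∀ᵐ e ∂σ, sqNorm e = 1) ∧
      MeasurePreserving (fun p : (Fin n → ℂ) × ℝ => √p.2 • p.1) (σ.prod (radialMeasure n))
        volume := by
  let L : (Fin n → ℂ) ≃L[ℝ] EuclideanSpace ℂ (Fin n) :=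
    (PiLp.continuousLinearEquiv 2 ℝ fun _ : Fin n => ℂ).symm
  let μ : Measure (EuclideanSpace ℂ (Fin n)) := (volume : Measure (Fin n → ℂ)).map L
  have : μ.IsAddHaarMeasure := L.isAddHaarMeasure_map volume
  have : NeZero n := ⟨hn⟩
  have hdim : Module.finrank ℝ (EuclideanSpace ℂ (Fin n)) = 2 * n := by
    rw [finrank_real_of_complex, finrank_euclideanSpace, Fintype.card_fin]
  have hpol := μ.measurePreserving_homeomorphUnitSphereProd
  rw [hdim] at hpol
  have hsub : MeasurePreserving (Subtype.val : ({0}ᶜ : Set (EuclideanSpace ℂ (Fin n))) → _)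
      (μ.comap (↑)) μ := by
    have h := measurePreserving_subtype_coe (μa := μ)
      (measurableSet_singleton (0 : EuclideanSpace ℂ (Fin n))).compl
    rwa [restrict_compl_singleton] at h
  have hL : MeasurePreserving L.symm μ volume := by
    refine ⟨L.symm.continuous.measurable, ?_⟩
    rw [Measure.map_map L.symm.continuous.measurable L.continuous.measurable]
    simp
  have hfull := hL.comp (hsub.comp (hpol.symm (homeomorphUnitSphereProd _).toMeasurableEquiv))
  have hσ : Measurable fun s : Metric.sphere (0 : EuclideanSpace ℂ (Fin n)) 1 => L.symm s :=
    L.symm.continuous.measurable.comp measurable_subtype_coe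
  have hsq : MeasurePreserving (fun r : Ioi (0 : ℝ) => (r : ℝ) ^ 2)
      (Measure.volumeIoiPow (2 * n - 1)) (radialMeasure n) :=
    ⟨by fun_prop, map_sq_volumeIoiPow hn⟩
  have hP := (hσ.measurePreserving μ.toSphere).prod hsq
  refine ⟨μ.toSphere.map fun s : Metric.sphere (0 : EuclideanSpace ℂ (Fin n)) 1 => L.symm s, inferInstance, ?_, ?_⟩
  · refine (ae_map_iff hσ.aemeasurable ?_).2 (Filter.Eventually.of_forall fun s => ?_)
    · exact (isClosed_eq continuous_sqNorm continuous_const).measurableSet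
    · have hs : ‖(s : EuclideanSpace ℂ (Fin n))‖ = 1 := by simp
      rw [EuclideanSpace.norm_eq, Real.sqrt_eq_one] at hs
      exact hs
  · have hB : Measurable fun p : (Fin n → ℂ) × ℝ => √p.2 • p.1 := by fun_prop
    refine ⟨hB, ?_⟩
    rw [← hP.map_eq, Measure.map_map hB hP.measurable, ← hfull.map_eq]
    congr 1
    funext p
    have hp : (0 : ℝ) < p.2 := p.2.2
    simp only [Function.comp_apply, Prod.map_fst, Prod.map_snd, Real.sqrt_sq hp.le]
    rw [← map_smul]
    rfl

theorem measurePreserving_prodProdProdComm {A B C D : Type*} [MeasurableSpace A]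
    [MeasurableSpace B] [MeasurableSpace C] [MeasurableSpace D] (μ : Measure A) (ν : Measure B)
    (ξ : Measure C) (η : Measure D) [SFinite μ] [SFinite ν] [SFinite ξ] [SFinite η] :
    MeasurePreserving (fun p : (A × B) × C × D => ((p.1.1, p.2.1), (p.1.2, p.2.2)))
      ((μ.prod ν).prod (ξ.prod η)) ((μ.prod ξ).prod (ν.prod η)) := by
  have h1 := measurePreserving_prodAssoc μ ν (ξ.prod η)
  have h2 := (MeasurePreserving.id μ).prod
    ((measurePreserving_prodAssoc ν ξ η).symm MeasurableEquiv.prodAssoc)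
  have h3 := (MeasurePreserving.id μ).prod
    ((Measure.measurePreserving_swap (μ := ν) (ν := ξ)).prod (MeasurePreserving.id η))
  have h4 := (MeasurePreserving.id μ).prod (measurePreserving_prodAssoc ξ ν η)
  have h5 := (measurePreserving_prodAssoc μ ξ (ν.prod η)).symm MeasurableEquiv.prodAssoc
  exact h5.comp (h4.comp (h3.comp (h2.comp h1)))

theorem sqNorm_smul (c : ℝ) (φ : Fin n → ℂ) : sqNorm (c • φ) = c ^ 2 * sqNorm φ := by
  simp only [sqNorm, Pi.smul_apply, norm_smul, mul_pow, Real.norm_eq_abs, sq_abs, Finset.mul_sum]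

theorem norm_le_one_of_sqNorm {φ : Fin n → ℂ} (h : sqNorm φ = 1) : ‖φ‖ ≤ 1 := by
  rw [pi_norm_le_iff_of_nonneg zero_le_one]
  intro i
  have h1 : ‖φ i‖ ^ 2 ≤ sqNorm φ :=
    Finset.single_le_sum (f := fun i => ‖φ i‖ ^ 2) (fun i _ => by positivity) (Finset.mem_univ i)
  nlinarith [norm_nonneg (φ i)]

/-- Integrating out the directions of a pair of vectors: if `Θ (c φ₁, φ₂) = Θ (φ₁, c φ₂)`, the
density of `Θ` in the variables `|φ₁|²`, `|φ₂|²` is a function of their product. -/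
theorem exists_radial_density (hn : n ≠ 0) {Θ : (Fin n → ℂ) × (Fin n → ℂ) → ℂ}
    (hΘ : PolyGrowth Θ) (hinv : ∀ (c : ℝ) (x y : Fin n → ℂ), Θ (c • x, y) = Θ (x, c • y)) :
    ∃ J : ℝ → ℂ, PolyGrowth J ∧ ∀ f : ℝ × ℝ → ℂ,
      Integrable (fun x : (Fin n → ℂ) × (Fin n → ℂ) => f (sqNorm x.1, sqNorm x.2) * Θ x) →
      ∫ x : (Fin n → ℂ) × (Fin n → ℂ), f (sqNorm x.1, sqNorm x.2) * Θ x =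
        ∫ y in Ioi (0 : ℝ) ×ˢ Ioi (0 : ℝ), f y * J (y.1 * y.2) := by
  obtain ⟨σ, hfin, hσ1, hmp⟩ := exists_spherical_measure hn
  have hσ2 : ∀ᵐ e ∂σ.prod σ, sqNorm e.1 = 1 ∧ sqNorm e.2 = 1 :=
    (Measure.quasiMeasurePreserving_fst.ae hσ1).and (Measure.quasiMeasurePreserving_snd.ae hσ1)
  set M : ℝ → ℂ := fun p => ∫ e, Θ (√p • e.1, e.2) ∂σ.prod σ with hM
  obtain ⟨C, N, hC, hb⟩ := hΘ.exists_bound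
  have hbound : ∀ p : ℝ, ∀ᵐ e ∂σ.prod σ, ‖Θ (√p • e.1, e.2)‖ ≤ C * (2 + √p) ^ N := by
    intro p
    filter_upwards [hσ2] with e he
    refine (hb _).trans ?_
    have h1 := norm_le_one_of_sqNorm he.1
    have h2 := norm_le_one_of_sqNorm he.2
    have h3 : ‖(√p • e.1, e.2)‖ ≤ 1 + √p := by
      rw [Prod.norm_def]
      refine max_le ?_ ?_
      · simp only [norm_smul, Real.norm_eq_abs, abs_of_nonneg (Real.sqrt_nonneg p)]
        nlinarith [Real.sqrt_nonneg p]
      · simp only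
        linarith [Real.sqrt_nonneg p]
    exact mul_le_mul_of_nonneg_left (pow_le_pow_left₀ (by positivity) (by linarith) _) hC
  have hcontM : Continuous M := by
    refine continuous_iff_continuousAt.2 fun p₀ => ?_
    refine continuousAt_of_dominated (bound := fun _ => C * (2 + (√p₀ + 1)) ^ N) ?_ ?_ ?_ ?_
    · refine Filter.Eventually.of_forall fun p => ?_
      exact (hΘ.1.comp (by fun_prop)).aestronglyMeasurable
    · have : ∀ᶠ p in nhds p₀, √p < √p₀ + 1 :=
        (Real.continuous_sqrt.tendsto p₀).eventually_lt_const (by linarith)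
      filter_upwards [this] with p hp
      filter_upwards [hbound p] with e he
      refine he.trans ?_
      gcongr
    · exact integrable_const _
    · refine Filter.Eventually.of_forall fun e => ?_
      exact (hΘ.1.comp (by fun_prop : Continuous fun p : ℝ => (√p • e.1, e.2))).continuousAt
  have hMp : PolyGrowth M := by
    refine ⟨hcontM, (C * 3 ^ N) * (σ.prod σ).real univ, N, fun p => ?_⟩
    have h1 : ‖M p‖ ≤ C * (2 + √p) ^ N * (σ.prod σ).real univ :=
      norm_integral_le_of_norm_le_const (hbound p)
    refine h1.trans ?_
    have h2 : 2 + √p ≤ 3 * (1 + ‖p‖) := by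
      have : √p ≤ 1 + |p| := by
        refine Real.sqrt_le_iff.2 ⟨by positivity, ?_⟩
        nlinarith [abs_nonneg p, le_abs_self p]
      rw [Real.norm_eq_abs]
      nlinarith [abs_nonneg p]
    calc C * (2 + √p) ^ N * (σ.prod σ).real univ
        ≤ C * (3 * (1 + ‖p‖)) ^ N * (σ.prod σ).real univ := by gcongr
      _ = _ := by rw [mul_pow]; ring
  have h0 : PolyGrowth fun t : ℝ => (t : ℂ) :=
    .of_norm_le (by fun_prop) (C := 1) fun t => by
      rw [Complex.norm_real]; linarith [norm_nonneg t]
  -- J is the average of Θ over directions times the two radial densities y^(n-1)/2.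
  refine ⟨fun p => ((p : ℂ) ^ (n - 1) * (1 / 4)) * M p, ((h0.pow _).mul (.const _)).mul hMp,
    fun f hf => ?_⟩
  set ρ := radialMeasure n with hρ
  have hΦ := (hmp.prod hmp).comp (measurePreserving_prodProdProdComm σ σ ρ ρ)
  set F : (Fin n → ℂ) × (Fin n → ℂ) → ℂ := fun x => f (sqNorm x.1, sqNorm x.2) * Θ x with hF
  have hρ0 : ∀ᵐ y ∂ρ, 0 < y := by
    rw [hρ, radialMeasure]
    exact (withDensity_absolutelyContinuous _ _).ae_le (ae_restrict_mem measurableSet_Ioi)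
  have hy2 : ∀ᵐ y ∂ρ.prod ρ, 0 < y.1 ∧ 0 < y.2 :=
    (Measure.quasiMeasurePreserving_fst.ae hρ0).and (Measure.quasiMeasurePreserving_snd.ae hρ0)
  -- The invariance moves both radii onto the first vector, where only √(y₁y₂) is seen.
  have hae : ∀ᵐ p ∂(σ.prod σ).prod (ρ.prod ρ), F (√p.2.1 • p.1.1, √p.2.2 • p.1.2) =
      f p.2 * Θ (√(p.2.1 * p.2.2) • p.1.1, p.1.2) := by
    filter_upwards [Measure.quasiMeasurePreserving_fst.ae hσ2, Measure.quasiMeasurePreserving_snd.ae hy2]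
      with p hp hy
    simp only [hF, sqNorm_smul, hp.1, hp.2, Real.sq_sqrt hy.1.le, Real.sq_sqrt hy.2.le, mul_one]
    rw [← hinv, smul_smul, Real.sqrt_mul hy.1.le, mul_comm √p.2.2]
  have hFi : Integrable (fun p : ((Fin n → ℂ) × (Fin n → ℂ)) × (ℝ × ℝ) =>
      f p.2 * Θ (√(p.2.1 * p.2.2) • p.1.1, p.1.2)) ((σ.prod σ).prod (ρ.prod ρ)) := by
    have h1 : Integrable (F ∘ _) ((σ.prod σ).prod (ρ.prod ρ)) :=
      (hΦ.integrable_comp hf.1).2 hf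
    exact h1.congr hae
  have h1 : ∫ x, F x = ∫ p, F (√p.2.1 • p.1.1, √p.2.2 • p.1.2) ∂(σ.prod σ).prod (ρ.prod ρ) := by
    have h2 : (volume : Measure ((Fin n → ℂ) × (Fin n → ℂ))) = _ := hΦ.map_eq.symm
    rw [h2, integral_map hΦ.measurable.aemeasurable]
    · rfl
    · rw [← h2]; exact hf.1
  rw [h1, integral_congr_ae hae, integral_prod_symm _ hFi]
  simp only [integral_const_mul]
  change ∫ y, f y * M (y.1 * y.2) ∂ρ.prod ρ = _
  have hρρ : ρ.prod ρ = (volume.restrict (Ioi (0 : ℝ) ×ˢ Ioi (0 : ℝ))).withDensity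
      fun y => ENNReal.ofReal (y.1 ^ (n - 1) / 2) * ENNReal.ofReal (y.2 ^ (n - 1) / 2) := by
    rw [hρ, radialMeasure, prod_withDensity (by fun_prop) (by fun_prop), Measure.prod_restrict]
    rfl
  rw [hρρ, integral_withDensity_eq_integral_toReal_smul (by fun_prop)
    (Filter.Eventually.of_forall fun y =>
      ENNReal.mul_lt_top ENNReal.ofReal_lt_top ENNReal.ofReal_lt_top)]
  refine setIntegral_congr_fun (measurableSet_Ioi.prod measurableSet_Ioi) fun y hy => ?_
  have hy1 : 0 < y.1 := hy.1
  have hy2 : 0 < y.2 := hy.2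
  simp only [ENNReal.toReal_mul]
  rw [ENNReal.toReal_ofReal (by positivity), ENNReal.toReal_ofReal (by positivity),
    Complex.real_smul]
  push_cast
  rw [mul_pow]
  ring

end Polar

/-! ### Fourier inversion in two variables -/

section Fourier

/-- The two-dimensional Fourier transform, with the convention `∫ g(x) exp (i s · x) dx`. -/
noncomputable def fourier₂ (g : ℝ × ℝ → ℂ) (s : ℝ × ℝ) : ℂ :=
  ∫ x : ℝ × ℝ, g x * Complex.exp (Complex.I * (s.1 * x.1 + s.2 * x.2))

/-- Fourier inversion at the origin, with the plane identified with ℂ as an inner product space. The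
rescaling s = -2πξ in two dimensions produces (2π)². -/
theorem integral_fourier₂ {g : ℝ × ℝ → ℂ} (hg : Integrable g) (hg' : Integrable (fourier₂ g))
    (hc : ContinuousAt g 0) : ∫ s, fourier₂ g s = (2 * Real.pi) ^ 2 * g 0 := by
  set e := Complex.measurableEquivRealProd
  have he := Complex.volume_preserving_equiv_real_prod
  set F : ℂ → ℂ := fun z => g (e z) with hF
  have hFi : Integrable F := (he.integrable_comp_emb e.measurableEmbedding).2 hg
  have hπ : (2 * Real.pi) ≠ 0 := by positivity
  have hFhat : ∀ ξ : ℂ, FourierTransform.fourier F ξ = fourier₂ g (-(2 * Real.pi) • e ξ) := by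
    intro ξ
    rw [Real.fourier_eq', fourier₂, ← he.integral_comp e.measurableEmbedding]
    refine integral_congr_ae (Filter.Eventually.of_forall fun v => ?_)
    simp only [hF, smul_eq_mul, e, Complex.measurableEquivRealProd_apply, Prod.smul_fst,
      Prod.smul_snd, Complex.inner]
    rw [mul_comm]
    congr 2
    simp
    ring
  have hFhati : Integrable (FourierTransform.fourier F) := by
    have h1 : Integrable fun x : ℝ × ℝ => fourier₂ g (-(2 * Real.pi) • x) :=
      hg'.comp_smul (neg_ne_zero.2 hπ)
    have h2 := (he.integrable_comp_emb e.measurableEmbedding).2 h1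
    refine h2.congr (Filter.Eventually.of_forall fun ξ => (hFhat ξ).symm)
  have hcont : ContinuousAt F 0 := by
    have h1 : F = g ∘ fun z : ℂ => (z.re, z.im) := rfl
    rw [h1]
    exact ContinuousAt.comp (x := (0 : ℂ)) hc (by fun_prop)
  have h := hFi.fourierInv_fourier_eq hFhati hcont
  rw [Real.fourierInv_eq'] at h
  simp only [inner_zero_right, mul_zero, Complex.ofReal_zero, zero_mul, Complex.exp_zero,
    one_smul, hFhat] at h
  rw [he.integral_comp e.measurableEmbedding fun x => fourier₂ g (-(2 * Real.pi) • x),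
    Measure.integral_comp_smul] at h
  have hF0 : F 0 = g 0 := by
    simp only [hF, e, Complex.measurableEquivRealProd_apply]
    rfl
  rw [hF0] at h
  rw [← h]
  have hr : Module.finrank ℝ (ℝ × ℝ) = 2 := by simp
  rw [hr, Complex.real_smul, ← mul_assoc]
  have : (2 * (Real.pi : ℂ)) ≠ 0 := by exact_mod_cast hπ
  rw [abs_of_nonneg (by positivity)]
  push_cast
  field_simp

/-- Averaging a density over diagonal translations, and Fourier inversion. -/
theorem integral_fourier₂_mul {α : Type*} [MeasurableSpace α] {m : Measure α} [SFinite m]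
    {f : ℝ × ℝ → ℂ} (hfm : Measurable f) (hf : Integrable f) {C : ℝ} (hfb : ∀ x, ‖f x‖ ≤ C)
    {w : α → ℂ} (hw : Integrable w m) {k : α → ℝ} (hk : Measurable k)
    (hcont : ∀ᵐ r ∂m, ContinuousAt f (k r, k r))
    (hint : Integrable fun s : ℝ × ℝ =>
      fourier₂ f s * ∫ r, w r * Complex.exp (-Complex.I * k r * (s.1 + s.2)) ∂m) :
    ∫ s : ℝ × ℝ, fourier₂ f s * ∫ r, w r * Complex.exp (-Complex.I * k r * (s.1 + s.2)) ∂m =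
      (2 * Real.pi) ^ 2 * ∫ r, w r * f (k r, k r) ∂m := by
  -- The product to be integrated is the Fourier transform of this average of translates, and the
  -- right-hand side is (2π)² g(0). Although f may jump, g is continuous at 0, because (k r, k r) is
  -- a continuity point of f for almost every r.
  set g : ℝ × ℝ → ℂ := fun y => ∫ r, w r * f (y + (k r, k r)) ∂m with hg
  have hshift : ∀ r, Integrable fun y : ℝ × ℝ => f (y + (k r, k r)) := fun r =>
    hf.comp_add_right _
  have hmeas : AEStronglyMeasurable (fun p : α × (ℝ × ℝ) => w p.1 * f (p.2 + (k p.1, k p.1)))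
      (m.prod volume) := by
    refine hw.1.comp_fst.mul (Measurable.aestronglyMeasurable ?_)
    exact hfm.comp (by fun_prop)
  have hprod : Integrable (fun p : α × (ℝ × ℝ) => w p.1 * f (p.2 + (k p.1, k p.1)))
      (m.prod volume) := by
    refine (integrable_prod_iff hmeas).2 ⟨Filter.Eventually.of_forall fun r =>
      (hshift r).const_mul (w r), ?_⟩
    simp only [norm_mul, integral_const_mul]
    have : ∀ r, ∫ y : ℝ × ℝ, ‖f (y + (k r, k r))‖ = ∫ y, ‖f y‖ := fun r =>
      integral_add_right_eq_self (fun y => ‖f y‖) (k r, k r)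
    simp only [this]
    exact hw.norm.mul_const _
  have hgi : Integrable g := hprod.integral_prod_right
  have hghat : ∀ s, fourier₂ g s =
      fourier₂ f s * ∫ r, w r * Complex.exp (-Complex.I * k r * (s.1 + s.2)) ∂m := by
    intro s
    have hb : ∀ x : ℝ × ℝ, ‖Complex.exp (Complex.I * (s.1 * x.1 + s.2 * x.2))‖ = 1 := by
      intro x
      have : Complex.I * (s.1 * x.1 + s.2 * x.2 : ℂ) = ((s.1 * x.1 + s.2 * x.2 : ℝ) : ℂ) *
        Complex.I := by push_cast; ring
      rw [this, Complex.norm_exp_ofReal_mul_I]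
    have h1 : Integrable (Function.uncurry fun (y : ℝ × ℝ) (r : α) =>
        w r * f (y + (k r, k r)) * Complex.exp (Complex.I * (s.1 * y.1 + s.2 * y.2)))
        ((volume : Measure (ℝ × ℝ)).prod m) := by
      refine (hprod.swap.mul_bdd (c := 1) (g := fun p : (ℝ × ℝ) × α =>
        Complex.exp (Complex.I * (s.1 * p.1.1 + s.2 * p.1.2))) ?_ ?_)
      · exact Measurable.aestronglyMeasurable (by fun_prop)
      · exact Filter.Eventually.of_forall fun p => (hb p.1).le
    have hl : fourier₂ g s = ∫ y : ℝ × ℝ, ∫ r, w r * f (y + (k r, k r)) *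
        Complex.exp (Complex.I * (s.1 * y.1 + s.2 * y.2)) ∂m := by
      simp only [fourier₂, hg, integral_mul_const]
    rw [hl, integral_integral_swap h1, ← integral_const_mul]
    refine integral_congr_ae (Filter.Eventually.of_forall fun r => ?_)
    simp only
    have h2 := integral_add_right_eq_self (μ := (volume : Measure (ℝ × ℝ)))
      (fun y => w r * f y * Complex.exp (Complex.I * (s.1 * (y.1 - k r) + s.2 * (y.2 - k r))))
      (k r, k r)
    simp only [Prod.fst_add, Prod.snd_add, Complex.ofReal_add, add_sub_cancel_right] at h2
    rw [h2, fourier₂, ← integral_mul_const]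
    refine integral_congr_ae (Filter.Eventually.of_forall fun y => ?_)
    simp only
    have : Complex.exp (Complex.I * (s.1 * (y.1 - k r) + s.2 * (y.2 - k r))) =
        Complex.exp (Complex.I * (s.1 * y.1 + s.2 * y.2)) *
          Complex.exp (-Complex.I * k r * (s.1 + s.2)) := by
      rw [← Complex.exp_add]
      ring_nf
    rw [this]
    ring
  have hgc : ContinuousAt g 0 := by
    refine continuousAt_of_dominated (bound := fun r => ‖w r‖ * C) ?_ ?_ ?_ ?_
    · refine Filter.Eventually.of_forall fun y => ?_
      exact hw.1.mul (hfm.comp (by fun_prop)).aestronglyMeasurable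
    · refine Filter.Eventually.of_forall fun y => Filter.Eventually.of_forall fun r => ?_
      rw [norm_mul]
      exact mul_le_mul_of_nonneg_left (hfb _) (norm_nonneg _)
    · exact hw.norm.mul_const _
    · filter_upwards [hcont] with r hr
      refine continuousAt_const.mul (ContinuousAt.comp ?_ (by fun_prop))
      simpa using hr
  have h := integral_fourier₂ hgi (hint.congr (Filter.Eventually.of_forall fun s =>
    (hghat s).symm)) hgc
  simp only [hghat] at h
  rw [h]
  simp only [hg, zero_add]

end Fourier

/-! ### The radial kernel and integrability by decay -/

section OscillatoryKernel

theorem polyGrowth_ofReal : PolyGrowth fun t : ℝ => (t : ℂ) :=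
  .of_norm_le (by fun_prop) (C := 1) fun t => by
    rw [Complex.norm_real]; linarith [norm_nonneg t]

/-- The exponential weight in `r = (r₁, r₂)`, at `τ = t₁ + t₂`. -/
noncomputable def radialKernel (N ε : ℝ) (τ : ℂ) (r : ℝ × ℝ) : ℂ :=
  Complex.exp (-N * (r.1 * r.2) ^ 2 - Complex.I * N * r.1 * r.2 * τ - N * ε * (r.1 ^ 2 + r.2 ^ 2))

theorem norm_radialKernel (N ε : ℝ) (τ : ℂ) (r : ℝ × ℝ) :
    ‖radialKernel N ε τ r‖ = Real.exp (-N * (r.1 * r.2) ^ 2 + N * (r.1 * r.2) * τ.im) *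
      Real.exp (-(N * ε) * ((r.1 + 0) ^ 2 + r.2 ^ 2)) := by
  rw [radialKernel, Complex.norm_exp, ← Real.exp_add]
  congr 1
  have : (-N * (r.1 * r.2) ^ 2 - Complex.I * N * r.1 * r.2 * τ - N * ε * (r.1 ^ 2 + r.2 ^ 2) : ℂ) =
      ((-N * (r.1 * r.2) ^ 2 - N * ε * (r.1 ^ 2 + r.2 ^ 2) : ℝ) : ℂ) -
        ((N * r.1 * r.2 : ℝ) : ℂ) * (Complex.I * τ) := by
    push_cast
    ring
  rw [this, Complex.sub_re, Complex.ofReal_re, Complex.re_ofReal_mul, Complex.I_mul_re]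
  ring

/-- With k = r₁r₂, k Im τ - k² ≤ (Im τ)²/4: the quartic term controls the growth caused by Im τ,
uniformly in Re τ. -/
theorem norm_radialKernel_le {N : ℝ} (hN : 0 < N) (ε : ℝ) (τ : ℂ) (r : ℝ × ℝ) :
    ‖radialKernel N ε τ r‖ ≤ Real.exp (N * τ.im ^ 2 / 4) *
      Real.exp (-(N * ε) * ((r.1 + 0) ^ 2 + r.2 ^ 2)) := by
  rw [norm_radialKernel]
  gcongr
  nlinarith [mul_nonneg hN.le (sq_nonneg (r.1 * r.2 - τ.im / 2))]

theorem continuous_radialKernel (N ε : ℝ) (τ : ℂ) : Continuous (radialKernel N ε τ) := by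
  unfold radialKernel
  fun_prop

theorem integrable_mul_radialKernel {N ε : ℝ} (hN : 0 < N) (hε : 0 < ε) (τ : ℂ)
    {P : ℝ × ℝ → ℂ} (hP : PolyGrowth P) : Integrable fun r => P r * radialKernel N ε τ r := by
  have h := ((rapidWeight_shifted (mul_pos hN hε) 0).integrable_mul hP).norm.const_mul
    (Real.exp (N * τ.im ^ 2 / 4))
  refine h.mono' (hP.1.mul (continuous_radialKernel N ε τ)).aestronglyMeasurable ?_
  filter_upwards with r
  rw [norm_mul, norm_mul, Complex.norm_real, Real.norm_of_nonneg (Real.exp_pos _).le]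
  calc ‖P r‖ * ‖radialKernel N ε τ r‖ ≤ ‖P r‖ * _ :=
        mul_le_mul_of_nonneg_left (norm_radialKernel_le hN ε τ r) (norm_nonneg _)
    _ = _ := by ring

/-- The integrand is the y-derivative of y times the kernel, which vanishes at 0 and at infinity.
Its term containing τ is what `exists_radial_bound` solves for. -/
theorem integral_deriv_radialKernel {N ε : ℝ} (hN : 0 < N) (hε : 0 < ε) (τ : ℂ) (x : ℝ) :
    ∫ y : ℝ in Ioi 0, (1 - 2 * N * (x ^ 2 + ε) * y ^ 2 - Complex.I * N * x * y * τ) *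
      radialKernel N ε τ (x, y) = 0 := by
  set β : ℂ := ((N * (x ^ 2 + ε) : ℝ) : ℂ) with hβ
  set c : ℂ := -Complex.I * N * x * τ with hc
  have hβ' : 0 < β.re := by
    rw [hβ, Complex.ofReal_re]; positivity
  have hk : ∀ y : ℝ, radialKernel N ε τ (x, y) =
      Complex.exp (-N * ε * x ^ 2) * Complex.exp (-β * y ^ 2 + c * y) := by
    intro y
    rw [radialKernel, ← Complex.exp_add]
    congr 1
    rw [hβ, hc]
    push_cast
    ring
  have hd : ∀ y : ℝ, HasDerivAt (fun y : ℝ => (y : ℂ) * radialKernel N ε τ (x, y))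
      ((1 - 2 * N * (x ^ 2 + ε) * y ^ 2 - Complex.I * N * x * y * τ) *
        radialKernel N ε τ (x, y)) y := by
    intro y
    simp only [hk]
    have h1 := (((((hasDerivAt_id (y : ℂ)).pow 2).const_mul (-β)).add
      ((hasDerivAt_id (y : ℂ)).const_mul c)).cexp)
    have h2 := ((hasDerivAt_id (y : ℂ)).mul (h1.const_mul (Complex.exp (-N * ε * x ^ 2)))).comp_ofReal
    refine h2.congr_deriv ?_
    simp only [id, Pi.add_apply, Pi.pow_apply, hβ, hc]
    push_cast
    ring
  have i : ∀ k : ℕ, Integrable fun y : ℝ => (y : ℂ) ^ k * radialKernel N ε τ (x, y) := by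
    intro k
    simp only [hk]
    refine ((integrable_pow_mul_cexp_quadratic hβ' c k).const_mul
      (Complex.exp (-N * ε * x ^ 2))).congr (Filter.Eventually.of_forall fun y => ?_)
    ring
  have hi' : Integrable fun y : ℝ => (1 - 2 * N * (x ^ 2 + ε) * y ^ 2 - Complex.I * N * x * y * τ) *
      radialKernel N ε τ (x, y) := by
    refine (((i 0).sub ((i 2).const_mul (2 * N * (x ^ 2 + ε) : ℂ))).sub
      ((i 1).const_mul (Complex.I * N * x * τ))).congr (Filter.Eventually.of_forall fun y => ?_)
    simp only [Pi.sub_apply]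
    ring
  have hi : Integrable fun y : ℝ => (y : ℂ) * radialKernel N ε τ (x, y) := by
    simpa using i 1
  rw [integral_Ioi_of_hasDerivAt_of_tendsto' (fun y _ => hd y) hi'.integrableOn
    (tendsto_zero_of_hasDerivAt_of_integrableOn_Ioi (a := 0) (fun y _ => hd y) hi'.integrableOn
      hi.integrableOn)]
  simp

/-- Decay of the radial integral in `τ = t₁ + t₂`. -/
theorem exists_radial_bound {N ε : ℝ} (hN : 0 < N) (hε : 0 < ε) (b : ℝ) :
    ∃ K, ∀ τ : ℂ, τ.im = b →
      ‖τ‖ * ‖∫ r in Ioi (0 : ℝ) ×ˢ Ioi (0 : ℝ), (r.1 * r.2 : ℂ) * radialKernel N ε τ r‖ ≤ K := by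
  have hP : PolyGrowth fun r : ℝ × ℝ => (1 - 2 * N * ((r.1 : ℂ) ^ 2 + ε) * (r.2 : ℂ) ^ 2) :=
    (PolyGrowth.const _).sub (((PolyGrowth.const _).mul
      ((polyGrowth_ofReal.comp_fst.pow 2).add (.const _))).mul (polyGrowth_ofReal.comp_snd.pow 2))
  have hQ : PolyGrowth fun r : ℝ × ℝ => (r.1 * r.2 : ℂ) :=
    polyGrowth_ofReal.comp_fst.mul polyGrowth_ofReal.comp_snd
  refine ⟨N⁻¹ * ∫ r in Ioi (0 : ℝ) ×ˢ Ioi (0 : ℝ), Real.exp (N * b ^ 2 / 4) *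
    ‖(1 - 2 * N * ((r.1 : ℂ) ^ 2 + ε) * (r.2 : ℂ) ^ 2) *
      (Real.exp (-(N * ε) * ((r.1 + 0) ^ 2 + r.2 ^ 2)) : ℂ)‖, fun τ hτ => ?_⟩
  have iP := integrable_mul_radialKernel hN hε τ hP
  have iQ := integrable_mul_radialKernel hN hε τ hQ
  -- Integration by parts in r₂ trades τ times the radial integral for an integral bounded uniformly
  -- in Re τ.
  have hD : ∫ r in Ioi (0 : ℝ) ×ˢ Ioi (0 : ℝ),
      ((1 - 2 * N * ((r.1 : ℂ) ^ 2 + ε) * (r.2 : ℂ) ^ 2) * radialKernel N ε τ r -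
        (Complex.I * N * τ) * ((r.1 * r.2 : ℂ) * radialKernel N ε τ r)) = 0 := by
    have hi : IntegrableOn (fun r : ℝ × ℝ => (1 - 2 * N * ((r.1 : ℂ) ^ 2 + ε) * (r.2 : ℂ) ^ 2) *
        radialKernel N ε τ r - (Complex.I * N * τ) * ((r.1 * r.2 : ℂ) * radialKernel N ε τ r))
        (Ioi (0 : ℝ) ×ˢ Ioi (0 : ℝ)) (volume.prod volume) :=
      (iP.sub (iQ.const_mul (Complex.I * N * τ))).integrableOn
    rw [Measure.volume_eq_prod, setIntegral_prod _ hi]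
    refine (integral_congr_ae (Filter.Eventually.of_forall fun x => ?_)).trans
      (integral_zero ℝ ℂ)
    simp only
    rw [← integral_deriv_radialKernel hN hε τ x]
    refine integral_congr_ae (Filter.Eventually.of_forall fun y => ?_)
    simp only
    ring
  rw [integral_sub iP.integrableOn (iQ.const_mul _).integrableOn, integral_const_mul, sub_eq_zero]
    at hD
  have h1 : N * (‖τ‖ * ‖∫ r in Ioi (0 : ℝ) ×ˢ Ioi (0 : ℝ), (r.1 * r.2 : ℂ) *
      radialKernel N ε τ r‖) = ‖∫ r in Ioi (0 : ℝ) ×ˢ Ioi (0 : ℝ),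
      (1 - 2 * N * ((r.1 : ℂ) ^ 2 + ε) * (r.2 : ℂ) ^ 2) * radialKernel N ε τ r‖ := by
    rw [hD, norm_mul, norm_mul, norm_mul, Complex.norm_I, Complex.norm_real,
      Real.norm_of_nonneg hN.le]
    ring
  rw [← div_eq_inv_mul, le_div_iff₀ hN, mul_comm _ N, h1]
  refine norm_integral_le_of_norm_le ?_ (Filter.Eventually.of_forall fun r => ?_)
  · exact (((rapidWeight_shifted (mul_pos hN hε) 0).integrable_mul hP).norm.const_mul _).integrableOn
  · rw [norm_mul, norm_mul, Complex.norm_real, Real.norm_of_nonneg (Real.exp_pos _).le, ← hτ]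
    calc _ ≤ ‖(1 - 2 * N * ((r.1 : ℂ) ^ 2 + ε) * (r.2 : ℂ) ^ 2)‖ * _ :=
        mul_le_mul_of_nonneg_left (norm_radialKernel_le hN ε τ r) (norm_nonneg _)
      _ = _ := by ring

end OscillatoryKernel

/-! ### Integrability on L × L from decay in t₁, t₂ and t₁ + t₂ -/

section Decay

theorem le_norm_add_mul_I {b : ℝ} (hb : 0 < b) :
    ∃ c > 0, ∀ s : ℝ, c * (1 + ‖s‖ ^ 2) ^ (1 / 2 : ℝ) ≤ ‖(s : ℂ) + b * Complex.I‖ := by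
  refine ⟨min 1 b, lt_min one_pos hb, fun s => ?_⟩
  have hc : 0 < min 1 b := lt_min one_pos hb
  have hc1 : min 1 b ≤ 1 := min_le_left _ _
  have hcb : min 1 b ≤ b := min_le_right _ _
  rw [← Real.sqrt_eq_rpow, Complex.norm_add_mul_I]
  refine Real.le_sqrt_of_sq_le ?_
  rw [mul_pow, Real.sq_sqrt (by positivity), Real.norm_eq_abs, sq_abs]
  have h1 : (min 1 b) ^ 2 ≤ 1 := pow_le_one₀ hc.le hc1
  have h2 : (min 1 b) ^ 2 ≤ b ^ 2 := pow_le_pow_left₀ hc.le hcb 2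
  nlinarith [sq_nonneg s]

/-- No two of the three factors of order |·|⁻¹ are integrable on the plane, but all three together
are. As x²y²z² = (xy)(xz)(yz) ≤ (xy)³ + (xz)³ + (yz)³, the product is dominated by terms involving
two variables each, with the integrable exponent 3/2; shears of the plane handle those containing s₁
+ s₂. -/
theorem integrable_japanese :
    Integrable fun s : ℝ × ℝ => (1 + ‖s.1‖ ^ 2) ^ (-(1 / 2) : ℝ) * (1 + ‖s.2‖ ^ 2) ^ (-(1 / 2) : ℝ) *
      (1 + ‖s.1 + s.2‖ ^ 2) ^ (-(1 / 2) : ℝ) := by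
  set ζ : ℝ → ℝ := fun s => (1 + ‖s‖ ^ 2) ^ (-(3 / 2 : ℝ) / 2) with hζ
  have hζi : Integrable ζ := integrable_rpow_neg_one_add_norm_sq (by norm_num)
  have h12 : Integrable fun s : ℝ × ℝ => ζ s.1 * ζ s.2 := hζi.mul_prod hζi
  have h13 : Integrable fun s : ℝ × ℝ => ζ s.1 * ζ (s.1 + s.2) :=
    ((measurePreserving_prod_add (volume : Measure ℝ) volume).integrable_comp h12.1).2 h12
  have h23 : Integrable fun s : ℝ × ℝ => ζ s.2 * ζ (s.2 + s.1) :=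
    ((measurePreserving_prod_add_swap (volume : Measure ℝ) volume).integrable_comp h12.1).2 h12
  refine ((h12.add h13).add h23).mono' ?_ ?_
  · refine Measurable.aestronglyMeasurable ?_
    fun_prop
  · filter_upwards with s
    have key : ∀ s : ℝ, (1 + ‖s‖ ^ 2) ^ (-(1 / 2) : ℝ) = ((1 + ‖s‖ ^ 2) ^ (-(1 / 4) : ℝ)) ^ 2 := by
      intro s
      rw [← Real.rpow_natCast ((1 + ‖s‖ ^ 2) ^ (-(1 / 4) : ℝ)), ← Real.rpow_mul (by positivity)]
      norm_num
    have key' : ∀ s : ℝ, ζ s = ((1 + ‖s‖ ^ 2) ^ (-(1 / 4) : ℝ)) ^ 3 := by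
      intro s
      rw [hζ, ← Real.rpow_natCast ((1 + ‖s‖ ^ 2) ^ (-(1 / 4) : ℝ)), ← Real.rpow_mul (by positivity)]
      norm_num
    simp only [Pi.add_apply, key, key', add_comm s.2 s.1]
    have p1 : 0 ≤ (1 + ‖s.1‖ ^ 2) ^ (-(1 / 4) : ℝ) := by positivity
    have p2 : 0 ≤ (1 + ‖s.2‖ ^ 2) ^ (-(1 / 4) : ℝ) := by positivity
    have p3 : 0 ≤ (1 + ‖s.1 + s.2‖ ^ 2) ^ (-(1 / 4) : ℝ) := by positivity
    generalize (1 + ‖s.1‖ ^ 2) ^ (-(1 / 4) : ℝ) = x at *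
    generalize (1 + ‖s.2‖ ^ 2) ^ (-(1 / 4) : ℝ) = y at *
    generalize (1 + ‖s.1 + s.2‖ ^ 2) ^ (-(1 / 4) : ℝ) = z at *
    rw [Real.norm_of_nonneg (by positivity)]
    have amgm : ∀ a b c : ℝ, 0 ≤ a → 0 ≤ b → 0 ≤ c → a * b * c ≤ a ^ 3 + b ^ 3 + c ^ 3 := by
      intro a b c ha hb hc
      nlinarith [mul_nonneg (add_nonneg (add_nonneg ha hb) hc) (add_nonneg (add_nonneg
        (sq_nonneg (a - b)) (sq_nonneg (b - c))) (sq_nonneg (a - c))),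
        mul_nonneg (mul_nonneg ha hb) hc]
    calc x ^ 2 * y ^ 2 * z ^ 2 = (x * y) * (x * z) * (y * z) := by ring
      _ ≤ (x * y) ^ 3 + (x * z) ^ 3 + (y * z) ^ 3 := amgm _ _ _ (by positivity) (by positivity)
        (by positivity)
      _ = _ := by ring

/-- Integrability on `L × L` of a function decaying like `1 / (|t₁| |t₂| |t₁ + t₂|)`. -/
theorem integrable_of_decay {b : ℝ} (hb : 0 < b) {Φ : ℝ × ℝ → ℂ} (hm : AEStronglyMeasurable Φ)
    {C : ℝ} (h : ∀ s : ℝ × ℝ, ‖Φ s‖ * (‖(s.1 : ℂ) + b * Complex.I‖ * ‖(s.2 : ℂ) + b * Complex.I‖ *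
      ‖((s.1 : ℂ) + b * Complex.I) + (s.2 + b * Complex.I)‖) ≤ C) : Integrable Φ := by
  obtain ⟨c, hc, h1⟩ := le_norm_add_mul_I hb
  obtain ⟨c', hc', h2⟩ := le_norm_add_mul_I (mul_pos two_pos hb)
  refine (integrable_japanese.const_mul (C / (c * c * c'))).mono' hm ?_
  filter_upwards with s
  have e : ((s.1 : ℂ) + b * Complex.I) + (s.2 + b * Complex.I) =
      ((s.1 + s.2 : ℝ) : ℂ) + ((2 * b : ℝ) : ℂ) * Complex.I := by
    push_cast; ring
  have h0 := h s
  rw [e] at h0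
  have a1 := h1 s.1
  have a2 := h1 s.2
  have a3 := h2 (s.1 + s.2)
  have inv : ∀ s : ℝ, (1 + ‖s‖ ^ 2) ^ (-(1 / 2) : ℝ) = ((1 + ‖s‖ ^ 2) ^ (1 / 2 : ℝ))⁻¹ := fun s =>
    Real.rpow_neg (by positivity) _
  simp only [inv]
  have p1 : 0 < (1 + ‖s.1‖ ^ 2) ^ (1 / 2 : ℝ) := by positivity
  have p2 : 0 < (1 + ‖s.2‖ ^ 2) ^ (1 / 2 : ℝ) := by positivity
  have p3 : 0 < (1 + ‖s.1 + s.2‖ ^ 2) ^ (1 / 2 : ℝ) := by positivity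
  generalize (1 + ‖s.1‖ ^ 2) ^ (1 / 2 : ℝ) = x at *
  generalize (1 + ‖s.2‖ ^ 2) ^ (1 / 2 : ℝ) = y at *
  generalize (1 + ‖s.1 + s.2‖ ^ 2) ^ (1 / 2 : ℝ) = z at *
  have h3 : ‖Φ s‖ * ((c * x) * (c * y) * (c' * z)) ≤ C := by
    refine le_trans ?_ h0
    gcongr
  have h4 : C / (c * c * c') * (x⁻¹ * y⁻¹ * z⁻¹) = C / ((c * x) * (c * y) * (c' * z)) := by
    field_simp
  rw [h4, le_div_iff₀ (by positivity)]
  exact h3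

end Decay

/-! ### Bounds for quadratic means, and changes of variables -/

section QuadMeanBound

variable {n : ℕ}

/-- In λ - t₁t₂ = (λ/t₂ - t₁) t₂ both factors have imaginary part at least b in modulus, so |λ -
t₁t₂| ≥ b². This lower bound and the triangle inequality give the comparison. -/
theorem norm_mul_le_norm_sub {lam b : ℝ} (hlam : 0 ≤ lam) (hb : 0 < b) {t₁ t₂ : ℂ}
    (h₁ : t₁.im = b) (h₂ : t₂.im = b) :
    ‖t₁ * t₂‖ ≤ (1 + lam / b ^ 2) * ‖(lam : ℂ) - t₁ * t₂‖ := by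
  have ht₂ : t₂ ≠ 0 := fun h => by rw [h] at h₂; simp at h₂; linarith
  have hb2 : b ≤ ‖t₂‖ := by
    rw [← h₂]; exact (le_abs_self _).trans (Complex.abs_im_le_norm _)
  have h3 : b ≤ ‖(lam : ℂ) / t₂ - t₁‖ := by
    have h4 : ((lam : ℂ) / t₂ - t₁).im = -(lam * b / Complex.normSq t₂ + b) := by
      rw [Complex.sub_im, Complex.div_im, h₁, h₂]
      simp
      ring
    refine le_trans ?_ (Complex.abs_im_le_norm _)
    rw [h4, abs_neg]
    refine le_trans ?_ (le_abs_self _)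
    have : 0 ≤ lam * b / Complex.normSq t₂ :=
      div_nonneg (mul_nonneg hlam hb.le) (Complex.normSq_nonneg _)
    linarith
  have h5 : b ^ 2 ≤ ‖(lam : ℂ) - t₁ * t₂‖ := by
    have : (lam : ℂ) - t₁ * t₂ = ((lam : ℂ) / t₂ - t₁) * t₂ := by
      field_simp
    rw [this, norm_mul, pow_two]
    exact mul_le_mul h3 hb2 hb.le (norm_nonneg _)
  have h6 : ‖t₁ * t₂‖ ≤ ‖(lam : ℂ) - t₁ * t₂‖ + lam := by
    have := norm_sub_norm_le (t₁ * t₂) (lam : ℂ)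
    rw [norm_sub_rev, Complex.norm_real, Real.norm_of_nonneg hlam] at this
    linarith
  have h7 : lam ≤ lam / b ^ 2 * ‖(lam : ℂ) - t₁ * t₂‖ := by
    rw [div_mul_eq_mul_div, le_div_iff₀ (by positivity)]
    exact mul_le_mul_of_nonneg_left h5 hlam
  linarith

/-- With w = t₁t₂ and mₖ = (λₖ - w)⁻¹, both mₖ and w mₖ stay bounded. After multiplication by w, the
quotient is a polynomial in these: the added w is absorbed by one factor m of the inverse
determinant, which exists as n ≥ 1, and each w in the mean by one of its sums. Compactness then
gives the constant. -/
theorem exists_quadMean_bound (hn : n ≠ 0) (a : Matrix (Fin n) (Fin n) ℂ) {q : ℝ} (hq : 0 < q)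
    (δ : ℂ) {b : ℝ} (hb : 0 < b) :
    ∃ C, ∀ t₁ t₂ : ℂ, t₁.im = b → t₂.im = b →
      ‖quadMean (a * aᴴ) q (t₁ * t₂) δ / (a * aᴴ + Matrix.scalar (Fin n) (-(t₁ * t₂))).det‖ *
        (‖t₁‖ * ‖t₂‖) ≤ C := by
  obtain ⟨U, lam, hU, hlam, hd⟩ := exists_diagonalization a
  set D : ℝ := 1 + (∑ k, lam k) / b ^ 2 with hD
  have hD1 : 0 ≤ D := by
    have : 0 ≤ ∑ k, lam k := Finset.sum_nonneg fun k _ => hlam k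
    positivity
  set g : Fin n → ℂ := fun k => ((lam k : ℂ) + q)⁻¹
  set i₀ : Fin n := ⟨0, Nat.pos_of_ne_zero hn⟩
  set F : (Fin n → ℂ) × (Fin n → ℂ) → ℂ := fun x =>
    ((1 - δ * ∑ k, x.1 k + q * δ * ∑ k, g k * x.1 k) ^ 2
      + q * δ ^ 2 * ((∑ k, g k * x.2 k) * ∑ k, g k * x.1 k)
      + q * δ ^ 2 * (∑ k, g k * x.1 k ^ 2 - q * ∑ k, g k ^ 2 * x.1 k ^ 2)
      + δ ^ 2 * (∑ k, g k * x.1 k * x.2 k - q * ∑ k, g k ^ 2 * x.1 k * x.2 k))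
      * (x.2 i₀ * ∏ k ∈ Finset.univ.erase i₀, x.1 k) with hF
  have hFc : Continuous F := by
    rw [hF]; fun_prop
  obtain ⟨C, hC⟩ := ((isCompact_closedBall (0 : Fin n → ℂ) (D / b ^ 2)).prod
    (isCompact_closedBall (0 : Fin n → ℂ) D)).exists_bound_of_continuousOn hFc.continuousOn
  refine ⟨C, fun t₁ t₂ h₁ h₂ => ?_⟩
  set w := t₁ * t₂ with hw
  have hbt : b ^ 2 ≤ ‖w‖ := by
    rw [hw, norm_mul, pow_two]
    refine mul_le_mul ?_ ?_ hb.le (norm_nonneg _)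
    · rw [← h₁]; exact (le_abs_self _).trans (Complex.abs_im_le_norm _)
    · rw [← h₂]; exact (le_abs_self _).trans (Complex.abs_im_le_norm _)
  have hle : ∀ k, ‖w‖ ≤ D * ‖(lam k : ℂ) - w‖ := by
    intro k
    refine (norm_mul_le_norm_sub (hlam k) hb h₁ h₂).trans ?_
    refine mul_le_mul_of_nonneg_right ?_ (norm_nonneg _)
    rw [hD]
    have : lam k ≤ ∑ k, lam k := Finset.single_le_sum (fun k _ => hlam k) (Finset.mem_univ k)
    gcongr
  have hwpos : 0 < ‖w‖ := lt_of_lt_of_le (by positivity) hbt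
  have hne : ∀ k, (lam k : ℂ) - w ≠ 0 := by
    intro k h
    have := hle k
    rw [h, norm_zero, mul_zero] at this
    linarith
  have hqne : ∀ k, (lam k : ℂ) + (q : ℂ) ≠ 0 := fun k => by
    have := hlam k
    exact_mod_cast (by positivity : lam k + q ≠ 0)
  set m : Fin n → ℂ := fun k => ((lam k : ℂ) - w)⁻¹ with hm
  have hwm : ∀ k, ‖w * m k‖ ≤ D := by
    intro k
    rw [hm, norm_mul, norm_inv, ← div_eq_mul_inv, div_le_iff₀ (norm_pos_iff.2 (hne k))]
    exact hle k
  have hmb : ∀ k, ‖m k‖ ≤ D / b ^ 2 := by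
    intro k
    have := hwm k
    rw [norm_mul] at this
    rw [le_div_iff₀ (by positivity)]
    nlinarith [norm_nonneg (m k)]
  have hdet : (a * aᴴ + Matrix.scalar (Fin n) (-w)).det = ∏ k, ((lam k : ℂ) - w) := by
    rw [← det_conj_add_scalar hU, hd, Matrix.scalar_apply, Matrix.diagonal_add,
      Matrix.det_diagonal]
    simp only [sub_eq_add_neg]
  have hx : (m, w • m) ∈ Metric.closedBall (0 : Fin n → ℂ) (D / b ^ 2) ×ˢ
      Metric.closedBall (0 : Fin n → ℂ) D := by
    refine ⟨?_, ?_⟩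
    · rw [mem_closedBall_zero_iff, pi_norm_le_iff_of_nonneg (by positivity)]
      exact hmb
    · rw [mem_closedBall_zero_iff, pi_norm_le_iff_of_nonneg hD1]
      exact hwm
  have h := hC _ hx
  refine le_trans (le_of_eq ?_) h
  rw [← norm_mul, ← hw, ← norm_mul]
  congr 1
  rw [← quadMean_conj hU, hd, quadMean_diagonal δ hqne hne, hdet]
  simp only [hF, Pi.smul_apply, smul_eq_mul]
  have hprod : (∏ k, ((lam k : ℂ) - w))⁻¹ = m i₀ * ∏ k ∈ Finset.univ.erase i₀, m k := by
    rw [Finset.mul_prod_erase _ _ (Finset.mem_univ i₀), ← Finset.prod_inv_distrib]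
  rw [div_eq_mul_inv, hprod]
  have s1 : ∑ k, g k * (w * m k) = w * ∑ k, g k * m k := by
    rw [Finset.mul_sum]; exact Finset.sum_congr rfl fun k _ => by ring
  have s2 : ∑ k, g k * m k * (w * m k) = w * ∑ k, g k * m k ^ 2 := by
    rw [Finset.mul_sum]; exact Finset.sum_congr rfl fun k _ => by ring
  have s3 : ∑ k, g k ^ 2 * m k * (w * m k) = w * ∑ k, g k ^ 2 * m k ^ 2 := by
    rw [Finset.mul_sum]; exact Finset.sum_congr rfl fun k _ => by ring
  rw [s1, s2, s3]
  ring

end QuadMeanBound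

/-! ### Exponential weights on the quadrant and the substitution y = N r² -/

section RadialIntegrals

theorem PolyGrowth.comp_real {E : Type*} [NormedAddCommGroup E] {f : ℝ → ℂ} (hf : PolyGrowth f)
    {φ : E → ℝ} (hφ : PolyGrowth fun x => (φ x : ℂ)) : PolyGrowth fun x => f (φ x) := by
  obtain ⟨C, N, hC, hb⟩ := hf.exists_bound
  obtain ⟨C', N', hC', hb'⟩ := hφ.exists_bound
  have hc : Continuous φ := by
    have := Complex.continuous_re.comp hφ.1
    simpa [Function.comp_def] using this
  refine ⟨hf.1.comp hc, C * (1 + C') ^ N, N' * N, fun x => (hb _).trans ?_⟩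
  have h1 := hb' x
  rw [Complex.norm_real] at h1
  have h2 : 1 ≤ (1 + ‖x‖) ^ N' := one_le_pow₀ (by linarith [norm_nonneg x])
  rw [mul_assoc, pow_mul, ← mul_pow]
  refine mul_le_mul_of_nonneg_left (pow_le_pow_left₀ (by positivity) ?_ _) hC
  nlinarith

theorem rapidWeight_exp {b : ℝ} (hb : 0 < b) :
    RapidWeight (volume.restrict (Ioi (0 : ℝ))) fun y => Real.exp (-b * y) := by
  refine ⟨by fun_prop, fun y => (Real.exp_pos _).le, fun N => ?_⟩
  have hb' : 0 < (b : ℂ).re := by simpa using hb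
  have h1 : ∀ j : ℕ, IntegrableOn (fun y : ℝ => ‖y‖ ^ j * Real.exp (-b * y)) (Ioi 0) := by
    intro j
    refine (integrableOn_pow_mul_cexp_neg_mul_Ioi hb' j).norm.congr ?_
    filter_upwards with y
    rw [norm_mul, norm_pow, Complex.norm_real, Complex.norm_exp]
    congr 2
    simp
  have h2 : (fun y : ℝ => (1 + ‖y‖) ^ N * Real.exp (-b * y)) = fun y =>
      ∑ j ∈ Finset.range (N + 1), (N.choose j : ℝ) * (‖y‖ ^ j * Real.exp (-b * y)) := by
    funext y
    rw [add_comm, add_pow, Finset.sum_mul]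
    exact Finset.sum_congr rfl fun j _ => by ring
  rw [h2]
  exact integrable_finsetSum _ fun j _ => (h1 j).const_mul _

theorem rapidWeight_exp_prod {b : ℝ} (hb : 0 < b) :
    RapidWeight (volume.restrict (Ioi (0 : ℝ) ×ˢ Ioi (0 : ℝ))) fun y : ℝ × ℝ =>
      Real.exp (-b * y.1) * Real.exp (-b * y.2) := by
  rw [Measure.volume_eq_prod, ← Measure.prod_restrict]
  exact (rapidWeight_exp hb).prod (rapidWeight_exp hb)

theorem polyGrowth_mul : PolyGrowth fun y : ℝ × ℝ => ((y.1 * y.2 : ℝ) : ℂ) := by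
  push_cast
  exact polyGrowth_ofReal.comp_fst.mul polyGrowth_ofReal.comp_snd

theorem integral_comp_mul_sq_Ioi {N : ℝ} (hN : 0 < N) (g : ℝ → ℂ) :
    ∫ y : ℝ in Ioi 0, (y : ℂ) * g (N * y ^ 2) = (1 / (2 * N)) * ∫ x : ℝ in Ioi 0, g x := by
  have h := integral_comp_sq_Ioi fun x => g (N * x)
  rw [h, integral_comp_mul_left_Ioi g 0 hN, mul_zero, Complex.real_smul]
  push_cast
  field_simp

theorem integral_comp_mul_sq_Ioi_prod {N : ℝ} (hN : 0 < N) {h : ℝ × ℝ → ℂ}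
    (hi : IntegrableOn h (Ioi (0 : ℝ) ×ˢ Ioi (0 : ℝ)))
    (hi' : IntegrableOn (fun r : ℝ × ℝ => (r.1 * r.2 : ℂ) * h (N * r.1 ^ 2, N * r.2 ^ 2))
      (Ioi (0 : ℝ) ×ˢ Ioi (0 : ℝ))) :
    ∫ r in Ioi (0 : ℝ) ×ˢ Ioi (0 : ℝ), (r.1 * r.2 : ℂ) * h (N * r.1 ^ 2, N * r.2 ^ 2) =
      1 / (4 * N ^ 2) * ∫ y in Ioi (0 : ℝ) ×ˢ Ioi (0 : ℝ), h y := by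
  rw [Measure.volume_eq_prod] at hi hi' ⊢
  rw [setIntegral_prod _ hi, setIntegral_prod _ hi']
  simp only [mul_assoc, integral_const_mul]
  have h1 : ∀ x : ℝ, ∫ y : ℝ in Ioi 0, (y : ℂ) * h (N * x ^ 2, N * y ^ 2) =
      (1 / (2 * N)) * ∫ y : ℝ in Ioi 0, h (N * x ^ 2, y) := fun x =>
    integral_comp_mul_sq_Ioi hN fun y => h (N * x ^ 2, y)
  simp only [h1]
  rw [integral_comp_mul_sq_Ioi hN fun x => (1 / (2 * N)) * ∫ y : ℝ in Ioi 0, h (x, y),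
    integral_const_mul, ← mul_assoc]
  congr 1
  ring

end RadialIntegrals

/-! ### From the contour integral to an integral over vectors -/

section Core

variable {n : ℕ}

theorem quadFactor_smul (a G : Matrix (Fin n) (Fin n) ℂ) (δ : ℂ) (c : ℝ) (x y : Fin n → ℂ) :
    quadFactor a G δ (c • x, y) = quadFactor a G δ (x, c • y) := by
  have hc : ∀ v : Fin n → ℂ, c • v = (c : ℂ) • v := fun v => by
    funext i; simp
  simp only [quadFactor, hc, sesq_smul_left, sesq_smul_right, Complex.conj_ofReal]
  ring

theorem osc_smul (a : Matrix (Fin n) (Fin n) ℂ) (c : ℝ) (x y : Fin n → ℂ) :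
    osc a (c • x, y) = osc a (x, c • y) := by
  have hc : ∀ v : Fin n → ℂ, c • v = (c : ℂ) • v := fun v => by
    funext i; simp
  simp only [osc, hc, sesq_smul_left, sesq_smul_right, Complex.conj_ofReal]

/-- The radial density, cut off to the positive quadrant and damped. -/
noncomputable def dampedDensity (J : ℝ → ℂ) (b : ℝ) : ℝ × ℝ → ℂ :=
  (Ioi (0 : ℝ) ×ˢ Ioi (0 : ℝ)).indicator fun y =>
    J (y.1 * y.2) * (Real.exp (-b * y.1) * Real.exp (-b * y.2) : ℝ)

theorem measurable_dampedDensity {J : ℝ → ℂ} (hJ : Continuous J) (b : ℝ) :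
    Measurable (dampedDensity J b) := by
  refine Measurable.indicator ?_ (measurableSet_Ioi.prod measurableSet_Ioi)
  exact Continuous.measurable (by fun_prop)

theorem integrable_dampedDensity {J : ℝ → ℂ} (hJ : PolyGrowth J) {b : ℝ} (hb : 0 < b) :
    Integrable (dampedDensity J b) :=
  (integrable_indicator_iff (measurableSet_Ioi.prod measurableSet_Ioi)).2
    ((rapidWeight_exp_prod hb).integrable_mul (hJ.comp_real polyGrowth_mul))

/-- On the quadrant 1 + y₁y₂ ≤ (1 + y₁ + y₂)², and this power is beaten by exp (b (1 + y₁ + y₂));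
the 1 in that exponent accounts for the constant `Real.exp b`. -/
theorem exists_dampedDensity_bound {J : ℝ → ℂ} (hJ : PolyGrowth J) {b : ℝ} (hb : 0 < b) :
    ∃ C, ∀ y, ‖dampedDensity J b y‖ ≤ C := by
  obtain ⟨C, N, hC, hbd⟩ := hJ.exists_bound
  refine ⟨C * ((2 * N).factorial / b ^ (2 * N) * Real.exp b), fun y => ?_⟩
  by_cases hy : y ∈ Ioi (0 : ℝ) ×ˢ Ioi (0 : ℝ)
  · have hy1 : 0 < y.1 := hy.1
    have hy2 : 0 < y.2 := hy.2
    rw [dampedDensity, indicator_of_mem hy, norm_mul, Complex.norm_real,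
      Real.norm_of_nonneg (by positivity), ← Real.exp_add]
    have h1 := Real.pow_div_factorial_le_exp (b * (1 + (y.1 + y.2))) (by positivity) (2 * N)
    have h2 : (1 + (y.1 + y.2)) ^ (2 * N) ≤
        (2 * N).factorial / b ^ (2 * N) * Real.exp (b * (1 + (y.1 + y.2))) := by
      rw [mul_pow, div_le_iff₀ (by positivity)] at h1
      rw [div_mul_eq_mul_div, le_div_iff₀ (by positivity)]
      linarith
    have h3 : ‖J (y.1 * y.2)‖ ≤ C * (1 + (y.1 + y.2)) ^ (2 * N) := by
      refine (hbd _).trans ?_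
      rw [pow_mul, Real.norm_of_nonneg (by positivity)]
      refine mul_le_mul_of_nonneg_left (pow_le_pow_left₀ (by positivity) ?_ _) hC
      nlinarith
    calc ‖J (y.1 * y.2)‖ * Real.exp (-b * y.1 + -b * y.2)
        ≤ C * ((2 * N).factorial / b ^ (2 * N) * Real.exp (b * (1 + (y.1 + y.2)))) *
          Real.exp (-b * y.1 + -b * y.2) := by
          refine mul_le_mul_of_nonneg_right (h3.trans ?_) (Real.exp_pos _).le
          exact mul_le_mul_of_nonneg_left h2 hC
      _ = C * ((2 * N).factorial / b ^ (2 * N) * (Real.exp (b * (1 + (y.1 + y.2))) *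
          Real.exp (-b * y.1 + -b * y.2))) := by ring
      _ = _ := by
        rw [← Real.exp_add]
        ring_nf
  · rw [dampedDensity, indicator_of_notMem hy, norm_zero]
    positivity

theorem continuousAt_dampedDensity {J : ℝ → ℂ} (hJ : Continuous J) (b : ℝ) {y : ℝ × ℝ}
    (hy1 : 0 < y.1) (hy2 : 0 < y.2) : ContinuousAt (dampedDensity J b) y := by
  have hF : Continuous fun y : ℝ × ℝ =>
      J (y.1 * y.2) * (Real.exp (-b * y.1) * Real.exp (-b * y.2) : ℝ) := by fun_prop
  refine hF.continuousAt.congr ?_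
  have ho : IsOpen (Ioi (0 : ℝ) ×ˢ Ioi (0 : ℝ)) := isOpen_Ioi.prod isOpen_Ioi
  filter_upwards [ho.mem_nhds (show y ∈ _ from ⟨hy1, hy2⟩)] with z hz
  rw [dampedDensity, indicator_of_mem hz]

/-- A real shift of τ multiplies the kernel by a character with frequency N r₁r₂, which exhibits the
r-integral as a superposition of characters of s₁ + s₂. -/
theorem radialKernel_add (N ε : ℝ) (τ : ℂ) (σ : ℝ) (r : ℝ × ℝ) :
    radialKernel N ε (τ + σ) r =
      radialKernel N ε τ r * Complex.exp (-Complex.I * (N * (r.1 * r.2) : ℝ) * σ) := by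
  rw [radialKernel, radialKernel, ← Complex.exp_add]
  congr 1
  push_cast
  ring

/-- The factor of the `t`-integrand coming from the vectors. -/
noncomputable def resolventFactor (a : Matrix (Fin n) (Fin n) ℂ) (q δ : ℂ) (b : ℝ)
    (s : ℝ × ℝ) : ℂ :=
  quadMean (a * aᴴ) q (((s.1 : ℂ) + b * Complex.I) * (s.2 + b * Complex.I)) δ /
    (a * aᴴ + Matrix.scalar (Fin n)
      (-(((s.1 : ℂ) + b * Complex.I) * (s.2 + b * Complex.I)))).det

/-- The integral over `r` in the positive quadrant. -/
noncomputable def radialIntegral (N ε b : ℝ) (s : ℝ × ℝ) : ℂ :=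
  ∫ r in Ioi (0 : ℝ) ×ˢ Ioi (0 : ℝ), (r.1 * r.2 : ℂ) * radialKernel N ε
    (((s.1 : ℂ) + b * Complex.I) + (s.2 + b * Complex.I)) r

/-- `J` is the density of `Θ` in the variables `|φ₁|²`, `|φ₂|²`. -/
def IsRadialDensity (Θ : (Fin n → ℂ) × (Fin n → ℂ) → ℂ) (J : ℝ → ℂ) : Prop :=
  ∀ f : ℝ × ℝ → ℂ,
    Integrable (fun x : (Fin n → ℂ) × (Fin n → ℂ) => f (sqNorm x.1, sqNorm x.2) * Θ x) →
    ∫ x : (Fin n → ℂ) × (Fin n → ℂ), f (sqNorm x.1, sqNorm x.2) * Θ x =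
      ∫ y in Ioi (0 : ℝ) ×ˢ Ioi (0 : ℝ), f y * J (y.1 * y.2)

/-- Take β_j = -i t_j with t_j = s_j + ib: then Re β_j = b > 0 and β₁β₂ = -t₁t₂. The imaginary part
of the contour becomes the damping of the density, and the real parts are the Fourier variables. -/
theorem fourier₂_dampedDensity (a : Matrix (Fin n) (Fin n) ℂ) {q : ℝ} (hq : 0 < q) (δ : ℂ) {b : ℝ}
    (hb : 0 < b) {J : ℝ → ℂ} (hJ : IsRadialDensity (fun x =>
      quadFactor a ((a * aᴴ + Matrix.scalar (Fin n) (q : ℂ))⁻¹) δ x * osc a x) J) (s : ℝ × ℝ) :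
    fourier₂ (dampedDensity J b) s = (Real.pi : ℂ) ^ (2 * n) * resolventFactor a q δ b s := by
  rw [resolventFactor]
  have hre : ∀ s : ℝ, 0 < (-Complex.I * ((s : ℂ) + b * Complex.I)).re := fun s => by simpa using hb
  have h1 := integral_quadFactor a hq δ (hre s.1) (hre s.2)
  have h2 := hJ (fun y => Complex.exp (-(-Complex.I * ((s.1 : ℂ) + b * Complex.I)) * y.1 -
    -Complex.I * ((s.2 : ℂ) + b * Complex.I) * y.2))
    (integrable_quadFactor a _ δ (hre s.1) (hre s.2))
  have h3 : fourier₂ (dampedDensity J b) s = ∫ y in Ioi (0 : ℝ) ×ˢ Ioi (0 : ℝ),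
      Complex.exp (-(-Complex.I * ((s.1 : ℂ) + b * Complex.I)) * y.1 -
        -Complex.I * ((s.2 : ℂ) + b * Complex.I) * y.2) * J (y.1 * y.2) := by
    rw [fourier₂, ← integral_indicator (measurableSet_Ioi.prod measurableSet_Ioi)]
    refine integral_congr_ae (Filter.Eventually.of_forall fun y => ?_)
    simp only [dampedDensity]
    by_cases hy : y ∈ Ioi (0 : ℝ) ×ˢ Ioi (0 : ℝ)
    · rw [indicator_of_mem hy, indicator_of_mem hy, mul_comm (J _), mul_right_comm]
      congr 1
      push_cast
      rw [← Complex.exp_add, ← Complex.exp_add]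
      congr 1
      linear_combination (-b * (y.1 + y.2) : ℂ) * Complex.I_sq
    · rw [indicator_of_notMem hy, indicator_of_notMem hy, zero_mul]
  generalize (s.1 : ℂ) + b * Complex.I = t₁ at *
  generalize (s.2 : ℂ) + b * Complex.I = t₂ at *
  have e1 : -Complex.I * t₁ * (-Complex.I * t₂) = -(t₁ * t₂) := by
    linear_combination (t₁ * t₂) * Complex.I_sq
  rw [e1, neg_neg] at h1
  rw [h3, ← h2]
  refine h1.trans ?_
  ring

theorem radialIntegral_eq (N ε b : ℝ) (s : ℝ × ℝ) :
    radialIntegral N ε b s = ∫ r in Ioi (0 : ℝ) ×ˢ Ioi (0 : ℝ),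
      (r.1 * r.2 : ℂ) * radialKernel N ε (2 * b * Complex.I) r *
        Complex.exp (-Complex.I * (N * (r.1 * r.2) : ℝ) * (s.1 + s.2)) := by
  rw [radialIntegral]
  refine integral_congr_ae (Filter.Eventually.of_forall fun r => ?_)
  have : ((s.1 : ℂ) + b * Complex.I) + (s.2 + b * Complex.I) =
      2 * b * Complex.I + (s.1 + s.2 : ℝ) := by
    push_cast; ring
  simp only [this, radialKernel_add]
  push_cast
  ring

theorem stronglyMeasurable_fourier₂ {f : ℝ × ℝ → ℂ} (hf : Measurable f) :
    StronglyMeasurable (fourier₂ f) := by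
  have h : Measurable (Function.uncurry fun (s x : ℝ × ℝ) =>
      f x * Complex.exp (Complex.I * (s.1 * x.1 + s.2 * x.2))) :=
    (hf.comp measurable_snd).mul (Continuous.measurable (by fun_prop))
  exact h.stronglyMeasurable.integral_prod_right

theorem stronglyMeasurable_radialIntegral (N ε b : ℝ) :
    StronglyMeasurable (radialIntegral N ε b) := by
  have h : Continuous (Function.uncurry fun (s r : ℝ × ℝ) => (r.1 * r.2 : ℂ) * radialKernel N ε
      (((s.1 : ℂ) + b * Complex.I) + (s.2 + b * Complex.I)) r) := by
    simp only [radialKernel, Function.uncurry_def]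
    fun_prop
  exact h.stronglyMeasurable.integral_prod_right

theorem integrable_resolventFactor_mul_radialIntegral (hn : n ≠ 0) (a : Matrix (Fin n) (Fin n) ℂ)
    {q : ℝ} (hq : 0 < q) (δ : ℂ) {N ε b : ℝ} (hN : 0 < N) (hε : 0 < ε) (hb : 0 < b) {J : ℝ → ℂ}
    (hJc : Continuous J) (hJ : IsRadialDensity (fun x =>
      quadFactor a ((a * aᴴ + Matrix.scalar (Fin n) (q : ℂ))⁻¹) δ x * osc a x) J) :
    Integrable fun s => resolventFactor a q δ b s * radialIntegral N ε b s := by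
  have hpi : (Real.pi : ℂ) ^ (2 * n) ≠ 0 := by exact_mod_cast pow_ne_zero _ Real.pi_ne_zero
  have hmeas : AEStronglyMeasurable fun s => resolventFactor a q δ b s * radialIntegral N ε b s := by
    -- Measurability in s is read off from the Fourier representation of the factor.
    have m3 : (fun s => resolventFactor a q δ b s * radialIntegral N ε b s) = fun s =>
        ((Real.pi : ℂ) ^ (2 * n))⁻¹ * fourier₂ (dampedDensity J b) s * radialIntegral N ε b s := by
      funext s
      rw [fourier₂_dampedDensity a hq δ hb hJ, inv_mul_cancel_left₀ hpi]
    rw [m3]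
    exact (((stronglyMeasurable_fourier₂ (measurable_dampedDensity hJc b)).const_mul _).mul
      (stronglyMeasurable_radialIntegral N ε b)).aestronglyMeasurable
  obtain ⟨C, hC⟩ := exists_quadMean_bound hn a hq δ hb
  obtain ⟨K, hK⟩ := exists_radial_bound hN hε (2 * b)
  refine integrable_of_decay hb hmeas (C := C * K) fun s => ?_
  have ht1 : ((s.1 : ℂ) + b * Complex.I).im = b := by simp
  have ht2 : ((s.2 : ℂ) + b * Complex.I).im = b := by simp
  have h1 := hC _ _ ht1 ht2
  have h2 := hK (((s.1 : ℂ) + b * Complex.I) + (s.2 + b * Complex.I))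
    (by rw [Complex.add_im, ht1, ht2]; ring)
  rw [norm_mul, resolventFactor, radialIntegral]
  calc _ = _ := mul_mul_mul_comm _ _ _ _
    _ ≤ _ := mul_le_mul h1 (by rw [mul_comm]; exact h2) (by positivity) (le_trans (by positivity) h1)

theorem integrableOn_radial_weight {J : ℝ → ℂ} (hJ : PolyGrowth J) {N ε : ℝ} (hN : 0 < N)
    (hε : 0 < ε) :
    IntegrableOn (fun y : ℝ × ℝ => Complex.exp (-ε * y.1 - ε * y.2) *
      Complex.exp (-(N⁻¹ : ℝ) * (y.1 * y.2)) * J (y.1 * y.2)) (Ioi (0 : ℝ) ×ˢ Ioi (0 : ℝ)) := by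
  have h := (rapidWeight_exp_prod hε).integrable_mul (hJ.comp_real polyGrowth_mul)
  have h' := h.bdd_mul (c := 1) (f := fun y : ℝ × ℝ => Complex.exp (-(N⁻¹ : ℝ) * (y.1 * y.2)))
    (Continuous.aestronglyMeasurable (by fun_prop)) (by
      filter_upwards [ae_restrict_mem (measurableSet_Ioi.prod measurableSet_Ioi)] with y hy
      have hy1 : 0 < y.1 := hy.1
      have hy2 : 0 < y.2 := hy.2
      rw [Complex.norm_exp]
      have : (-(N⁻¹ : ℝ) * (y.1 * y.2) : ℂ).re = -(N⁻¹ * (y.1 * y.2)) := by norm_cast; ring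
      rw [this, Real.exp_le_one_iff, neg_nonpos]
      positivity)
  refine h'.congr (Filter.Eventually.of_forall fun y => ?_)
  simp only
  have : ((Real.exp (-ε * y.1) * Real.exp (-ε * y.2) : ℝ) : ℂ) =
      Complex.exp (-ε * y.1 - ε * y.2) := by
    push_cast
    rw [← Complex.exp_add]
    ring_nf
  rw [this]
  ring

theorem radial_weight_comp_sq (J : ℝ → ℂ) {N : ℝ} (hN : 0 < N) (ε : ℝ) (r : ℝ × ℝ) :
    Complex.exp (-ε * (N * r.1 ^ 2 : ℝ) - ε * (N * r.2 ^ 2 : ℝ)) *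
      Complex.exp (-(N⁻¹ : ℝ) * ((N * r.1 ^ 2 : ℝ) * (N * r.2 ^ 2 : ℝ))) *
        J (N * r.1 ^ 2 * (N * r.2 ^ 2)) =
      radialKernel N ε 0 r * J (N * (r.1 * r.2) * (N * (r.1 * r.2))) := by
  have e1 : N * r.1 ^ 2 * (N * r.2 ^ 2) = N * (r.1 * r.2) * (N * (r.1 * r.2)) := by ring
  have hNc : (N : ℂ) ≠ 0 := by exact_mod_cast hN.ne'
  rw [e1, radialKernel, ← Complex.exp_add]
  congr 2
  push_cast
  field_simp
  ring

/-- At (k, k) with k = N r₁r₂ the damping is exp (-2bk), while the kernel at τ = 2ib carries exp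
(2bk). They cancel, which makes the result independent of the height b of the contour. -/
theorem mul_dampedDensity_diagonal (J : ℝ → ℂ) {N b : ℝ} (hN : 0 < N) (ε : ℝ) {r : ℝ × ℝ}
    (hr : r ∈ Ioi (0 : ℝ) ×ˢ Ioi (0 : ℝ)) :
    radialKernel N ε (2 * b * Complex.I) r *
      dampedDensity J b (N * (r.1 * r.2), N * (r.1 * r.2)) =
      radialKernel N ε 0 r * J (N * (r.1 * r.2) * (N * (r.1 * r.2))) := by
  have h1 : 0 < r.1 := hr.1
  have h2 : 0 < r.2 := hr.2
  have hk0 : 0 < N * (r.1 * r.2) := by positivity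
  have hmem : (N * (r.1 * r.2), N * (r.1 * r.2)) ∈ Ioi (0 : ℝ) ×ˢ Ioi (0 : ℝ) := ⟨hk0, hk0⟩
  rw [dampedDensity, indicator_of_mem hmem, mul_comm (J _), ← mul_assoc]
  congr 1
  simp only [radialKernel]
  push_cast
  rw [← Complex.exp_add, ← Complex.exp_add]
  congr 1
  linear_combination (-2 * b * N * r.1 * r.2 : ℂ) * Complex.I_sq

/-- For fixed `q = |u|²`, the `(r, t)`-integral is an integral over a pair of vectors. -/
theorem integral_resolventFactor_mul_radialIntegral (hn : n ≠ 0) (a : Matrix (Fin n) (Fin n) ℂ)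
    {q : ℝ} (hq : 0 < q) (δ : ℂ) {N ε b : ℝ} (hN : 0 < N) (hε : 0 < ε) (hb : 0 < b) :
    Integrable (fun s => resolventFactor a q δ b s * radialIntegral N ε b s) ∧
    ∫ s, resolventFactor a q δ b s * radialIntegral N ε b s =
      ((Real.pi : ℂ) ^ (2 * n))⁻¹ * (Real.pi ^ 2 / N ^ 2) *
      ∫ x : (Fin n → ℂ) × (Fin n → ℂ), Complex.exp (-ε * sqNorm x.1 - ε * sqNorm x.2) *
        Complex.exp (-(N⁻¹ : ℝ) * (sqNorm x.1 * sqNorm x.2)) *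
        (quadFactor a ((a * aᴴ + Matrix.scalar (Fin n) (q : ℂ))⁻¹) δ x * osc a x) := by
  set Θ : (Fin n → ℂ) × (Fin n → ℂ) → ℂ := fun x =>
    quadFactor a ((a * aᴴ + Matrix.scalar (Fin n) (q : ℂ))⁻¹) δ x * osc a x with hΘ
  have hΘp : PolyGrowth Θ := (PolyGrowth.quadFactor a _ δ).mul (.osc a)
  obtain ⟨J, hJ, hJΘ⟩ := exists_radial_density hn hΘp fun c x y => by
    simp only [hΘ, quadFactor_smul, osc_smul]
  have hQm : MeasurableSet (Ioi (0 : ℝ) ×ˢ Ioi (0 : ℝ)) := measurableSet_Ioi.prod measurableSet_Ioi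
  have hpi : (Real.pi : ℂ) ^ (2 * n) ≠ 0 := by exact_mod_cast pow_ne_zero _ Real.pi_ne_zero
  have hint := integrable_resolventFactor_mul_radialIntegral hn a hq δ hN hε hb hJ.1 hJΘ
  refine ⟨hint, ?_⟩
  have hfour := fourier₂_dampedDensity a hq δ hb hJΘ
  have hP : PolyGrowth fun r : ℝ × ℝ => (r.1 * r.2 : ℂ) :=
    polyGrowth_ofReal.comp_fst.mul polyGrowth_ofReal.comp_snd
  have hwi := integrable_mul_radialKernel hN hε (2 * b * Complex.I) hP
  obtain ⟨C, hC⟩ := exists_dampedDensity_bound hJ hb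
  have hcore := integral_fourier₂_mul (m := volume.restrict (Ioi (0 : ℝ) ×ˢ Ioi (0 : ℝ)))
    (measurable_dampedDensity hJ.1 b) (integrable_dampedDensity hJ hb) hC hwi.integrableOn
    (k := fun r => N * (r.1 * r.2)) (by fun_prop) (by
      filter_upwards [ae_restrict_mem hQm] with r hr
      have h1 : 0 < r.1 := hr.1
      have h2 : 0 < r.2 := hr.2
      exact continuousAt_dampedDensity hJ.1 b (by positivity) (by positivity))
    (by
      refine (hint.const_mul ((Real.pi : ℂ) ^ (2 * n))).congr
        (Filter.Eventually.of_forall fun s => ?_)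
      simp only [hfour, ← radialIntegral_eq]
      ring)
  simp only [hfour, ← radialIntegral_eq, mul_assoc ((Real.pi : ℂ) ^ (2 * n))] at hcore
  rw [integral_const_mul] at hcore
  rw [mul_assoc, eq_inv_mul_iff_mul_eq₀ hpi, hcore]
  have hi1 := integrableOn_radial_weight hJ hN hε
  have hi2 : IntegrableOn (fun r : ℝ × ℝ => (r.1 * r.2 : ℂ) *
      (fun y : ℝ × ℝ => Complex.exp (-ε * y.1 - ε * y.2) *
      Complex.exp (-(N⁻¹ : ℝ) * (y.1 * y.2)) * J (y.1 * y.2)) (N * r.1 ^ 2, N * r.2 ^ 2))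
      (Ioi (0 : ℝ) ×ˢ Ioi (0 : ℝ)) := by
    have hP2 : PolyGrowth fun r : ℝ × ℝ => J (N * (r.1 * r.2) * (N * (r.1 * r.2))) := by
      refine hJ.comp_real (φ := fun r : ℝ × ℝ => N * (r.1 * r.2) * (N * (r.1 * r.2))) ?_
      push_cast
      exact ((PolyGrowth.const _).mul hP).mul ((PolyGrowth.const _).mul hP)
    refine (integrable_mul_radialKernel hN hε 0 (hP.mul hP2)).integrableOn.congr
      (Filter.Eventually.of_forall fun r => ?_)
    simp only [radial_weight_comp_sq J hN]
    ring
  -- Since J sees only the product of its two variables, (k, k) may be exchanged for (N r₁², N r₂²),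
  -- which undoes the substitution y_j = N r_j². Its Jacobian 1/(4N²) and the (2π)² of Fourier
  -- inversion combine to π²/N².
  have hsub := integral_comp_mul_sq_Ioi_prod hN hi1 hi2
  have hr : ∀ r ∈ Ioi (0 : ℝ) ×ˢ Ioi (0 : ℝ),
      (r.1 * r.2 : ℂ) * radialKernel N ε (2 * b * Complex.I) r *
        dampedDensity J b (N * (r.1 * r.2), N * (r.1 * r.2)) =
      (r.1 * r.2 : ℂ) * (fun y : ℝ × ℝ => Complex.exp (-ε * y.1 - ε * y.2) *
      Complex.exp (-(N⁻¹ : ℝ) * (y.1 * y.2)) * J (y.1 * y.2)) (N * r.1 ^ 2, N * r.2 ^ 2) := by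
    intro r hr
    simp only [radial_weight_comp_sq J hN]
    rw [mul_assoc, mul_dampedDensity_diagonal J hN ε hr]
  rw [setIntegral_congr_fun hQm hr, hsub]
  have hfin := hJΘ (fun y => Complex.exp (-ε * y.1 - ε * y.2) *
    Complex.exp (-(N⁻¹ : ℝ) * (y.1 * y.2))) (by
      have hε' : 0 < (ε : ℂ).re := by simpa using hε
      refine (integrable_polyGrowth_mul_cexp hε' hε' ((PolyGrowth.exp_sqNorm_mul
        (inv_nonneg.2 hN.le)).mul hΘp)).congr (Filter.Eventually.of_forall fun x => ?_)
      simp only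
      ring)
  simp only at hfin
  rw [hfin]
  ring

end Core

/-! ### The representation for a deterministic matrix -/

section Deterministic

variable {n : ℕ}

theorem φ_eq_quadMean (A : Matrix (Fin n) (Fin n) ℂ) (z : ℂ) (u₁ u₂ : ℝ) (t₁ t₂ : ℂ) :
    φ A z u₁ u₂ t₁ t₂ = quadMean (Y₀ A z) ((u₁ : ℂ) ^ 2 + (u₂ : ℂ) ^ 2) (t₁ * t₂) (n : ℂ)⁻¹ := by
  simp only [φ, quadMean, G]
  ring

/-- The branch of the logarithm disappears in the exponential, but a vanishing determinant has to be
excluded because log 0 = 0. -/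
theorem exp_mul_Ln (hn : n ≠ 0) {A : Matrix (Fin n) (Fin n) ℂ} {z x : ℂ}
    (h : (Y₀ A z + Matrix.scalar (Fin n) x).det ≠ 0) :
    Complex.exp (n * Ln A z x) = (Y₀ A z + Matrix.scalar (Fin n) x).det := by
  rw [Ln, mul_inv_cancel_left₀ (Nat.cast_ne_zero.2 hn), Complex.exp_log h]

theorem det_Y₀_add_ne_zero (A : Matrix (Fin n) (Fin n) ℂ) (z : ℂ) {q : ℝ} (hq : 0 < q) :
    (Y₀ A z + Matrix.scalar (Fin n) (q : ℂ)).det ≠ 0 := by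
  have h := det_add_scalar_ne_zero (A - Matrix.scalar (Fin n) z) (β₁ := (q : ℂ)) (β₂ := 1)
    (by simpa using hq) (by simp)
  rwa [mul_one] at h

theorem det_Y₀_sub_ne_zero (A : Matrix (Fin n) (Fin n) ℂ) (z : ℂ) {t₁ t₂ : ℂ} (h₁ : 0 < t₁.im)
    (h₂ : 0 < t₂.im) : (Y₀ A z + Matrix.scalar (Fin n) (-(t₁ * t₂))).det ≠ 0 := by
  have h := det_add_scalar_ne_zero (A - Matrix.scalar (Fin n) z) (β₁ := -Complex.I * t₁)
    (β₂ := -Complex.I * t₂) (by simpa using h₁) (by simpa using h₂)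
  rwa [show -Complex.I * t₁ * (-Complex.I * t₂) = -(t₁ * t₂) by
    linear_combination (t₁ * t₂) * Complex.I_sq] at h

theorem exp_mul_F₁ (hn : n ≠ 0) (A : Matrix (Fin n) (Fin n) ℂ) (z : ℂ) (ε : ℝ) {u₁ u₂ : ℝ}
    (hu : 0 < u₁ ^ 2 + u₂ ^ 2) :
    Complex.exp (n * F₁ A z ε u₁ u₂) =
      (Y₀ A z + Matrix.scalar (Fin n) ((u₁ : ℂ) ^ 2 + (u₂ : ℂ) ^ 2)).det *
        Complex.exp (-(n : ℂ) * (((u₁ : ℂ) + ε) ^ 2 + (u₂ : ℂ) ^ 2)) := by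
  have h := det_Y₀_add_ne_zero A z hu
  push_cast at h
  rw [F₁, ← exp_mul_Ln hn h, ← Complex.exp_add]
  congr 1
  ring

theorem exp_mul_F₂ (hn : n ≠ 0) (A : Matrix (Fin n) (Fin n) ℂ) (z : ℂ) (ε : ℝ) {t₁ t₂ : ℂ}
    (h₁ : 0 < t₁.im) (h₂ : 0 < t₂.im) (r : ℝ × ℝ) :
    Complex.exp (n * F₂ A z ε t₁ t₂ r.1 r.2) =
      (Y₀ A z + Matrix.scalar (Fin n) (-(t₁ * t₂))).det⁻¹ * radialKernel n ε (t₁ + t₂) r := by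
  rw [F₂, ← exp_mul_Ln hn (det_Y₀_sub_ne_zero A z h₁ h₂), ← Complex.exp_neg, radialKernel,
    ← Complex.exp_add]
  congr 1
  push_cast
  ring

/-- The part of the integrand that depends on `u` alone. -/
noncomputable def outerWeight (A : Matrix (Fin n) (Fin n) ℂ) (z : ℂ) (ε : ℝ) (u : ℝ × ℝ) : ℂ :=
  ((u.1 : ℂ) + ε) * ((Y₀ A z + Matrix.scalar (Fin n) ((u.1 : ℂ) ^ 2 + (u.2 : ℂ) ^ 2)).det *
    Complex.exp (-(n : ℂ) * (((u.1 : ℂ) + ε) ^ 2 + (u.2 : ℂ) ^ 2)))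

theorem sq_add_sq_pos {u : ℝ × ℝ} (hu : u ≠ 0) : 0 < u.1 ^ 2 + u.2 ^ 2 := by
  rcases eq_or_ne u.1 0 with h | h
  · have : u.2 ≠ 0 := fun h' => hu (Prod.ext h h')
    positivity
  · positivity

/-- Separates the variables into a factor in u, a factor in (u, t) and a factor in (t, r). The point
u = 0 is excluded because the determinant may vanish there. -/
theorem integrand_eq (hn : n ≠ 0) (A : Matrix (Fin n) (Fin n) ℂ) (z : ℂ) (ε : ℝ) {ε₀ : ℝ}
    (hε₀ : 0 < ε₀) {u : ℝ × ℝ} (hu : u ≠ 0) (s r : ℝ × ℝ) :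
    integrand A z ε ε₀ u s r = outerWeight A z ε u *
      resolventFactor (A - Matrix.scalar (Fin n) z) ((u.1 ^ 2 + u.2 ^ 2 : ℝ) : ℂ) (n : ℂ)⁻¹ ε₀ s *
      ((r.1 * r.2 : ℂ) * radialKernel n ε
        (((s.1 : ℂ) + ε₀ * Complex.I) + (s.2 + ε₀ * Complex.I)) r) := by
  have him : ∀ x : ℝ, 0 < ((x : ℂ) + ε₀ * Complex.I).im := fun x => by simpa using hε₀
  rw [integrand, exp_mul_F₁ hn A z ε (sq_add_sq_pos hu), exp_mul_F₂ hn A z ε (him _) (him _),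
    φ_eq_quadMean, outerWeight, resolventFactor]
  simp only [Y₀, Complex.ofReal_add, Complex.ofReal_pow]
  ring

theorem rIntegral_eq (hn : n ≠ 0) (A : Matrix (Fin n) (Fin n) ℂ) (z : ℂ) (ε : ℝ) {ε₀ : ℝ}
    (hε₀ : 0 < ε₀) {u : ℝ × ℝ} (hu : u ≠ 0) (s : ℝ × ℝ) :
    rIntegral A z ε ε₀ u s = outerWeight A z ε u *
      (resolventFactor (A - Matrix.scalar (Fin n) z) ((u.1 ^ 2 + u.2 ^ 2 : ℝ) : ℂ) (n : ℂ)⁻¹ ε₀ s *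
        radialIntegral n ε ε₀ s) := by
  simp only [rIntegral, integrand_eq hn A z ε hε₀ hu]
  rw [integral_const_mul, radialIntegral, mul_assoc]

/-- The factor det (Y₀ + |u|²) from exp (nF₁) is what `det_rank_two_perturbation` needs to recombine
with `quadFactor` into the perturbed determinant. -/
theorem tIntegral_eq (hn : n ≠ 0) (A : Matrix (Fin n) (Fin n) ℂ) (z : ℂ) {ε ε₀ : ℝ}
    (hε : 0 < ε) (hε₀ : 0 < ε₀) {u : ℝ × ℝ} (hu : u ≠ 0) :
    tIntegral A z ε ε₀ u = ((Real.pi : ℂ) ^ (2 * n))⁻¹ * (Real.pi ^ 2 / n ^ 2) *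
      (((u.1 : ℂ) + ε) * Complex.exp (-(n : ℂ) * (((u.1 : ℂ) + ε) ^ 2 + (u.2 : ℂ) ^ 2)) *
        ∫ x, vectorIntegrand (A - Matrix.scalar (Fin n) z) ε (n : ℝ)⁻¹
          ((u.1 : ℂ) ^ 2 + (u.2 : ℂ) ^ 2) x) := by
  have hN : (0 : ℝ) < n := by positivity
  have hq := sq_add_sq_pos hu
  simp only [tIntegral, rIntegral_eq hn A z ε hε₀ hu]
  rw [integral_const_mul, (integral_resolventFactor_mul_radialIntegral hn _ hq _ hN hε hε₀).2,
    outerWeight]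
  have hdet := det_Y₀_add_ne_zero A z hq
  have hv : ∀ x, vectorIntegrand (A - Matrix.scalar (Fin n) z) ε (n : ℝ)⁻¹
      ((u.1 : ℂ) ^ 2 + (u.2 : ℂ) ^ 2) x =
      (Y₀ A z + Matrix.scalar (Fin n) ((u.1 ^ 2 + u.2 ^ 2 : ℝ) : ℂ)).det *
      (Complex.exp (-ε * sqNorm x.1 - ε * sqNorm x.2) *
        Complex.exp (-((n : ℝ)⁻¹ : ℝ) * (sqNorm x.1 * sqNorm x.2)) *
        (quadFactor (A - Matrix.scalar (Fin n) z) (((A - Matrix.scalar (Fin n) z) *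
          (A - Matrix.scalar (Fin n) z)ᴴ + Matrix.scalar (Fin n)
            ((u.1 ^ 2 + u.2 ^ 2 : ℝ) : ℂ))⁻¹) (n : ℂ)⁻¹ x *
          osc (A - Matrix.scalar (Fin n) z) x)) := by
    intro x
    have h := det_rank_two_perturbation (A - Matrix.scalar (Fin n) z)
      ((u.1 ^ 2 + u.2 ^ 2 : ℝ) : ℂ) (n : ℂ)⁻¹ hdet x
    have hc : (((n : ℝ)⁻¹ : ℝ) : ℂ) = (n : ℂ)⁻¹ := by push_cast; rfl
    have hq' : (u.1 : ℂ) ^ 2 + (u.2 : ℂ) ^ 2 = ((u.1 ^ 2 + u.2 ^ 2 : ℝ) : ℂ) := by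
      push_cast; rfl
    rw [vectorIntegrand, hq', hc, h, Y₀]
    ring
  simp only [hv]
  rw [integral_const_mul]
  simp only [Y₀, Complex.ofReal_add, Complex.ofReal_pow, Complex.ofReal_natCast]
  ring

theorem ae_ne_zero_real_prod : ∀ᵐ u : ℝ × ℝ, u ≠ 0 :=
  (ae_iff.2 (by simp))

theorem converges (hn : n ≠ 0) (A : Matrix (Fin n) (Fin n) ℂ) (z : ℂ) {ε ε₀ : ℝ}
    (hε : 0 < ε) (hε₀ : 0 < ε₀) : Converges A z ε ε₀ := by
  have hN : (0 : ℝ) < n := by positivity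
  refine ⟨fun u s hu => ?_, fun u hu => ?_, ?_⟩
  · have hP : PolyGrowth fun r : ℝ × ℝ => (r.1 * r.2 : ℂ) :=
      polyGrowth_ofReal.comp_fst.mul polyGrowth_ofReal.comp_snd
    refine Integrable.integrableOn ?_
    simp only [funext (integrand_eq hn A z ε hε₀ hu s)]
    exact (integrable_mul_radialKernel hN hε _ hP).const_mul _
  · rw [funext (rIntegral_eq hn A z ε hε₀ hu)]
    exact (integral_resolventFactor_mul_radialIntegral hn _ (sq_add_sq_pos hu) _ hN hε
      hε₀).1.const_mul _
  -- Up to a constant and the null set {0}, the inner integral is a marginal of a jointly integrable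
  -- function.
  · have h := (integrable_vectorIntegrand (A - Matrix.scalar (Fin n) z) hε
      (inv_nonneg.2 hN.le) hN).integral_prod_left
    refine (h.const_mul (((Real.pi : ℂ) ^ (2 * n))⁻¹ * (Real.pi ^ 2 / n ^ 2))).congr ?_
    filter_upwards [ae_ne_zero_real_prod] with u hu
    rw [tIntegral_eq hn A z hε hε₀ hu]
    rw [integral_const_mul, Complex.ofReal_natCast]

/-- Both sides are now the same integral over u, and the constants agree: (n³/(π³ε)) (π²/n²) = n⁻¹ ·
n²/(πε), where n² = v⁻² for v = 1/n. -/
theorem representation_eq (hn : n ≠ 0) (A : Matrix (Fin n) (Fin n) ℂ) (z : ℂ) {ε ε₀ : ℝ}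
    (hε : 0 < ε) (hε₀ : 0 < ε₀) :
    representation A z ε ε₀ = (n : ℂ)⁻¹ * ∫ h,
      (addColumns (A - Matrix.scalar (Fin n) z) h *
        (addColumns (A - Matrix.scalar (Fin n) z) h)ᴴ +
          Matrix.scalar (Fin n) ((ε : ℂ) ^ 2))⁻¹.trace
      ∂(Measure.pi fun _ : Fin n => Measure.pi fun _ : Fin n =>
        complexGaussian (1 / (n : ℝ≥0))) := by
  have hn' : (n : ℂ) ≠ 0 := Nat.cast_ne_zero.2 hn
  have hpi : (Real.pi : ℂ) ≠ 0 := Complex.ofReal_ne_zero.2 Real.pi_ne_zero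
  rw [integral_trace_resolvent _ hε (by positivity), representation,
    integral_congr_ae (g := fun u => ((Real.pi : ℂ) ^ (2 * n))⁻¹ * (Real.pi ^ 2 / n ^ 2) *
      (((u.1 : ℂ) + ε) * Complex.exp (-(n : ℂ) * (((u.1 : ℂ) + ε) ^ 2 + (u.2 : ℂ) ^ 2)) *
        ∫ x, vectorIntegrand (A - Matrix.scalar (Fin n) z) ε (n : ℝ)⁻¹
          ((u.1 : ℂ) ^ 2 + (u.2 : ℂ) ^ 2) x))
      (by filter_upwards [ae_ne_zero_real_prod] with u hu using tIntegral_eq hn A z hε hε₀ hu),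
    integral_const_mul]
  have h1 : (((1 / (n : ℝ≥0) : ℝ≥0) : ℝ) : ℂ)⁻¹ = n := by simp
  have h2 : ((1 / (n : ℝ≥0) : ℝ≥0) : ℝ) = (n : ℝ)⁻¹ := by simp
  rw [h1, h2]
  have hε' : (ε : ℂ) ≠ 0 := Complex.ofReal_ne_zero.2 hε.ne'
  field_simp

end Deterministic

/-! ### The law of the random matrix -/

section Law

variable {n : ℕ}

instance (v : ℝ≥0) : IsProbabilityMeasure (complexGaussian v) :=
  Measure.isProbabilityMeasure_map (by fun_prop)

/-- `resolventTrace` as a function of the entries of the two summands. -/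
noncomputable def resolventEntries (z : ℂ) (ε : ℝ)
    (p : (Fin n × Fin n → ℂ) × (Fin n × Fin n → ℂ)) : ℂ :=
  resolventTrace (Matrix.of (fun i j => p.1 (i, j)) + Matrix.of (fun i j => p.2 (i, j))) z ε

theorem det_resolvent_ne_zero (M : Matrix (Fin n) (Fin n) ℂ) {ε : ℝ} (hε : 0 < ε) :
    (M * Mᴴ + Matrix.scalar (Fin n) ((ε : ℂ) ^ 2)).det ≠ 0 := by
  rw [pow_two]
  exact det_add_scalar_ne_zero M (by simpa using hε) (by simpa using hε)

theorem continuous_resolventTrace (z : ℂ) {ε : ℝ} (hε : 0 < ε) :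
    Continuous fun M : Matrix (Fin n) (Fin n) ℂ => resolventTrace M z ε := by
  simp only [resolventTrace, Matrix.inv_def, Ring.inverse_eq_inv']
  have h : Continuous fun M : Matrix (Fin n) (Fin n) ℂ =>
      (M - Matrix.scalar (Fin n) z) * (M - Matrix.scalar (Fin n) z)ᴴ +
        Matrix.scalar (Fin n) ((ε : ℂ) ^ 2) := by fun_prop
  refine continuous_const.mul (Continuous.matrix_trace ?_)
  exact (h.matrix_det.inv₀ fun M => det_resolvent_ne_zero _ hε).smul h.matrix_adjugate

theorem continuous_resolventEntries (z : ℂ) {ε : ℝ} (hε : 0 < ε) :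
    Continuous (resolventEntries (n := n) z ε) := by
  refine (continuous_resolventTrace z hε).comp (Continuous.add ?_ ?_)
  · exact continuous_matrix fun i j => by simp only [Matrix.of_apply]; fun_prop
  · exact continuous_matrix fun i j => by simp only [Matrix.of_apply]; fun_prop

/-- After diagonalization this is a mean of (λₖ + ε²)⁻¹ with λₖ ≥ 0. The bound is deterministic, so
integrability holds whatever the law of A₀. -/
theorem norm_resolventTrace_le (M : Matrix (Fin n) (Fin n) ℂ) (z : ℂ) {ε : ℝ} (hε : 0 < ε) :
    ‖resolventTrace M z ε‖ ≤ (ε ^ 2)⁻¹ := by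
  obtain ⟨U, lam, hU, hlam, hd⟩ := exists_diagonalization (M - Matrix.scalar (Fin n) z)
  have hUU : U * Uᴴ = 1 := mul_eq_one_comm.1 hU
  have hne : ∀ k, (lam k : ℂ) + (ε : ℂ) ^ 2 ≠ 0 := fun k => by
    have := hlam k
    exact_mod_cast (by positivity : lam k + ε ^ 2 ≠ 0)
  have htr : ((M - Matrix.scalar (Fin n) z) * (M - Matrix.scalar (Fin n) z)ᴴ +
      Matrix.scalar (Fin n) ((ε : ℂ) ^ 2))⁻¹.trace = ∑ k, ((lam k : ℂ) + (ε : ℂ) ^ 2)⁻¹ := by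
    rw [← Matrix.trace_diagonal, ← diagonal_add_scalar_inv hne, ← hd, inv_conj_add_scalar hU,
      Matrix.trace_mul_comm, ← mul_assoc, hUU, one_mul]
  rw [resolventTrace, htr, norm_mul]
  have hk : ∀ k, ‖((lam k : ℂ) + (ε : ℂ) ^ 2)⁻¹‖ ≤ (ε ^ 2)⁻¹ := fun k => by
    have h := hlam k
    rw [norm_inv, show (lam k : ℂ) + (ε : ℂ) ^ 2 = ((lam k + ε ^ 2 : ℝ) : ℂ) by push_cast; rfl,
      Complex.norm_real, Real.norm_of_nonneg (by positivity)]
    exact inv_anti₀ (by positivity) (by linarith)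
  have hs : ‖∑ k, ((lam k : ℂ) + (ε : ℂ) ^ 2)⁻¹‖ ≤ n * (ε ^ 2)⁻¹ := by
    simpa using norm_sum_le_of_le Finset.univ fun k _ => hk k
  rw [norm_inv, Complex.norm_natCast]
  rcases eq_or_ne n 0 with rfl | hn
  · simp; positivity
  · have : (0 : ℝ) < n := by positivity
    rw [inv_mul_le_iff₀ this]
    exact hs

/-- Passes from independent columns, for which the averages were computed, to independent entries;
the swap occurs because the column index comes first in the iterated product. -/
theorem map_pi_pi_uncurry_swap {ι κ α : Type*} [Fintype ι] [Fintype κ] [MeasurableSpace α]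
    (μ : Measure α) [SigmaFinite μ] :
    (Measure.pi fun _ : κ => Measure.pi fun _ : ι => μ).map (fun h (p : ι × κ) => h p.2 p.1) =
      Measure.pi fun _ : ι × κ => μ := by
  refine (Measure.pi_eq fun s hs => ?_).symm
  rw [Measure.map_apply (by fun_prop) (.univ_pi hs)]
  have : (fun (h : κ → ι → α) (p : ι × κ) => h p.2 p.1) ⁻¹' univ.pi s =
      univ.pi fun j => univ.pi fun i => s (i, j) := by
    ext h
    simp only [mem_preimage, mem_univ_pi, Prod.forall]
    exact forall_comm
  rw [this, Measure.pi_pi, Fintype.prod_prod_type_right]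
  simp only [Measure.pi_pi]

variable {Ω : Type*} [MeasurableSpace Ω] {P : Measure Ω} {H₀ : Ω → Matrix (Fin n) (Fin n) ℂ}

theorem IsComplexGinibre.map_entries [IsProbabilityMeasure P] (h : IsComplexGinibre P H₀) :
    P.map (entries H₀) = Measure.pi fun _ => complexGaussian (1 / (n : ℝ≥0)) := by
  have hm : ∀ p : Fin n × Fin n, AEMeasurable (fun ω => H₀ ω p.1 p.2) P := fun p =>
    ((measurable_pi_apply p).comp h.measurable).aemeasurable
  have := (iIndepFun_iff_map_fun_eq_pi_map hm).1 h.indep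
  rw [show entries H₀ = fun ω (p : Fin n × Fin n) => H₀ ω p.1 p.2 from rfl, this]
  simp only [h.law]

theorem resolventTrace_addColumns (A : Matrix (Fin n) (Fin n) ℂ) (z : ℂ) (ε : ℝ)
    (h : Fin n → Fin n → ℂ) :
    resolventEntries z ε (fun p => A p.1 p.2, fun p => h p.2 p.1) = (n : ℂ)⁻¹ *
      (addColumns (A - Matrix.scalar (Fin n) z) h *
        (addColumns (A - Matrix.scalar (Fin n) z) h)ᴴ +
          Matrix.scalar (Fin n) ((ε : ℂ) ^ 2))⁻¹.trace := by
  have : Matrix.of (fun i j => A i j) + Matrix.of (fun i j => h j i) - Matrix.scalar (Fin n) z =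
      addColumns (A - Matrix.scalar (Fin n) z) h := by
    ext i j
    simp only [addColumns, Matrix.sub_apply, Matrix.add_apply, Matrix.of_apply]
    ring
  simp only [resolventEntries, resolventTrace, this]

/-- The Ginibre average of the resolvent trace is the integral representation. -/
theorem integral_resolventEntries (hn : n ≠ 0) (A : Matrix (Fin n) (Fin n) ℂ) (z : ℂ) {ε ε₀ : ℝ}
    (hε : 0 < ε) (hε₀ : 0 < ε₀) :
    ∫ h, resolventEntries z ε (fun p => A p.1 p.2, h)
      ∂(Measure.pi fun _ : Fin n × Fin n => complexGaussian (1 / (n : ℝ≥0))) =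
      representation A z ε ε₀ := by
  rw [representation_eq hn A z hε hε₀, ← map_pi_pi_uncurry_swap, integral_map]
  · simp only [resolventTrace_addColumns]
    rw [integral_const_mul]
  · exact Measurable.aemeasurable (by fun_prop)
  · exact ((continuous_resolventEntries z hε).comp (by fun_prop)).aestronglyMeasurable

theorem integrable_resolventTrace [IsFiniteMeasure P] {A₀ : Ω → Matrix (Fin n) (Fin n) ℂ}
    (hA : Measurable (entries A₀)) (hH : Measurable (entries H₀)) (z : ℂ) {ε : ℝ} (hε : 0 < ε) :
    Integrable (fun ω => resolventTrace (A₀ ω + H₀ ω) z ε) P := by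
  refine .of_bound (C := (ε ^ 2)⁻¹) ?_ (.of_forall fun ω => norm_resolventTrace_le _ _ hε)
  exact ((continuous_resolventEntries z hε).measurable.comp
    (hA.prodMk hH)).aestronglyMeasurable

theorem IsComplexGinibre.condExp_resolventTrace [IsProbabilityMeasure P]
    (h : IsComplexGinibre P H₀) (hn : n ≠ 0) {A₀ : Ω → Matrix (Fin n) (Fin n) ℂ}
    (hA : Measurable (entries A₀)) (hind : IndepFun (entries A₀) (entries H₀) P) (z : ℂ)
    {ε ε₀ : ℝ} (hε : 0 < ε) (hε₀ : 0 < ε₀) :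
    P[fun ω => resolventTrace (A₀ ω + H₀ ω) z ε |
      MeasurableSpace.comap (entries A₀) inferInstance]
      =ᵐ[P] fun ω => representation (A₀ ω) z ε ε₀ := by
  have hH := h.measurable.aemeasurable (μ := P)
  have h1 := condExp_prod_ae_eq_integral_condDistrib (μ := P) hA hH
    (continuous_resolventEntries (n := n) z hε).stronglyMeasurable
    (integrable_resolventTrace hA h.measurable z hε)
  -- By independence the joint law is a product, so the conditional law of the entries of H₀ does
  -- not depend on A₀.
  have h2 : condDistrib (entries H₀) (entries A₀) P =ᵐ[P.map (entries A₀)]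
      Kernel.const _ (P.map (entries H₀)) := by
    have := Measure.isProbabilityMeasure_map hH
    refine condDistrib_ae_eq_of_measure_eq_compProd _ hH ?_
    rw [Measure.compProd_const]
    exact (indepFun_iff_map_prod_eq_prod_map_map hA.aemeasurable hH).1 hind
  refine h1.trans ?_
  filter_upwards [ae_of_ae_map hA.aemeasurable h2] with ω hω
  rw [hω, Kernel.const_apply, h.map_entries]
  exact integral_resolventEntries hn (A₀ ω) z hε hε₀

theorem IsComplexGinibre.T_const [IsProbabilityMeasure P]
    (h : IsComplexGinibre P H₀) (hn : n ≠ 0) (A : Matrix (Fin n) (Fin n) ℂ) (z : ℂ)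
    {ε ε₀ : ℝ} (hε : 0 < ε) (hε₀ : 0 < ε₀) :
    T P (fun _ => A) H₀ z ε = representation A z ε ε₀ := by
  have hc : Continuous fun x : Fin n × Fin n → ℂ => resolventEntries z ε (fun p => A p.1 p.2, x) :=
    (continuous_resolventEntries z hε).comp (by fun_prop)
  rw [← integral_resolventEntries hn A z hε hε₀, ← h.map_entries,
    integral_map h.measurable.aemeasurable hc.aestronglyMeasurable]
  rfl

end Law

end DeformedGinibre

/-! ### Deterministic and random deformations -/

theorem proposition1 {Ω : Type*} [MeasurableSpace Ω] (P : Measure Ω) [IsProbabilityMeasure P]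
    {n : ℕ} (hn : 1 ≤ n) (H₀ : Ω → Matrix (Fin n) (Fin n) ℂ)
    (hH₀ : DeformedGinibre.IsComplexGinibre P H₀)
    (z : ℂ) (ε ε₀ : ℝ) (hε : 0 < ε) (hε₀ : 0 < ε₀) :
    -- deterministic deformation
    (∀ A : Matrix (Fin n) (Fin n) ℂ,
      DeformedGinibre.Converges A z ε ε₀ ∧
      Integrable (fun ω => DeformedGinibre.resolventTrace (A + H₀ ω) z ε) P ∧
      DeformedGinibre.T P (fun _ => A) H₀ z ε = DeformedGinibre.representation A z ε ε₀) ∧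
    -- random deformation independent of `H₀`: the formula holds conditionally on `A₀`,
    -- and after averaging over `A₀`
    (∀ A₀ : Ω → Matrix (Fin n) (Fin n) ℂ, Measurable (DeformedGinibre.entries A₀) →
      IndepFun (DeformedGinibre.entries A₀) (DeformedGinibre.entries H₀) P →
      Integrable (fun ω => DeformedGinibre.resolventTrace (A₀ ω + H₀ ω) z ε) P ∧
      P[fun ω => DeformedGinibre.resolventTrace (A₀ ω + H₀ ω) z ε |
          MeasurableSpace.comap (DeformedGinibre.entries A₀) inferInstance]
        =ᵐ[P] (fun ω => DeformedGinibre.representation (A₀ ω) z ε ε₀) ∧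
      DeformedGinibre.T P A₀ H₀ z ε =
        ∫ ω, DeformedGinibre.representation (A₀ ω) z ε ε₀ ∂P) := by
  have hn' : n ≠ 0 := by omega
  refine ⟨fun A => ⟨DeformedGinibre.converges hn' A z hε hε₀,
    DeformedGinibre.integrable_resolventTrace (A₀ := fun _ => A) measurable_const
      hH₀.measurable z hε, hH₀.T_const hn' A z hε hε₀⟩, fun A₀ hA hind => ?_⟩
  have hc := hH₀.condExp_resolventTrace hn' hA hind z hε hε₀
  refine ⟨DeformedGinibre.integrable_resolventTrace hA hH₀.measurable z hε, hc, ?_⟩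
  rw [← integral_congr_ae hc, integral_condExp hA.comap_le, DeformedGinibre.T]
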